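/- **Setting.** Let $\hat{\mathbb C}=\mathbb C\cup\{\infty\}$ and let $\mathrm{M\ddot ob}$ be the group of holomorphic and antiholomorphic Möbius transformations of $\hat{\mathbb C}$. A *circle* means an oriented generalized circle (circle or line) in $\hat{\mathbb C}$, with a chosen side as its interior; $\sigma_d\in\mathrm{M\ddot ob}$ is the reflection across $d$. A collection of circles accumulates at $x$ if every open neighbourhood of $x$ contains infinitely many of its circles. The tangency graph $G_B$ of a collection $B$ has a vertex for each circle and an edge for each tangent pair. Let $B$ (the base configuration) and $\hat B$ (the dual configuration) be collections of circles such that: 1. the circles of $B$ are pairwise disjoint or tangent, with disjoint interiors, and likewise for $\hat B$; 2. $G_B$ and $G_{\hat B}$ are nontrivial, connected, and dual to each other: with their natural plane drawings on the sphere punctured at the accumulation point of $B\cup\hat B$ (if there is one; a tangency at that point is not drawn), the vertices of each graph correspond to the faces of the other and edges correspond to edges, preserving incidence; 3. a circle of $B$ and a circle of $\hat B$ intersect exactly when they correspond to a face-vertex pair under this duality, and then they intersect orthogonally; otherwise their interiors are disjoint; 4. $B\cup\hat B$ has at most one accumulation point. Let $\mathscr P$ be the orbit of $B$ under the group $\Gamma_1=\langle\sigma_d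 : d\in\hat B\rangle$, and let $\Gamma_2=\{g\in\mathrm{M\ddot ob}: g(B)=B,\ g(\hat B)=\hat B\}$. The *maximal reflective subgroup* of $\Gamma_2$ is the subgroup generated by all reflections across circles that lie in $\Gamma_2$. The *residual set* of a collection of circles is the set of points of $\hat{\mathbb C}$ not in the interior of any of them. A collection of circles whose interiors are pairwise disjoint and together dense in $\hat{\mathbb C}$ is *Kleinian* if its residual set is the limit set of a geometrically finite discrete group of isometries of $\mathbb H^3$ (where $\partial\mathbb H^3=\hat{\mathbb C}$), and *crystallographic* if its residual set is the limit set of such a group that is generated by reflections across hyperbolic planes. **Theorem.** The packing $\mathscr P$ is Kleinian if any of the following conditions holds: 1. $B\cup\hat B$ is finite; 2. after applying some Möbius transformation to $B$ and $\hat B$, $B\cup\hat B$ is a strip configuration (it contains two parallel lines) and $\Gamma_2$ contains a nontrivial translation; 3. after applying some Möbius transformation to $B$ and $\hat B$, $\Gamma_2$ contains two translations by vectors that are linearly independent over $\mathbb R$. Furthermore, $\mathscr P$ is crystallographic if any of the conditions (1)–(3) holds with $\Gamma_2$ replaced by the maximal reflective subgroup of $\Gamma_2$. -/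

import Mathlib

open Set Topology

noncomputable section

namespace CirclePacking

/-- The extended complex plane, with the topology of the sphere. -/
abbrev Sphere : Type := OnePoint ℂ

/-! ### Oriented generalized circles -/

/-- An oriented generalized circle, given by the real equation
`a |z|² + 2 Re (conj b · z) + c = 0`, normalized by `|b|² - a c = 1`; the interior is the side on
which the left-hand side is negative. A Euclidean circle of centre `m` and radius `r` with bounded
interior is `a = 1 / r`, `b = - m / r`, `c = (|m|² - r²) / r`; `a = 0` gives a line; changing all
signs reverses the orientation. The normalization makes the triple unique. -/
@[ext]
structure GenCircle where
  a : ℝ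
  b : ℂ
  c : ℝ
  normalized : ‖b‖ ^ 2 - a * c = 1

namespace GenCircle

/-- The left-hand side of the equation. Its sign at `∞` is that of the leading coefficient. -/
def form (C : GenCircle) (x : Sphere) : ℝ :=
  x.elim C.a (fun z : ℂ => C.a * ‖z‖ ^ 2 + 2 * ((starRingEnd ℂ) C.b * z).re + C.c)

/-- The points of the circle (a line contains `∞`). -/
def carrier (C : GenCircle) : Set Sphere := {x | C.form x = 0}

/-- The interior, an open disc of the sphere bounded by the circle. -/
def interior (C : GenCircle) : Set Sphere := {x | C.form x < 0}

/-- Two circles are tangent if they have exactly one point in common. -/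
def Tangent (C C' : GenCircle) : Prop := ∃ x, C.carrier ∩ C'.carrier = {x}

/-- Two circles are orthogonal (meet at right angles). For Euclidean circles with centres `m, m'`
and radii `r, r'` this says `|m - m'|² = r² + r'²`. -/
def Orthogonal (C C' : GenCircle) : Prop :=
  C.a * C'.c + C.c * C'.a = 2 * (C.b * (starRingEnd ℂ) C'.b).re

/-- The circle `C` is a straight line. -/
def IsLine (C : GenCircle) : Prop := OnePoint.infty ∈ C.carrier

/-- `C` and `C'` are two (distinct) parallel lines: their only common point is `∞`. -/
def ParallelLines (C C' : GenCircle) : Prop :=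
  C.IsLine ∧ C'.IsLine ∧ C.carrier ∩ C'.carrier = {OnePoint.infty}

end GenCircle

/-! ### Möbius transformations -/

/-- Complex conjugation on the sphere. -/
def conjPerm : Equiv.Perm Sphere :=
  (Homeomorph.onePointCongr Complex.conjCLE.toHomeomorph).toEquiv

theorem conjPerm_apply (x : Sphere) : conjPerm x = OnePoint.map (starRingEnd ℂ) x := rfl

theorem conjPerm_conjPerm (x : Sphere) : conjPerm (conjPerm x) = x := by
  rw [conjPerm_apply, conjPerm_apply]
  induction x using OnePoint.rec <;> simp

theorem conjPerm_smul (g : GL (Fin 2) ℂ) (x : Sphere) :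
    conjPerm (g • x) = g.map (starRingEnd ℂ) • conjPerm x := by
  simpa only [conjPerm_apply] using OnePoint.map_smul (starRingEnd ℂ) g x

/-- The group of holomorphic maps `z ↦ (a z + b) / (c z + d)` and antiholomorphic maps
`z ↦ (a z̄ + b) / (c z̄ + d)`, `a d - b c ≠ 0`, of the sphere. -/
def mobius : Subgroup (Equiv.Perm Sphere) where
  carrier := {f | ∃ g : GL (Fin 2) ℂ, (∀ x, f x = g • x) ∨ (∀ x, f x = g • conjPerm x)}
  one_mem' := ⟨1, Or.inl fun x => by simp⟩
  mul_mem' := by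
    rintro f f' ⟨g, hg⟩ ⟨g', hg'⟩
    rcases hg with hg | hg
    · refine ⟨g * g', ?_⟩
      rcases hg' with hg' | hg'
      · exact Or.inl fun x => by simp [hg, hg', mul_smul]
      · exact Or.inr fun x => by simp [hg, hg', mul_smul]
    · refine ⟨g * g'.map (starRingEnd ℂ), ?_⟩
      rcases hg' with hg' | hg'
      · exact Or.inr fun x => by simp [hg, hg', mul_smul, conjPerm_smul]
      · exact Or.inl fun x => by simp [hg, hg', mul_smul, conjPerm_smul, conjPerm_conjPerm]
  inv_mem' := by
    rintro f ⟨g, hg | hg⟩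
    · refine ⟨g⁻¹, Or.inl fun x => ?_⟩
      rw [Equiv.Perm.inv_eq_iff_eq, hg, smul_inv_smul]
    · refine ⟨(g⁻¹).map (starRingEnd ℂ), Or.inr fun x => ?_⟩
      rw [Equiv.Perm.inv_eq_iff_eq, hg, ← conjPerm_smul, conjPerm_conjPerm, smul_inv_smul]

theorem reflection_det_ne_zero (C : GenCircle) :
    Matrix.det !![-C.b, -(C.c : ℂ); (C.a : ℂ), (starRingEnd ℂ) C.b] ≠ 0 := by
  have h : (Matrix.det !![-C.b, -(C.c : ℂ); (C.a : ℂ), (starRingEnd ℂ) C.b]) = -1 := by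
    have h1 := congrArg (fun r : ℝ => (r : ℂ)) C.normalized
    have h2 := Complex.mul_conj' C.b
    push_cast at h1
    rw [Matrix.det_fin_two_of]
    linear_combination (-1 : ℂ) * h2 - h1
  rw [h]
  norm_num

/-- The reflection (inversion) across the circle `C`, `z ↦ - (b z̄ + c) / (a z̄ + b̄)`. -/
def GenCircle.reflection (C : GenCircle) : Equiv.Perm Sphere :=
  MulAction.toPerm (Matrix.GeneralLinearGroup.mkOfDetNeZero
    !![-C.b, -(C.c : ℂ); (C.a : ℂ), (starRingEnd ℂ) C.b] (reflection_det_ne_zero C)) * conjPerm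

/-- `f` is the translation `z ↦ z + v`. -/
def IsTranslation (f : Equiv.Perm Sphere) (v : ℂ) : Prop :=
  f OnePoint.infty = OnePoint.infty ∧ ∀ z : ℂ, f (z : Sphere) = ((z + v : ℂ) : Sphere)

/-- The image of a collection of oriented circles under a Möbius transformation `g`: the oriented
circles whose interiors are the images of the given interiors. -/
def mapCircles (g : Equiv.Perm Sphere) (B : Set GenCircle) : Set GenCircle :=
  {C' | ∃ C ∈ B, C'.interior = g '' C.interior}

/-! ### Base and dual configurations -/

/-- The circles are pairwise disjoint or tangent, with disjoint interiors. -/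
def DisjointOrTangent (B : Set GenCircle) : Prop :=
  ∀ C ∈ B, ∀ C' ∈ B, C ≠ C' →
    (Disjoint C.carrier C'.carrier ∨ C.Tangent C') ∧ Disjoint C.interior C'.interior

/-- The tangency graph: a vertex for every circle, an edge between each pair of tangent circles. -/
def tangencyGraph (B : Set GenCircle) : SimpleGraph B where
  Adj C C' := C ≠ C' ∧ (C : GenCircle).Tangent C'
  symm := ⟨fun C C' h => ⟨h.1.symm, by
    obtain ⟨x, hx⟩ := h.2
    exact ⟨x, by rw [Set.inter_comm]; exact hx⟩⟩⟩
  loopless := ⟨fun _ h => h.1 rfl⟩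

/-- The accumulation points of a collection of circles: every open neighbourhood contains
infinitely many of the circles. -/
def accumulationPoints (B : Set GenCircle) : Set Sphere :=
  {x | ∀ U : Set Sphere, IsOpen U → x ∈ U → {C ∈ B | C.carrier ⊆ U}.Infinite}

/-- The edges of the tangency graph as drawn on the sphere punctured at the points of `A`. Each
edge is marked by its point of tangency, which determines it when interiors are disjoint. -/
def edges (A : Set Sphere) (B : Set GenCircle) : Set Sphere :=
  {x | x ∉ A ∧ ∃ C ∈ B, ∃ C' ∈ B, C ≠ C' ∧ x ∈ C.carrier ∧ x ∈ C'.carrier}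

/-- The part of the sphere punctured at `A` that lies outside all the closed discs. -/
def outside (A : Set Sphere) (B : Set GenCircle) : Set Sphere :=
  {x | x ∉ A ∧ ∀ C ∈ B, 0 < C.form x}

/-- The faces of the natural plane drawing of the tangency graph on the sphere punctured at `A`.
The drawing is obtained by shrinking each closed disc to a vertex, the points of tangency becoming
the edges, so its faces are represented by the connected components of the complement of the
closed discs. -/
def faces (A : Set Sphere) (B : Set GenCircle) : Set (Set Sphere) :=
  {F | ∃ x ∈ outside A B, F = connectedComponentIn (outside A B) x}

/-- The vertex `C` is incident to the face `F`, in the sphere punctured at `A`. -/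
def Incident (A : Set Sphere) (C : GenCircle) (F : Set Sphere) : Prop :=
  ∃ x, x ∉ A ∧ x ∈ C.carrier ∧ x ∈ closure F

/-- A duality between the tangency graphs of `B` and `B'`, drawn on the sphere punctured at `A`:
vertices of each correspond to faces of the other, and edges to edges, so that incidence is
preserved. -/
structure GraphDuality (A : Set Sphere) (B B' : Set GenCircle) where
  face : B' ≃ faces A B
  face' : B ≃ faces A B'
  edge : edges A B ≃ edges A B'
  edge_face : ∀ (d : B') (e : edges A B),
    (e : Sphere) ∈ closure (face d : Set Sphere) ↔ (edge e : Sphere) ∈ (d : GenCircle).carrier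
  edge_face' : ∀ (c : B) (e : edges A B),
    (edge e : Sphere) ∈ closure (face' c : Set Sphere) ↔ (e : Sphere) ∈ (c : GenCircle).carrier
  vertex_face : ∀ (c : B) (d : B'), Incident A c (face d) ↔ Incident A d (face' c)

/-- `B` is a base configuration and `B'` a dual configuration. -/
structure IsBaseDual (B B' : Set GenCircle) : Prop where
  base_disjoint : DisjointOrTangent B
  dual_disjoint : DisjointOrTangent B'
  base_nontrivial : B.Nontrivial
  dual_nontrivial : B'.Nontrivial
  base_connected : (tangencyGraph B).Connected
  dual_connected : (tangencyGraph B').Connected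
  accumulation : (accumulationPoints (B ∪ B')).Subsingleton
  /-- The graphs are dual; a base and a dual circle intersect exactly when they correspond to a
  face-vertex pair, and then orthogonally; otherwise their interiors are disjoint. -/
  duality : ∃ D : GraphDuality (accumulationPoints (B ∪ B')) B B', ∀ (c : B) (d : B'),
    (((c : GenCircle).carrier ∩ (d : GenCircle).carrier).Nonempty ↔
      Incident (accumulationPoints (B ∪ B')) c (D.face d)) ∧
    (((c : GenCircle).carrier ∩ (d : GenCircle).carrier).Nonempty → (c : GenCircle).Orthogonal d) ∧
    (¬ ((c : GenCircle).carrier ∩ (d : GenCircle).carrier).Nonempty →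
      Disjoint (c : GenCircle).interior (d : GenCircle).interior)

/-! ### The packing and its groups -/

/-- The group `Γ₁` generated by the reflections across the circles of `B'`. -/
def reflectionGroup (B' : Set GenCircle) : Subgroup (Equiv.Perm Sphere) :=
  Subgroup.closure (GenCircle.reflection '' B')

/-- The packing: the orbit of `B` under the group generated by reflections across `B'`. -/
def packing (B B' : Set GenCircle) : Set GenCircle :=
  {C | ∃ g ∈ reflectionGroup B', C ∈ mapCircles g B}

/-- The Möbius transformation `g` preserves the collection `B` of oriented circles. -/
def Preserves (g : Equiv.Perm Sphere) (B : Set GenCircle) : Prop :=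
  (fun C : GenCircle => g '' C.interior) '' B = GenCircle.interior '' B

theorem preserves_iff (g : Equiv.Perm Sphere) (B : Set GenCircle) :
    Preserves g B ↔ Set.image g '' (GenCircle.interior '' B) = GenCircle.interior '' B := by
  rw [Preserves, Set.image_image]

/-- The group `Γ₂ = Sym(B, B')` of Möbius transformations preserving both `B` and `B'`. -/
def symmetryGroup (B B' : Set GenCircle) : Subgroup (Equiv.Perm Sphere) where
  carrier := {g | g ∈ mobius ∧ Preserves g B ∧ Preserves g B'}
  one_mem' := ⟨mobius.one_mem, by simp [Preserves], by simp [Preserves]⟩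
  mul_mem' := by
    have key : ∀ (g h : Equiv.Perm Sphere) (B : Set GenCircle),
        Preserves g B → Preserves h B → Preserves (g * h) B := by
      intro g h B hg hh
      rw [preserves_iff] at *
      conv_rhs => rw [← hg, ← hh]
      simp only [Set.image_image, Equiv.Perm.coe_mul, Function.comp_apply]
    rintro g h ⟨hg, hg1, hg2⟩ ⟨hh, hh1, hh2⟩
    exact ⟨mobius.mul_mem hg hh, key g h B hg1 hh1, key g h B' hg2 hh2⟩
  inv_mem' := by
    have key : ∀ (g : Equiv.Perm Sphere) (B : Set GenCircle), Preserves g B → Preserves g⁻¹ B := by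
      intro g B hg
      rw [preserves_iff] at *
      conv_lhs => rw [← hg]
      have e : ∀ x, g⁻¹ (g x) = x := g.symm_apply_apply
      simp only [Set.image_image, e, Set.image_id']
    rintro g ⟨hg, hg1, hg2⟩
    exact ⟨mobius.inv_mem hg, key g B hg1, key g B' hg2⟩

/-- The maximal reflective subgroup of a group of Möbius transformations: the subgroup generated by
all the reflections (across generalized circles) that it contains. -/
def maxReflective (G : Subgroup (Equiv.Perm Sphere)) : Subgroup (Equiv.Perm Sphere) :=
  Subgroup.closure {f | f ∈ G ∧ ∃ C : GenCircle, f = C.reflection}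

/-- The residual set: the points not in the interior of any circle. -/
def residualSet (P : Set GenCircle) : Set Sphere := {x | ∀ C ∈ P, x ∉ C.interior}

/-- A strip configuration: the collection contains two parallel lines. -/
def IsStrip (B : Set GenCircle) : Prop := ∃ C ∈ B, ∃ C' ∈ B, C.ParallelLines C'

/-- After some Möbius transformation, `B ∪ B'` is a strip configuration and `K (Γ₂)` contains a
nontrivial translation. -/
def StripCondition (K : Subgroup (Equiv.Perm Sphere) → Subgroup (Equiv.Perm Sphere))
    (B B' : Set GenCircle) : Prop :=
  ∃ g ∈ mobius, IsStrip (mapCircles g B ∪ mapCircles g B') ∧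
    ∃ f ∈ K (symmetryGroup (mapCircles g B) (mapCircles g B')), ∃ v : ℂ, v ≠ 0 ∧ IsTranslation f v

/-- After some Möbius transformation, `K (Γ₂)` contains two linearly independent translations. -/
def LatticeCondition (K : Subgroup (Equiv.Perm Sphere) → Subgroup (Equiv.Perm Sphere))
    (B B' : Set GenCircle) : Prop :=
  ∃ g ∈ mobius,
    ∃ f₁ ∈ K (symmetryGroup (mapCircles g B) (mapCircles g B')),
    ∃ f₂ ∈ K (symmetryGroup (mapCircles g B) (mapCircles g B')),
    ∃ v : Fin 2 → ℂ, LinearIndependent ℝ v ∧ IsTranslation f₁ (v 0) ∧ IsTranslation f₂ (v 1)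

/-! ### Hyperbolic space -/

/-- Hyperbolic 3-space, in the upper half-space model; its ideal boundary is `Sphere`. -/
abbrev H3 : Type := {p : ℂ × ℝ // 0 < p.2}

/-- The hyperbolic distance. -/
def hdist (p q : H3) : ℝ :=
  Real.arcosh (1 + (‖p.1.1 - q.1.1‖ ^ 2 + (p.1.2 - q.1.2) ^ 2) / (2 * p.1.2 * q.1.2))

/-- The group of isometries of hyperbolic 3-space. -/
def isometryGroup : Subgroup (Equiv.Perm H3) where
  carrier := {f | ∀ p q, hdist (f p) (f q) = hdist p q}
  one_mem' := fun _ _ => rfl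
  mul_mem' := fun {f g} hf hg p q => by
    rw [Equiv.Perm.mul_apply, Equiv.Perm.mul_apply, hf, hg]
  inv_mem' := fun {f} hf p q => by
    have e : ∀ x, f (f⁻¹ x) = x := f.apply_symm_apply
    rw [← hf, e, e]

/-- The inclusion of hyperbolic space in the one-point compactification of `ℂ × ℝ`; the closure of
the image is the compactification of hyperbolic space by its ideal boundary. -/
def ofH3 (p : H3) : OnePoint (ℂ × ℝ) := (p.1 : OnePoint (ℂ × ℝ))

/-- The inclusion of the ideal boundary in the same space, `z ↦ (z, 0)` and `∞ ↦ ∞`. -/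
def ofBoundary (x : Sphere) : OnePoint (ℂ × ℝ) := OnePoint.map (fun z : ℂ => (z, (0 : ℝ))) x

/-- The limit set of a group of isometries: the points of the ideal boundary at which an orbit
accumulates. -/
def limitSet (G : Subgroup (Equiv.Perm H3)) : Set Sphere :=
  {x | ∃ p : H3, ofBoundary x ∈ closure {y | ∃ g ∈ G, y = ofH3 (g p)}}

/-- A group of isometries is discrete (equivalently, acts properly discontinuously): only
finitely many elements move a given point by a bounded distance. -/
def IsDiscrete (G : Subgroup (Equiv.Perm H3)) : Prop :=
  ∀ (p : H3) (r : ℝ), {g | g ∈ G ∧ hdist p (g p) ≤ r}.Finite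

/-- The Dirichlet domain with centre `p` determined by a set `T` of isometries. -/
def dirichletDomain (T : Set (Equiv.Perm H3)) (p : H3) : Set H3 :=
  {q | ∀ g ∈ T, hdist q p ≤ hdist q (g p)}

/-- A geometrically finite group of isometries: a discrete group that has a finite-sided
convex fundamental polyhedron, taken as the Dirichlet domain of some point with trivial stabilizer;
finite-sided means that it is cut out by finitely many of the defining half-spaces. -/
def IsGeometricallyFinite (G : Subgroup (Equiv.Perm H3)) : Prop :=
  G ≤ isometryGroup ∧ IsDiscrete G ∧
    ∃ p : H3, (∀ g ∈ G, g p = p → g = 1) ∧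
      ∃ T : Set (Equiv.Perm H3), T.Finite ∧ T ⊆ G ∧
        dirichletDomain (G : Set (Equiv.Perm H3)) p = dirichletDomain T p

/-- The hyperbolic plane with ideal boundary `C` (a hemisphere or a vertical half-plane). -/
def hyperbolicPlane (C : GenCircle) : Set H3 :=
  {p | C.a * (‖p.1.1‖ ^ 2 + p.1.2 ^ 2) + 2 * ((starRingEnd ℂ) C.b * p.1.1).re + C.c = 0}

/-- `f` is the reflection across a hyperbolic plane: a nontrivial isometry fixing the plane
pointwise. -/
def IsReflection (f : Equiv.Perm H3) : Prop :=
  f ∈ isometryGroup ∧ f ≠ 1 ∧ ∃ C : GenCircle, ∀ p ∈ hyperbolicPlane C, f p = p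

/-- A reflection group: a group generated by reflections across hyperbolic planes. -/
def IsReflectionGroup (G : Subgroup (Equiv.Perm H3)) : Prop :=
  ∃ R : Set (Equiv.Perm H3), (∀ f ∈ R, IsReflection f) ∧ G = Subgroup.closure R

/-! ### Kleinian and crystallographic packings -/

/-- The interiors of the circles are disjoint and dense in the sphere. -/
def DisjointDense (P : Set GenCircle) : Prop :=
  (∀ C ∈ P, ∀ C' ∈ P, C ≠ C' → Disjoint C.interior C'.interior) ∧
    Dense (⋃ C ∈ P, C.interior)

/-- A Kleinian packing: its residual set is the limit set of a geometrically finite group. -/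
def IsKleinian (P : Set GenCircle) : Prop :=
  DisjointDense P ∧
    ∃ G : Subgroup (Equiv.Perm H3), IsGeometricallyFinite G ∧ residualSet P = limitSet G

/-- A crystallographic packing: its residual set is the limit set of a geometrically finite
reflection group. -/
def IsCrystallographic (P : Set GenCircle) : Prop :=
  DisjointDense P ∧
    ∃ G : Subgroup (Equiv.Perm H3),
      IsReflectionGroup G ∧ IsGeometricallyFinite G ∧ residualSet P = limitSet G

end CirclePacking

end

open Set Topology

noncomputable section

namespace CirclePacking

/-! The geometry is linear algebra in Minkowski space of signature (1, 3). An oriented circle is a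
vector of square -2, a point of the sphere a light ray, a point of hyperbolic space a future vector
of square 2, and Möbius transformations come from orthochronous Lorentz transformations. Two circles
are orthogonal when their product is 0. Circles with disjoint interiors that do not cross are those
whose sum lies in the closed future cone (`Sep`), and then the product is at least 2.

The combinatorial duality is used once, to obtain a covering statement. The part of a dual disc
outside the base discs is connected, hence lies in one face, and three base circles crossing the
dual circle identify that face (`core_subset_face`). Consequently the base and dual discs cover the
sphere up to the accumulation point (`exists_form_nonpos`), and a point in no open disc is a
tangency point of dual circles (`mem_edges_of_nonneg`). `GoodPair` records what is needed
afterwards.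

The reflections across dual circles play ping-pong. Since products of distinct dual circles are at
least 2, a reduced word carries any point outside the dual half-spaces beyond its first circle
(`Beyond.step`), and both the displacement and the depth of the last half-space (the tip) grow
linearly with the length (`add_le_mform`, `le_mform_tip`). Hence the circles of the packing are
pairwise separated. A residual point lies in tips of arbitrarily long words, which are small discs
crossed by circles of the packing, unless the reflection group carries it to the accumulation point
(`exists_word`). This gives density.

For a group Γ of symmetries of the two configurations, the reflections and Γ generate a group whose
Dirichlet domain is the Dirichlet domain of Γ cut by the dual half-spaces. It is finite-sided as
soon as only finitely many of these half-spaces matter over the domain of Γ; `SymmetryDatum`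
isolates this. The limit set of the extended group is the residual set: orbits accumulate at
residual points along tips, or along powers of a translation at the accumulation point, and they
cannot accumulate inside a disc of the packing because the packing is invariant and a point is in at
most one of its half-spaces.

It remains to choose Γ. For finite configurations it is trivial. With two independent translations,
they bound the Dirichlet domain in the plane. In a strip, one translation bounds it along the strip,
and the two parallel lines confine the dual discs across it. In the crystallographic case Γ must be
generated by reflections: all the mirrors serve for a lattice, and for a strip two mirrors
perpendicular to it (`exists_mirror`). -/

/-! ### Minkowski space -/

/-- Four-dimensional Minkowski space, as the space of triples `(a, b, c)` of coefficients of the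
expressions `a |z|² + 2 Re (conj b · z) + c`. -/
abbrev Mink : Type := ℝ × ℂ × ℝ

/-- The Lorentz form, normalized so that oriented circles have square `-2`. -/
def mform : Mink →ₗ[ℝ] Mink →ₗ[ℝ] ℝ :=
  LinearMap.mk₂ ℝ (fun X Y => X.1 * Y.2.2 + X.2.2 * Y.1 -
    2 * (X.2.1.re * Y.2.1.re + X.2.1.im * Y.2.1.im))
    (fun X Y Z => by simp; ring) (fun r X Y => by simp; ring)
    (fun X Y Z => by simp; ring) (fun r X Y => by simp; ring)

theorem mform_apply (X Y : Mink) : mform X Y = X.1 * Y.2.2 + X.2.2 * Y.1 -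
    2 * (X.2.1.re * Y.2.1.re + X.2.1.im * Y.2.1.im) := rfl

theorem mform_comm (X Y : Mink) : mform X Y = mform Y X := by
  simp only [mform_apply]; ring

theorem mform_add_sq (X Y : Mink) :
    mform (X + Y) (X + Y) = mform X X + 2 * mform X Y + mform Y Y := by
  simp only [map_add, LinearMap.add_apply, mform_comm Y X]; ring

theorem mform_sub_sq (X Y : Mink) :
    mform (X - Y) (X - Y) = mform X X - 2 * mform X Y + mform Y Y := by
  simp only [map_sub, LinearMap.sub_apply, mform_comm Y X]; ring

theorem mform_add_smul_sq (X Y : Mink) (s : ℝ) :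
    mform (X + s • Y) (X + s • Y) = mform X X + 2 * s * mform X Y + s ^ 2 * mform Y Y := by
  simp only [map_add, LinearMap.add_apply, mform_comm Y X, map_smul, LinearMap.smul_apply,
    smul_eq_mul]; ring

theorem continuous_mform : Continuous fun p : Mink × Mink => mform p.1 p.2 := by
  simp only [mform_apply]
  fun_prop

@[fun_prop]
theorem Continuous.mform {α : Type*} [TopologicalSpace α] {f g : α → Mink} (hf : Continuous f)
    (hg : Continuous g) : Continuous fun x => mform (f x) (g x) :=
  continuous_mform.comp (hf.prodMk hg)

@[fun_prop]
theorem ContinuousOn.mform {α : Type*} [TopologicalSpace α] {f g : α → Mink} {s : Set α}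
    (hf : ContinuousOn f s) (hg : ContinuousOn g s) :
    ContinuousOn (fun x => mform (f x) (g x)) s :=
  continuous_mform.comp_continuousOn (hf.prodMk hg)

/-- The trace of a vector of Minkowski space. -/
def mtrace : Mink →ₗ[ℝ] ℝ := LinearMap.fst ℝ ℝ (ℂ × ℝ) + (LinearMap.snd ℝ ℂ ℝ).comp
  (LinearMap.snd ℝ ℝ (ℂ × ℝ))

theorem mtrace_apply (X : Mink) : mtrace X = X.1 + X.2.2 := rfl

theorem mtrace_eq (X : Mink) : mtrace X = mform (1, 0, 1) X := by
  simp [mform_apply, mtrace_apply]; ring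

@[fun_prop]
theorem Continuous.mtrace {α : Type*} [TopologicalSpace α] {f : α → Mink} (hf : Continuous f) :
    Continuous fun x => mtrace (f x) := by
  simp only [mtrace_apply]; fun_prop

@[fun_prop]
theorem ContinuousOn.mtrace {α : Type*} [TopologicalSpace α] {f : α → Mink} {s : Set α}
    (hf : ContinuousOn f s) : ContinuousOn (fun x => mtrace (f x)) s := by
  simp only [mtrace_apply]; fun_prop

/-- The nonzero vectors of the closed future cone. -/
def IsFuture (X : Mink) : Prop := 0 ≤ mform X X ∧ 0 < mtrace X

theorem IsFuture.nonneg_fst {X : Mink} (hX : IsFuture X) : 0 ≤ X.1 := by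
  obtain ⟨h1, h2⟩ := hX
  rw [mform_apply] at h1; rw [mtrace_apply] at h2
  by_contra! h
  nlinarith [sq_nonneg X.2.1.re, sq_nonneg X.2.1.im]

theorem IsFuture.nonneg_snd {X : Mink} (hX : IsFuture X) : 0 ≤ X.2.2 := by
  obtain ⟨h1, h2⟩ := hX
  rw [mform_apply] at h1; rw [mtrace_apply] at h2
  by_contra! h
  nlinarith [sq_nonneg X.2.1.re, sq_nonneg X.2.1.im]

theorem IsFuture.eq_zero_of_fst {X : Mink} (hX : IsFuture X) (h : X.1 = 0) : X.2.1 = 0 := by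
  have h1 := hX.1
  rw [mform_apply, h] at h1
  apply Complex.ext <;> simp <;> nlinarith [sq_nonneg X.2.1.re, sq_nonneg X.2.1.im]

theorem IsFuture.smul {X : Mink} (hX : IsFuture X) {r : ℝ} (hr : 0 < r) : IsFuture (r • X) := by
  constructor
  · simpa using mul_nonneg hr.le (mul_nonneg hr.le hX.1)
  · simpa using mul_pos hr hX.2

/-- Multiplying by the first coordinates completes a square. This plays the role of the reverse
Cauchy–Schwarz inequality on the future cone, and later gives the distance formula `mform_eq_foot`.
-/
theorem mform_future_identity (X Y : Mink) : X.1 * Y.1 * mform X Y * 2 =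
    2 * ((X.1 * Y.2.1.re - Y.1 * X.2.1.re) ^ 2 + (X.1 * Y.2.1.im - Y.1 * X.2.1.im) ^ 2) +
      Y.1 ^ 2 * mform X X + X.1 ^ 2 * mform Y Y := by
  simp only [mform_apply]; ring

theorem IsFuture.mform_nonneg {X Y : Mink} (hX : IsFuture X) (hY : IsFuture Y) :
    0 ≤ mform X Y := by
  rcases hX.nonneg_fst.eq_or_lt with h | h
  · rw [mform_apply, hX.eq_zero_of_fst h.symm, ← h]
    simpa using mul_nonneg hX.nonneg_snd hY.nonneg_fst
  rcases hY.nonneg_fst.eq_or_lt with h' | h'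
  · rw [mform_apply, hY.eq_zero_of_fst h'.symm, ← h']
    simpa using mul_nonneg hX.nonneg_fst hY.nonneg_snd
  have := mform_future_identity X Y
  have h1 := hX.1
  have h2 := hY.1
  have : 0 ≤ X.1 * Y.1 * mform X Y := by
    have e1 := mul_nonneg (sq_nonneg Y.1) h1
    have e2 := mul_nonneg (sq_nonneg X.1) h2
    nlinarith [sq_nonneg (X.1 * Y.2.1.re - Y.1 * X.2.1.re),
      sq_nonneg (X.1 * Y.2.1.im - Y.1 * X.2.1.im)]
  exact nonneg_of_mul_nonneg_right this (mul_pos h h')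

theorem IsFuture.fst_pos {X : Mink} (hX : IsFuture X) (h : 0 < mform X X) : 0 < X.1 := by
  refine lt_of_le_of_ne hX.nonneg_fst fun h0 => ?_
  rw [mform_apply, hX.eq_zero_of_fst h0.symm, ← h0] at h
  simp at h

theorem IsFuture.mform_pos {X Y : Mink} (hX : IsFuture X) (hX' : 0 < mform X X)
    (hY : IsFuture Y) : 0 < mform X Y := by
  have h := hX.fst_pos hX'
  rcases hY.nonneg_fst.eq_or_lt with h' | h'
  · have h2 := hY.2
    rw [mtrace_apply, ← h', zero_add] at h2
    rw [mform_apply, hY.eq_zero_of_fst h'.symm, ← h']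
    simpa using mul_pos h h2
  have := mform_future_identity X Y
  have h2 := hY.1
  have : 0 < X.1 * Y.1 * mform X Y := by
    have e1 := mul_pos (pow_pos h' 2) hX'
    have e2 := mul_nonneg (sq_nonneg X.1) h2
    nlinarith [sq_nonneg (X.1 * Y.2.1.re - Y.1 * X.2.1.re),
      sq_nonneg (X.1 * Y.2.1.im - Y.1 * X.2.1.im)]
  exact pos_of_mul_pos_right this (mul_pos h h').le

/-- The trace is the product with the time-like vector `(1, 0, 1)`, and the form is negative
definite on the orthogonal complement of that vector. -/
theorem eq_zero_of_mtrace {X : Mink} (h : 0 ≤ mform X X) (h0 : mtrace X = 0) : X = 0 := by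
  rw [mform_apply] at h; rw [mtrace_apply] at h0
  have e : X.2.2 = -X.1 := by linarith
  rw [e] at h
  have h1 : X.1 = 0 := by nlinarith [sq_nonneg X.1, sq_nonneg X.2.1.re, sq_nonneg X.2.1.im]
  have h2 : X.2.1.re = 0 := by nlinarith [sq_nonneg X.1, sq_nonneg X.2.1.re, sq_nonneg X.2.1.im]
  have h3 : X.2.1.im = 0 := by nlinarith [sq_nonneg X.1, sq_nonneg X.2.1.re, sq_nonneg X.2.1.im]
  rw [h1, neg_zero] at e
  exact Prod.ext h1 (Prod.ext (Complex.ext h2 h3) e)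

theorem isFuture_or_neg {X : Mink} (h : 0 ≤ mform X X) (h0 : X ≠ 0) :
    IsFuture X ∨ IsFuture (-X) := by
  rcases lt_trichotomy (mtrace X) 0 with h1 | h1 | h1
  · right; constructor <;> simpa
  · exact absurd (eq_zero_of_mtrace h h1) h0
  · exact Or.inl ⟨h, h1⟩

/-- A nonzero causal vector is future or past, and a past one has non-positive product with every
future vector. Constructed vectors are usually certified as future in this way, without computing
their trace. -/
theorem IsFuture.of_mform_pos {X Y : Mink} (hX : IsFuture X) (hY : 0 ≤ mform Y Y)
    (h : 0 < mform X Y) : IsFuture Y := by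
  have h0 : Y ≠ 0 := by rintro rfl; simp at h
  refine (isFuture_or_neg hY h0).resolve_right fun h' => ?_
  have := hX.mform_nonneg h'
  rw [map_neg] at this
  linarith

theorem IsFuture.add {X Y : Mink} (hX : IsFuture X) (hY : IsFuture Y) : IsFuture (X + Y) := by
  refine ⟨?_, by rw [map_add]; exact add_pos hX.2 hY.2⟩
  rw [mform_add_sq]
  have := hX.mform_nonneg hY
  linarith [hX.1, hY.1]

theorem IsFuture.add_pos_sq {X Y : Mink} (hX : IsFuture X) (hX' : 0 < mform X X)
    (hY : IsFuture Y) : 0 < mform (X + Y) (X + Y) := by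
  rw [mform_add_sq]
  have := hX.mform_nonneg hY
  linarith [hY.1]

/-- A future vector orthogonal to a light-like future vector is proportional to it. -/
theorem IsFuture.eq_smul_of_mform_eq_zero {X N : Mink} (hX : IsFuture X) (hXX : mform X X = 0)
    (hN : IsFuture N) (h : mform N X = 0) : ∃ r : ℝ, N = r • X := by
  have hs : mform (X + N) (X + N) = mform N N := by
    rw [mform_add_sq, hXX, mform_comm X N, h]; ring
  have hNN : mform N N = 0 := by
    by_contra hne
    have := hN.mform_pos (lt_of_le_of_ne hN.1 (Ne.symm hne)) hX
    linarith
  refine ⟨mtrace N / mtrace X, ?_⟩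
  rw [← sub_eq_zero]
  apply eq_zero_of_mtrace
  · have := mform_add_smul_sq N X (-(mtrace N / mtrace X))
    rw [neg_smul, ← sub_eq_add_neg] at this
    rw [this, h, hXX, hNN]; simp
  · rw [map_sub, map_smul, smul_eq_mul, div_mul_cancel₀ _ hX.2.ne', sub_self]

/-! ### Points and circles as vectors -/

/-- The coefficient vector of a circle. -/
def GenCircle.vec (C : GenCircle) : Mink := (C.a, C.b, C.c)

theorem sq_norm_complex (z : ℂ) : ‖z‖ ^ 2 = z.re ^ 2 + z.im ^ 2 := by
  rw [← Complex.normSq_eq_norm_sq, Complex.normSq_apply]; ring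

theorem GenCircle.vec_sq (C : GenCircle) : mform C.vec C.vec = -2 := by
  have := C.normalized
  rw [sq_norm_complex] at this
  simp only [mform_apply, vec]
  linarith

theorem GenCircle.vec_injective : Function.Injective GenCircle.vec := fun C C' h => by
  simp only [vec, Prod.mk.injEq] at h
  exact GenCircle.ext h.1 h.2.1 h.2.2

/-- The circle with a given coefficient vector. -/
def GenCircle.ofVec (X : Mink) (h : mform X X = -2) : GenCircle where
  a := X.1
  b := X.2.1
  c := X.2.2
  normalized := by
    rw [mform_apply] at h
    rw [sq_norm_complex]; linarith

@[simp] theorem GenCircle.vec_ofVec (X : Mink) (h : mform X X = -2) : (ofVec X h).vec = X := rfl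

/-- The same circle with the other orientation. -/
def GenCircle.neg (C : GenCircle) : GenCircle :=
  ofVec (-C.vec) (by simpa using C.vec_sq)

@[simp] theorem GenCircle.vec_neg (C : GenCircle) : C.neg.vec = -C.vec := rfl

/-- The light-like vector of a point of the sphere. -/
def pvec (x : Sphere) : Mink :=
  x.elim ((0, 0, 1) : Mink) fun z : ℂ => (1, -z, ‖z‖ ^ 2)

@[simp] theorem pvec_infty : pvec OnePoint.infty = (0, 0, 1) := rfl
@[simp] theorem pvec_coe (z : ℂ) : pvec (z : Sphere) = (1, -z, ‖z‖ ^ 2) := rfl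

theorem pvec_sq (x : Sphere) : mform (pvec x) (pvec x) = 0 := by
  induction x using OnePoint.rec with
  | infty => simp [mform_apply]
  | coe z => simp [mform_apply, sq_norm_complex]; ring

theorem isFuture_pvec (x : Sphere) : IsFuture (pvec x) := by
  refine ⟨(pvec_sq x).ge, ?_⟩
  induction x using OnePoint.rec with
  | infty => simp [mtrace_apply]
  | coe z => simp [mtrace_apply]; positivity

theorem GenCircle.form_eq (C : GenCircle) (x : Sphere) : C.form x = mform C.vec (pvec x) := by
  induction x using OnePoint.rec with
  | infty => simp [form, mform_apply, vec]
  | coe z => simp [form, mform_apply, vec]; ring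

/-- The point of the sphere on a light ray. -/
def toPt (X : Mink) : Sphere := if X.1 = 0 then OnePoint.infty else ((-X.2.1 / X.1 : ℂ) : Sphere)

theorem toPt_smul_pvec (x : Sphere) {r : ℝ} (hr : r ≠ 0) : toPt (r • pvec x) = x := by
  induction x using OnePoint.rec with
  | infty => simp [toPt]
  | coe z =>
    have : (r : ℂ) ≠ 0 := by exact_mod_cast hr
    simp only [toPt, pvec_coe, Prod.smul_mk, smul_eq_mul, mul_one, hr, if_false]
    congr 1
    simp only [smul_neg, neg_neg, Complex.real_smul]
    field_simp

theorem exists_eq_smul_pvec {X : Mink} (hX : IsFuture X) (h : mform X X = 0) :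
    ∃ r : ℝ, 0 < r ∧ X = r • pvec (toPt X) := by
  rcases hX.nonneg_fst.eq_or_lt with h0 | h0
  · have h1 := hX.2
    rw [mtrace_apply, ← h0, zero_add] at h1
    refine ⟨X.2.2, h1, ?_⟩
    rw [toPt, if_pos h0.symm, pvec_infty]
    refine Prod.ext (by simp [← h0]) (Prod.ext (by simp [hX.eq_zero_of_fst h0.symm]) (by simp))
  · refine ⟨X.1, h0, ?_⟩
    have hc : (X.1 : ℂ) ≠ 0 := by exact_mod_cast h0.ne'
    rw [toPt, if_neg h0.ne', pvec_coe]
    refine Prod.ext (by simp) (Prod.ext ?_ ?_)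
    · simp only [Prod.smul_mk, Complex.real_smul, neg_div]
      field_simp
    · simp only [Prod.smul_mk, smul_eq_mul, norm_div, norm_neg, div_pow, Complex.norm_real,
        Real.norm_eq_abs, sq_abs]
      rw [mform_apply] at h
      rw [sq_norm_complex]
      field_simp
      linarith

/-- Two oriented circles whose interiors are disjoint and which do not cross. -/
def Sep (C C' : GenCircle) : Prop := IsFuture (C.vec + C'.vec)

theorem Sep.symm {C C' : GenCircle} (h : Sep C C') : Sep C' C := by
  rw [Sep, add_comm]; exact h

theorem Sep.two_le {C C' : GenCircle} (h : Sep C C') : 2 ≤ mform C.vec C'.vec := by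
  have := h.1
  rw [mform_add_sq, C.vec_sq, C'.vec_sq] at this
  linarith

theorem Sep.add_nonneg {C C' : GenCircle} (h : Sep C C') {X : Mink} (hX : IsFuture X) :
    0 ≤ mform C.vec X + mform C'.vec X := by
  have := h.mform_nonneg hX
  rwa [map_add, LinearMap.add_apply] at this

theorem Sep.add_pos {C C' : GenCircle} (h : Sep C C') {X : Mink} (hX : IsFuture X)
    (hX' : 0 < mform X X) : 0 < mform C.vec X + mform C'.vec X := by
  have := hX.mform_pos hX' h
  rwa [mform_comm, map_add, LinearMap.add_apply] at this

theorem Sep.form_add_nonneg {C C' : GenCircle} (h : Sep C C') (x : Sphere) :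
    0 ≤ C.form x + C'.form x := by
  rw [C.form_eq, C'.form_eq]; exact h.add_nonneg (isFuture_pvec x)

/-! ### The topology of the sphere -/

/-- The light-like vector of trace one representing a point of the sphere. -/
def nvec (x : Sphere) : Mink := (mtrace (pvec x))⁻¹ • pvec x

theorem mtrace_pvec_pos (x : Sphere) : 0 < mtrace (pvec x) := (isFuture_pvec x).2

theorem isFuture_nvec (x : Sphere) : IsFuture (nvec x) :=
  (isFuture_pvec x).smul (inv_pos.2 (mtrace_pvec_pos x))

theorem nvec_sq (x : Sphere) : mform (nvec x) (nvec x) = 0 := by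
  simp [nvec, pvec_sq]

theorem mtrace_nvec (x : Sphere) : mtrace (nvec x) = 1 := by
  rw [nvec, map_smul, smul_eq_mul, inv_mul_cancel₀ (mtrace_pvec_pos x).ne']

theorem toPt_nvec (x : Sphere) : toPt (nvec x) = x :=
  toPt_smul_pvec x (inv_pos.2 (mtrace_pvec_pos x)).ne'

theorem nvec_injective : Function.Injective nvec :=
  Function.LeftInverse.injective toPt_nvec

theorem nvec_toPt {X : Mink} (hX : IsFuture X) (h : mform X X = 0) :
    nvec (toPt X) = (mtrace X)⁻¹ • X := by
  obtain ⟨r, hr, e⟩ := exists_eq_smul_pvec hX h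
  conv_rhs => rw [e]
  rw [map_smul, smul_eq_mul, smul_smul, nvec]
  congr 1
  field_simp

theorem mform_pvec_pos_iff (X : Mink) (x : Sphere) :
    0 < mform X (nvec x) ↔ 0 < mform X (pvec x) := by
  rw [nvec, map_smul, smul_eq_mul]
  exact mul_pos_iff_of_pos_left (inv_pos.2 (mtrace_pvec_pos x))

theorem mform_pvec_neg_iff (X : Mink) (x : Sphere) :
    mform X (nvec x) < 0 ↔ mform X (pvec x) < 0 := by
  have := mform_pvec_pos_iff (-X) x
  simpa using this

theorem GenCircle.form_pos_iff (C : GenCircle) (x : Sphere) :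
    0 < C.form x ↔ 0 < mform C.vec (nvec x) := by
  rw [mform_pvec_pos_iff, C.form_eq]

theorem GenCircle.form_neg_iff (C : GenCircle) (x : Sphere) :
    C.form x < 0 ↔ mform C.vec (nvec x) < 0 := by
  rw [mform_pvec_neg_iff, C.form_eq]

theorem GenCircle.form_nonpos_iff (C : GenCircle) (x : Sphere) :
    C.form x ≤ 0 ↔ mform C.vec (nvec x) ≤ 0 := by
  rw [← not_lt, ← not_lt, C.form_pos_iff]

theorem nvec_coe (z : ℂ) :
    nvec (z : Sphere) = (1 + ‖z‖ ^ 2)⁻¹ • ((1, -z, ‖z‖ ^ 2) : Mink) := by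
  simp [nvec, mtrace_apply]

theorem nvec_infty : nvec OnePoint.infty = (0, 0, 1) := by
  simp [nvec, mtrace_apply]

theorem tendsto_norm_div_atTop :
    Filter.Tendsto (fun r : ℝ => (1 + r ^ 2)⁻¹ * r) Filter.atTop (𝓝 0) := by
  refine squeeze_zero' (g := fun r => r⁻¹) ?_ ?_ tendsto_inv_atTop_zero
  · filter_upwards [Filter.eventually_gt_atTop 0] with r hr
    positivity
  · filter_upwards [Filter.eventually_gt_atTop 0] with r hr
    rw [inv_mul_le_iff₀ (by positivity)]
    field_simp
    nlinarith

theorem tendsto_inv_one_add_sq_atTop :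
    Filter.Tendsto (fun r : ℝ => (1 + r ^ 2)⁻¹) Filter.atTop (𝓝 0) := by
  refine Filter.Tendsto.inv_tendsto_atTop ?_
  exact Filter.tendsto_atTop_add_const_left _ _ (Filter.tendsto_pow_atTop two_ne_zero)

theorem continuous_nvec : Continuous nvec := by
  rw [OnePoint.continuous_iff]
  constructor
  · rw [Filter.coclosedCompact_eq_cocompact, nvec_infty]
    have h1 : Filter.Tendsto (fun z : ℂ => ‖z‖) (Filter.cocompact ℂ) Filter.atTop :=
      tendsto_norm_cocompact_atTop
    have e : (fun z : ℂ => nvec (z : Sphere)) = fun z : ℂ => (((1 + ‖z‖ ^ 2)⁻¹,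
        -((1 + ‖z‖ ^ 2)⁻¹ • z), 1 - (1 + ‖z‖ ^ 2)⁻¹) : Mink) := by
      funext z
      rw [nvec_coe]
      refine Prod.ext (by simp) (Prod.ext (by simp) ?_)
      simp only [Prod.smul_mk, smul_eq_mul]
      field_simp
      ring
    rw [e]
    refine (tendsto_inv_one_add_sq_atTop.comp h1).prodMk_nhds (Filter.Tendsto.prodMk_nhds ?_ ?_)
    · rw [show (0 : ℂ) = -0 by simp]
      refine Filter.Tendsto.neg ?_
      rw [tendsto_zero_iff_norm_tendsto_zero]
      refine (tendsto_norm_div_atTop.comp h1).congr fun z => ?_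
      simp only [Function.comp_apply]
      rw [norm_smul, Real.norm_eq_abs, abs_of_pos (by positivity)]
    · have := (tendsto_inv_one_add_sq_atTop.comp h1).const_sub 1
      simpa using this
  · have h1 : Continuous fun z : ℂ => (1 + ‖z‖ ^ 2)⁻¹ :=
      Continuous.inv₀ (by fun_prop) fun z => by positivity
    have h2 : Continuous fun z : ℂ => ((1, -z, ‖z‖ ^ 2) : Mink) := by fun_prop
    exact (h1.smul h2).congr fun z => (nvec_coe z).symm

/-- The sphere is compact, so continuity and injectivity suffice. Neighbourhoods on the sphere can
then be measured by norms of trace-one vectors. -/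
theorem isClosedEmbedding_nvec : IsClosedEmbedding nvec :=
  continuous_nvec.isClosedEmbedding nvec_injective

theorem GenCircle.isOpen_interior (C : GenCircle) : IsOpen C.interior := by
  have : C.interior = {x | mform C.vec (nvec x) < 0} := by
    ext x; exact C.form_neg_iff x
  rw [this]
  exact isOpen_lt (by have := continuous_nvec; fun_prop) continuous_const

theorem isOpen_mform_pos (X : Mink) : IsOpen {x : Sphere | 0 < mform X (pvec x)} := by
  simp only [← mform_pvec_pos_iff]
  exact isOpen_lt continuous_const (by have := continuous_nvec; fun_prop)

theorem GenCircle.isOpen_form_pos (C : GenCircle) : IsOpen {x | 0 < C.form x} := by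
  simp only [C.form_eq]; exact isOpen_mform_pos _

theorem continuousOn_toPt : ContinuousOn toPt {X | IsFuture X ∧ mform X X = 0} := by
  rw [isClosedEmbedding_nvec.isInducing.continuousOn_iff]
  refine ContinuousOn.congr (f := fun X => (mtrace X)⁻¹ • X) ?_ fun X hX => nvec_toPt hX.1 hX.2
  have h1 : ContinuousOn (fun X : Mink => (mtrace X)⁻¹) {X | IsFuture X ∧ mform X X = 0} :=
    ContinuousOn.inv₀ (by fun_prop) fun X hX => hX.1.2.ne'
  exact h1.smul continuousOn_id

/-! ### Connectedness of regions bounded by circles -/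

/-- From a causal vector orthogonal to `u`, the ray in direction `u` meets the light cone at this
parameter. It parametrizes a disc by the hyperbolic plane over its boundary circle, so that
convexity in the hyperplane gives connectedness on the sphere. -/
theorem isFuture_add_sqrt_smul {u m : Mink} (hu : mform u u = -2) (hm : IsFuture m)
    (h : mform m u = 0) : IsFuture (m + √(mform m m / 2) • u) ∧
      mform (m + √(mform m m / 2) • u) (m + √(mform m m / 2) • u) = 0 := by
  have h0 : mform (m + √(mform m m / 2) • u) (m + √(mform m m / 2) • u) = 0 := by
    rw [mform_add_smul_sq, h, hu, Real.sq_sqrt (by linarith [hm.1])]; ring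
  refine ⟨?_, h0⟩
  rcases hm.1.eq_or_lt with h1 | h1
  · rw [← h1]; simpa using hm
  · refine hm.of_mform_pos h0.ge ?_
    rw [map_add, map_smul, h]; simpa using h1

theorem isPreconnected_image_dome {u : Mink} (hu : mform u u = -2) {K : Set Mink}
    (hK : Convex ℝ K) (h : ∀ m ∈ K, IsFuture m ∧ mform m u = 0) :
    IsPreconnected ((fun m => toPt (m + √(mform m m / 2) • u)) '' K) := by
  refine hK.isPreconnected.image _ ?_
  refine continuousOn_toPt.comp (t := {X | IsFuture X ∧ mform X X = 0}) (by fun_prop) ?_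
  exact fun m hm => isFuture_add_sqrt_smul hu (h m hm).1 (h m hm).2

theorem mform_toPt_pos_iff {X : Mink} (hX : IsFuture X) (h : mform X X = 0) (Y : Mink) :
    0 < mform Y (pvec (toPt X)) ↔ 0 < mform Y X := by
  obtain ⟨r, hr, e⟩ := exists_eq_smul_pvec hX h
  conv_rhs => rw [e, map_smul, smul_eq_mul]
  exact (mul_pos_iff_of_pos_left hr).symm

theorem mform_toPt_nonneg_iff {X : Mink} (hX : IsFuture X) (h : mform X X = 0) (Y : Mink) :
    0 ≤ mform Y (pvec (toPt X)) ↔ 0 ≤ mform Y X := by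
  have := mform_toPt_pos_iff hX h (-Y)
  simp only [map_neg, LinearMap.neg_apply, neg_pos] at this
  rw [← not_lt, this, not_lt]

theorem IsFuture.convex_comb {X Y : Mink} (hX : IsFuture X) (hY : IsFuture Y) {a b : ℝ}
    (ha : 0 ≤ a) (hb : 0 ≤ b) (hab : a + b = 1) : IsFuture (a • X + b • Y) := by
  rcases ha.eq_or_lt with rfl | ha
  · rw [zero_add] at hab; subst hab; simpa using hY
  rcases hb.eq_or_lt with rfl | hb
  · rw [add_zero] at hab; subst hab; simpa using hX
  exact (hX.smul ha).add (hY.smul hb)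

theorem pos_convex_comb {x y a b : ℝ} (hx : 0 < x) (hy : 0 < y) (ha : 0 ≤ a) (hb : 0 ≤ b)
    (hab : a + b = 1) : 0 < a * x + b * y := by
  rcases ha.eq_or_lt with rfl | ha
  · rw [zero_add] at hab; subst hab; simpa using hy
  · have := mul_pos ha hx
    have := mul_nonneg hb hy.le
    linarith

/-- The part of a disc cut out by circles orthogonal to its boundary is connected. -/
theorem isPreconnected_dome {u : Mink} (hu : mform u u = -2) {𝒞 : Set Mink}
    (h : ∀ v ∈ 𝒞, mform v u = 0) :
    IsPreconnected {x : Sphere | mform u (pvec x) < 0 ∧ ∀ v ∈ 𝒞, 0 < mform v (pvec x)} := by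
  -- The part of the time-like cone of the hyperplane orthogonal to `u` on the positive sides of
  -- `𝒞`. Orthogonality of `𝒞` to `u` makes these conditions unaffected by the lift along `u`.
  set K : Set Mink := {m | (IsFuture m ∧ 0 < mform m m) ∧ mform m u = 0 ∧
    ∀ v ∈ 𝒞, 0 < mform v m}
  have hK : Convex ℝ K := by
    rintro X ⟨⟨h1, h2⟩, h3, h4⟩ Y ⟨⟨h1', h2'⟩, h3', h4'⟩ a b ha hb hab
    refine ⟨⟨h1.convex_comb h1' ha hb hab, ?_⟩, ?_, fun v hv => ?_⟩
    · rw [mform_add_sq]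
      simp only [map_smul, LinearMap.smul_apply, smul_eq_mul]
      have := mul_nonneg (mul_nonneg ha hb) (h1.mform_nonneg h1')
      rcases ha.eq_or_lt with rfl | ha
      · rw [zero_add] at hab; subst hab; simpa using h2'
      · have := mul_pos (mul_pos ha ha) h2
        have := mul_nonneg (mul_nonneg hb hb) h2'.le
        linarith
    · simp [h3, h3']
    · simp only [map_add, map_smul, smul_eq_mul]
      exact pos_convex_comb (h4 v hv) (h4' v hv) ha hb hab
  convert isPreconnected_image_dome hu hK fun m hm => ⟨hm.1.1, hm.2.1⟩ using 1
  ext x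
  constructor
  · rintro ⟨h1, h2⟩
    -- Adding `s / 2` times `u` projects to the hyperplane orthogonal to `u`, because `u` has square
    -- -2. This inverts the lift.
    set s := mform u (pvec x)
    have hm : mform (pvec x + (s / 2) • u) (pvec x + (s / 2) • u) = s ^ 2 / 2 := by
      rw [mform_add_smul_sq, pvec_sq, hu, mform_comm]; ring
    have hs : √(mform (pvec x + (s / 2) • u) (pvec x + (s / 2) • u) / 2) = -(s / 2) := by
      rw [hm, show s ^ 2 / 2 / 2 = (-(s / 2)) ^ 2 by ring, Real.sqrt_sq (by linarith)]
    refine ⟨pvec x + (s / 2) • u, ⟨⟨?_, ?_⟩, ?_, fun v hv => ?_⟩, ?_⟩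
    · refine (isFuture_pvec x).of_mform_pos (by rw [hm]; positivity) ?_
      rw [map_add, pvec_sq, map_smul, mform_comm (pvec x)]
      change 0 < 0 + s / 2 * s
      nlinarith
    · rw [hm]; have := h1.ne; positivity
    · rw [mform_comm, map_add, map_smul, hu]; change s + s / 2 * (-2) = 0; ring
    · rw [map_add, map_smul, h v hv]; simpa using h2 v hv
    · simp only [hs]
      rw [add_assoc, ← add_smul, add_neg_cancel, zero_smul, add_zero]
      simpa using toPt_smul_pvec x one_ne_zero
  · rintro ⟨m, ⟨⟨h1, h2⟩, h3, h4⟩, rfl⟩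
    obtain ⟨h5, h6⟩ := isFuture_add_sqrt_smul hu h1 h3
    refine ⟨?_, fun v hv => ?_⟩
    · have := (mform_toPt_pos_iff h5 h6 (-u)).2 ?_
      · simpa using this
      · simp only [map_neg, LinearMap.neg_apply, map_add, map_smul, hu, mform_comm u m, h3]
        have : 0 < √(mform m m / 2) := Real.sqrt_pos.2 (by linarith)
        simp; linarith
    · rw [mform_toPt_pos_iff h5 h6, map_add, map_smul, h v hv]
      simpa using h4 v hv

/-- The same parametrization with causal instead of time-like vectors, which adds the boundary
circle. Two such closed halves can then be glued along a common boundary point. -/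
theorem isPreconnected_closed_dome {u v v' : Mink} (hu : mform u u = -2)
    (h : mform v u = 0) (h' : mform v' u = 0) :
    IsPreconnected {x : Sphere | mform u (pvec x) ≤ 0 ∧ 0 < mform v (pvec x) ∧
      0 < mform v' (pvec x)} := by
  set K : Set Mink := {m | IsFuture m ∧ mform m u = 0 ∧ 0 < mform v m ∧ 0 < mform v' m}
  have hK : Convex ℝ K := by
    rintro X ⟨h1, h3, h4, h5⟩ Y ⟨h1', h3', h4', h5'⟩ a b ha hb hab
    refine ⟨h1.convex_comb h1' ha hb hab, by simp [h3, h3'], ?_, ?_⟩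
    · simp only [map_add, map_smul, smul_eq_mul]
      exact pos_convex_comb h4 h4' ha hb hab
    · simp only [map_add, map_smul, smul_eq_mul]
      exact pos_convex_comb h5 h5' ha hb hab
  convert isPreconnected_image_dome hu hK fun m hm => ⟨hm.1, hm.2.1⟩ using 1
  ext x
  constructor
  · rintro ⟨h1, h2, h2'⟩
    set s := mform u (pvec x)
    have hm : mform (pvec x + (s / 2) • u) (pvec x + (s / 2) • u) = s ^ 2 / 2 := by
      rw [mform_add_smul_sq, pvec_sq, hu, mform_comm]; ring
    have hs : √(mform (pvec x + (s / 2) • u) (pvec x + (s / 2) • u) / 2) = -(s / 2) := by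
      rw [hm, show s ^ 2 / 2 / 2 = (-(s / 2)) ^ 2 by ring, Real.sqrt_sq (by linarith)]
    refine ⟨pvec x + (s / 2) • u, ⟨?_, ?_, ?_, ?_⟩, ?_⟩
    · rcases h1.eq_or_lt with h0 | h0
      · rw [h0]; simpa using isFuture_pvec x
      refine (isFuture_pvec x).of_mform_pos (by rw [hm]; positivity) ?_
      rw [map_add, pvec_sq, map_smul, mform_comm (pvec x)]
      change 0 < 0 + s / 2 * s
      nlinarith
    · rw [mform_comm, map_add, map_smul, hu]; change s + s / 2 * (-2) = 0; ring
    · rw [map_add, map_smul, h]; simpa using h2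
    · rw [map_add, map_smul, h']; simpa using h2'
    · simp only [hs]
      rw [add_assoc, ← add_smul, add_neg_cancel, zero_smul, add_zero]
      simpa using toPt_smul_pvec x one_ne_zero
  · rintro ⟨m, ⟨h1, h3, h4, h4'⟩, rfl⟩
    obtain ⟨h5, h6⟩ := isFuture_add_sqrt_smul hu h1 h3
    refine ⟨?_, ?_, ?_⟩
    · have := (mform_toPt_nonneg_iff h5 h6 (-u)).2 ?_
      · simpa using this
      · simp only [map_neg, LinearMap.neg_apply, map_add, map_smul, hu, mform_comm u m, h3]
        simpa using Real.sqrt_nonneg (mform m m / 2)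
    · rw [mform_toPt_pos_iff h5 h6, map_add, map_smul, h]
      simpa using h4
    · rw [mform_toPt_pos_iff h5 h6, map_add, map_smul, h']
      simpa using h4'

theorem exists_ne_zero_orthogonal (v : Fin 3 → Mink) :
    ∃ w : Mink, w ≠ 0 ∧ ∀ i, mform (v i) w = 0 := by
  have : (LinearMap.pi fun i => mform (v i)).ker ≠ ⊥ := by
    apply LinearMap.ker_ne_bot_of_finrank_lt
    simp
  obtain ⟨w, hw, h0⟩ := Submodule.exists_mem_ne_zero_of_ne_bot this
  exact ⟨w, h0, fun i => congrFun (LinearMap.mem_ker.1 hw) i⟩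

theorem mform_neg_of_mtrace_eq_zero {w : Mink} (h0 : w ≠ 0) (h : mtrace w = 0) :
    mform w w < 0 := by
  by_contra! h'
  exact h0 (eq_zero_of_mtrace h' h)

/-- Three linear conditions in dimension four. Trace zero forces the solution to be space-like, and
makes projection along it preserve the trace. -/
theorem exists_unit_orthogonal (v v' : Mink) :
    ∃ u : Mink, mform u u = -2 ∧ mtrace u = 0 ∧ mform v u = 0 ∧ mform v' u = 0 := by
  obtain ⟨u, h0, hu⟩ := exists_ne_zero_orthogonal ![(1, 0, 1), v, v']
  have ht := hu 0
  have hv := hu 1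
  have hv' := hu 2
  simp only [Matrix.cons_val] at ht hv hv'
  rw [← mtrace_eq] at ht
  have hneg := mform_neg_of_mtrace_eq_zero h0 ht
  have hr : √(-2 / mform u u) ^ 2 = -2 / mform u u :=
    Real.sq_sqrt (div_nonneg_of_nonpos (by norm_num) hneg.le)
  refine ⟨√(-2 / mform u u) • u, ?_, by rw [map_smul, ht, smul_zero],
    by rw [map_smul, hv, smul_zero], by rw [map_smul, hv', smul_zero]⟩
  rw [map_smul, map_smul, LinearMap.smul_apply, smul_smul, ← sq, hr, smul_eq_mul]
  exact div_mul_cancel₀ _ hneg.ne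

/-- The intersection of two open discs of the sphere is connected. -/
theorem isPreconnected_inter_discs (v v' : Mink) :
    IsPreconnected {x : Sphere | 0 < mform v (pvec x) ∧ 0 < mform v' (pvec x)} := by
  -- A circle orthogonal to both boundaries cuts the intersection into two connected halves. What
  -- remains is to find a point of the intersection on that circle.
  obtain ⟨u, hu, htu, hv, hv'⟩ := exists_unit_orthogonal v v'
  have A := isPreconnected_closed_dome hu hv hv'
  have B := isPreconnected_closed_dome (u := -u) (v := v) (v' := v') (by simpa using hu)
    (by simpa using hv) (by simpa using hv')
  set S := {x : Sphere | mform u (pvec x) ≤ 0 ∧ 0 < mform v (pvec x) ∧ 0 < mform v' (pvec x)}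
  set S' := {x : Sphere | mform (-u) (pvec x) ≤ 0 ∧ 0 < mform v (pvec x) ∧ 0 < mform v' (pvec x)}
  have hSS : {x : Sphere | 0 < mform v (pvec x) ∧ 0 < mform v' (pvec x)} = S ∪ S' := by
    ext x
    simp only [S, S', mem_ofPred_eq, mem_union, map_neg, LinearMap.neg_apply, neg_nonpos]
    rcases le_total (mform u (pvec x)) 0 with h | h <;> tauto
  rw [hSS]
  by_cases hne : (S ∪ S').Nonempty
  swap
  · rw [not_nonempty_iff_eq_empty.1 hne]; exact isPreconnected_empty
  suffices ∃ y, y ∈ S ∧ y ∈ S' by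
    obtain ⟨y, h1, h2⟩ := this
    exact A.union y h1 h2 B
  rw [← hSS] at hne
  obtain ⟨x, hx, hx'⟩ := hne
  set s := mform u (pvec x) with hs
  set m := pvec x + (s / 2) • u with hmdef
  have hmm : mform m m = s ^ 2 / 2 := by
    rw [hmdef, mform_add_smul_sq, pvec_sq, hu, mform_comm]; ring
  have hmu : mform u m = 0 := by
    rw [hmdef, map_add, map_smul, hu]; change s + s / 2 * (-2) = 0; ring
  have hmv : 0 < mform v m := by rw [hmdef, map_add, map_smul, hv]; simpa using hx
  have hmv' : 0 < mform v' m := by rw [hmdef, map_add, map_smul, hv']; simpa using hx'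
  have hmt : 0 < mtrace m := by
    rw [hmdef, map_add, map_smul, htu]; simpa using mtrace_pvec_pos x
  -- A space-like direction inside the hyperplane, orthogonal to `v` and with its sign chosen so
  -- that `v'` does not decrease along it. Moving `m` this way stays on the positive sides until the
  -- light cone is reached, at the larger root of a quadratic.
  obtain ⟨w, hwt, hwu, hwn, hw1, hw2⟩ : ∃ w, mtrace w = 0 ∧ mform u w = 0 ∧ mform w w < 0 ∧
      0 ≤ mform v w ∧ 0 ≤ mform v' w := by
    obtain ⟨w, h0, hw⟩ := exists_ne_zero_orthogonal ![(1, 0, 1), u, v]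
    have hwt := hw 0
    have hwu := hw 1
    have hwv := hw 2
    simp only [Matrix.cons_val] at hwt hwu hwv
    rw [← mtrace_eq] at hwt
    rcases le_total 0 (mform v' w) with h | h
    · exact ⟨w, hwt, hwu, mform_neg_of_mtrace_eq_zero h0 hwt, hwv.ge, h⟩
    · exact ⟨-w, by simpa using hwt, by simpa using hwu,
        by simpa using mform_neg_of_mtrace_eq_zero h0 hwt, by simpa using hwv.le, by simpa using h⟩
  obtain ⟨l, hl, hl0⟩ : ∃ l : ℝ, 0 ≤ l ∧ mform (m + l • w) (m + l • w) = 0 := by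
    set p := mform m w
    set q := -mform w w with hq
    have hq0 : 0 < q := by linarith
    have hD : 0 ≤ p ^ 2 + q * mform m m := by rw [hmm]; positivity
    refine ⟨(p + √(p ^ 2 + q * mform m m)) / q, div_nonneg ?_ hq0.le, ?_⟩
    · have : |p| ≤ √(p ^ 2 + q * mform m m) := by
        apply Real.abs_le_sqrt
        have : 0 ≤ q * mform m m := by rw [hmm]; positivity
        linarith
      have := neg_abs_le p
      linarith
    · rw [mform_add_smul_sq, show mform w w = -q by linarith]
      have h2 := Real.sq_sqrt hD
      generalize √(p ^ 2 + q * mform m m) = t at h2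
      change mform m m + 2 * ((p + t) / q) * p + ((p + t) / q) ^ 2 * -q = 0
      field_simp
      linarith
  have hF : IsFuture (m + l • w) := ⟨hl0.ge, by rw [map_add, map_smul, hwt]; simpa using hmt⟩
  have e1 : mform u (m + l • w) = 0 := by rw [map_add, map_smul, hmu, hwu]; simp
  have e2 : 0 < mform v (pvec (toPt (m + l • w))) := by
    rw [mform_toPt_pos_iff hF hl0, map_add, map_smul, smul_eq_mul]
    have := mul_nonneg hl hw1
    linarith
  have e3 : 0 < mform v' (pvec (toPt (m + l • w))) := by
    rw [mform_toPt_pos_iff hF hl0, map_add, map_smul, smul_eq_mul]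
    have := mul_nonneg hl hw2
    linarith
  have e4 : 0 ≤ mform u (pvec (toPt (m + l • w))) := by
    rw [mform_toPt_nonneg_iff hF hl0]; exact e1.ge
  have e5 : 0 ≤ mform (-u) (pvec (toPt (m + l • w))) := by
    rw [mform_toPt_nonneg_iff hF hl0, map_neg, LinearMap.neg_apply, e1, neg_zero]
  refine ⟨toPt (m + l • w), ⟨?_, e2, e3⟩, ⟨?_, e2, e3⟩⟩
  · simpa using e5
  · simpa using e4

theorem GenCircle.isPreconnected_exteriors (C C' : GenCircle) :
    IsPreconnected {x | 0 < C.form x ∧ 0 < C'.form x} := by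
  simp only [C.form_eq, C'.form_eq]; exact isPreconnected_inter_discs _ _

@[simp] theorem GenCircle.form_neg (C : GenCircle) (x : Sphere) : C.neg.form x = -C.form x := by
  simp [form_eq]

theorem GenCircle.isPreconnected_interior (C : GenCircle) : IsPreconnected C.interior := by
  have := C.neg.isPreconnected_exteriors C.neg
  simpa [interior] using this

/-! ### Small discs -/

/-- The circle with centre `m` and radius `r`, with bounded interior. -/
def GenCircle.circle (m : ℂ) (r : ℝ) (hr : 0 < r) : GenCircle :=
  ofVec (r⁻¹, -(r⁻¹ • m), r⁻¹ * (‖m‖ ^ 2 - r ^ 2)) (by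
    simp only [mform_apply, Complex.neg_re, Complex.neg_im, Complex.smul_re, Complex.smul_im,
      sq_norm_complex, smul_eq_mul]
    field_simp
    ring)

theorem GenCircle.form_circle_coe (m : ℂ) (r : ℝ) (hr : 0 < r) (z : ℂ) :
    (circle m r hr).form z = r⁻¹ * (‖z - m‖ ^ 2 - r ^ 2) := by
  simp [form_eq, circle, mform_apply, sq_norm_complex]
  ring

theorem GenCircle.form_circle_infty (m : ℂ) (r : ℝ) (hr : 0 < r) :
    (circle m r hr).form OnePoint.infty = r⁻¹ := by
  simp [form_eq, circle, mform_apply]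

theorem GenCircle.form_circle_neg_iff (m : ℂ) (r : ℝ) (hr : 0 < r) (z : ℂ) :
    (circle m r hr).form z < 0 ↔ ‖z - m‖ < r := by
  have h : (0 : ℝ) < r⁻¹ := inv_pos.2 hr
  rw [form_circle_coe, mul_neg_iff, ← sq_lt_sq₀ (norm_nonneg _) hr.le]
  constructor
  · rintro (h' | h') <;> linarith
  · intro h'; left; exact ⟨h, by linarith⟩

theorem GenCircle.form_circle_pos_iff (m : ℂ) (r : ℝ) (hr : 0 < r) (z : ℂ) :
    0 < (circle m r hr).form z ↔ r < ‖z - m‖ := by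
  have h : (0 : ℝ) < r⁻¹ := inv_pos.2 hr
  rw [form_circle_coe, mul_pos_iff_of_pos_left h, ← sq_lt_sq₀ hr.le (norm_nonneg _), sub_pos]

theorem isPreconnected_image_polar {I : Set ℝ} (hI : Convex ℝ I) (m : ℂ) :
    IsPreconnected ((fun p : ℝ × ℝ =>
      ((m + p.1 * Complex.exp (p.2 * Complex.I) : ℂ) : Sphere)) '' (I ×ˢ univ)) := by
  refine (hI.prod convex_univ).isPreconnected.image _ (Continuous.continuousOn ?_)
  exact OnePoint.continuous_coe.comp (by fun_prop)

/-- Every point of the sphere has arbitrarily small discs around it. -/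
theorem exists_disc_subset {U : Set Sphere} (hU : IsOpen U) {y : Sphere} (hy : y ∈ U) :
    ∃ C : GenCircle, y ∈ C.interior ∧ C.interior ⊆ U ∧ IsPreconnected (C.interior \ {y}) := by
  induction y using OnePoint.rec with
  | infty =>
    have hK := ((OnePoint.isOpen_iff_of_mem hy).1 hU).2
    obtain ⟨R, hR⟩ := hK.isBounded.subset_closedBall 0
    have hr : 0 < max R 1 := by positivity
    have hmem : ∀ z : ℂ, ((z : Sphere) ∈ (GenCircle.circle 0 (max R 1) hr).neg.interior ↔
        max R 1 < ‖z‖) := fun z => by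
      rw [GenCircle.interior, mem_ofPred_eq, GenCircle.form_neg, neg_lt_zero,
        GenCircle.form_circle_pos_iff, sub_zero]
    refine ⟨(GenCircle.circle 0 (max R 1) hr).neg, ?_, ?_, ?_⟩
    · rw [GenCircle.interior, mem_ofPred_eq, GenCircle.form_neg, GenCircle.form_circle_infty]
      simp
    · intro x hx
      induction x using OnePoint.rec with
      | infty => exact hy
      | coe z =>
        rw [hmem] at hx
        by_contra hz
        have := hR (show z ∈ ((↑) ⁻¹' U : Set ℂ)ᶜ from hz)
        rw [mem_closedBall_zero_iff] at this
        exact absurd (le_max_left R 1) (by linarith)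
    · convert isPreconnected_image_polar (convex_Ioi (max R 1)) 0 using 1
      ext x
      simp only [zero_add, mem_image, mem_prod, mem_univ, and_true, mem_Ioi, Prod.exists,
        mem_sdiff, mem_singleton_iff]
      constructor
      · rintro ⟨h1, h2⟩
        induction x using OnePoint.rec with
        | infty => exact absurd rfl h2
        | coe z =>
          rw [hmem] at h1
          exact ⟨‖z‖, Complex.arg z, h1, by rw [Complex.norm_mul_exp_arg_mul_I]⟩
      · rintro ⟨s, t, h, rfl⟩
        rw [hmem]
        refine ⟨?_, OnePoint.coe_ne_infty _⟩
        rw [norm_mul, Complex.norm_exp_ofReal_mul_I, mul_one, Complex.norm_real, Real.norm_eq_abs]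
        exact h.trans_le (le_abs_self s)
  | coe w =>
    have hV : IsOpen ((↑) ⁻¹' U : Set ℂ) := hU.preimage OnePoint.continuous_coe
    obtain ⟨r, hr, hb⟩ := Metric.isOpen_iff.1 hV w hy
    have hmem : ∀ z : ℂ, ((z : Sphere) ∈ (GenCircle.circle w r hr).interior ↔ ‖z - w‖ < r) :=
      fun z => GenCircle.form_circle_neg_iff w r hr z
    have hinf : OnePoint.infty ∉ (GenCircle.circle w r hr).interior := by
      rw [GenCircle.interior, mem_ofPred_eq, GenCircle.form_circle_infty]
      exact (inv_pos.2 hr).not_gt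
    refine ⟨GenCircle.circle w r hr, ?_, ?_, ?_⟩
    · rw [hmem]; simpa using hr
    · intro x hx
      induction x using OnePoint.rec with
      | infty => exact absurd hx hinf
      | coe z =>
        rw [hmem, ← dist_eq_norm] at hx
        exact hb hx
    · convert isPreconnected_image_polar (convex_Ioo 0 r) w using 1
      ext x
      simp only [mem_image, mem_prod, mem_univ, and_true, mem_Ioo, Prod.exists,
        mem_sdiff, mem_singleton_iff]
      constructor
      · rintro ⟨h1, h2⟩
        induction x using OnePoint.rec with
        | infty => exact absurd h1 hinf
        | coe z =>
          rw [hmem] at h1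
          have : z - w ≠ 0 := fun h => h2 (by rw [sub_eq_zero.1 h])
          exact ⟨‖z - w‖, Complex.arg (z - w), ⟨norm_pos_iff.2 this, h1⟩,
            by rw [Complex.norm_mul_exp_arg_mul_I]; simp⟩
      · rintro ⟨s, t, h, rfl⟩
        have hn : ‖(s : ℂ) * Complex.exp (t * Complex.I)‖ = s := by
          rw [norm_mul, Complex.norm_exp_ofReal_mul_I, mul_one, Complex.norm_real,
            Real.norm_eq_abs, abs_of_pos h.1]
        rw [hmem]
        refine ⟨by rw [add_sub_cancel_left, hn]; exact h.2, fun e => ?_⟩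
        rw [OnePoint.coe_eq_coe, add_eq_left] at e
        rw [e, norm_zero] at hn
        exact h.1.ne hn

/-- Faces are components of an open set; local connectedness makes them open. -/
instance : LocallyConnectedSpace Sphere := by
  refine locallyConnectedSpace_of_connected_bases (fun _ (C : GenCircle) => C.interior)
    (fun x C => x ∈ C.interior) (fun x => ⟨fun s => ⟨fun hs => ?_, ?_⟩⟩)
    fun x C _ => C.isPreconnected_interior
  · obtain ⟨U, hUs, hU, hx⟩ := mem_nhds_iff.1 hs
    obtain ⟨C, h1, h2, -⟩ := exists_disc_subset hU hx
    exact ⟨C, h1, h2.trans hUs⟩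
  · rintro ⟨C, h1, h2⟩
    exact Filter.mem_of_superset (C.isOpen_interior.mem_nhds h1) h2

/-- A small punctured disc around `a` is connected, so it falls into one part of any separation of
the complement of `a`. Adding the disc to that part would separate `U` itself. -/
theorem isPreconnected_diff_singleton {U : Set Sphere} (hU : IsOpen U) (hc : IsPreconnected U)
    (a : Sphere) : IsPreconnected (U \ {a}) := by
  by_cases ha : a ∈ U
  swap
  · rwa [sdiff_singleton_eq_self ha]
  obtain ⟨C, haC, hCU, hC⟩ := exists_disc_subset hU ha
  have key : ∀ u v : Set Sphere, IsOpen u → IsOpen v → U \ {a} ⊆ u ∪ v →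
      (U \ {a}) ∩ (u ∩ v) = ∅ → C.interior \ {a} ⊆ u → U \ {a} ⊆ u := by
    intro u v hu hv huv he hCu
    rw [isPreconnected_iff_subset_of_disjoint] at hc
    have h1 : U ⊆ (u ∪ C.interior) ∪ (v \ {a}) := by
      intro x hx
      by_cases hxa : x = a
      · subst hxa; exact Or.inl (Or.inr haC)
      · rcases huv ⟨hx, hxa⟩ with h | h
        · exact Or.inl (Or.inl h)
        · exact Or.inr ⟨h, hxa⟩
    have h2 : U ∩ ((u ∪ C.interior) ∩ (v \ {a})) = ∅ := by
      rw [eq_empty_iff_forall_notMem] at he ⊢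
      rintro x ⟨hx, hx1 | hx1, hx2, hx3⟩
      · exact he x ⟨⟨hx, hx3⟩, hx1, hx2⟩
      · exact he x ⟨⟨hx, hx3⟩, hCu ⟨hx1, hx3⟩, hx2⟩
    rcases hc _ _ (hu.union C.isOpen_interior) (hv.sdiff isClosed_singleton) h1 h2 with h | h
    · rintro x ⟨hx, hxa⟩
      rcases h hx with h' | h'
      · exact h'
      · exact hCu ⟨h', hxa⟩
    · exact absurd rfl (h ha).2
  rw [isPreconnected_iff_subset_of_disjoint] at hC ⊢
  intro u v hu hv huv he
  have hsub : C.interior \ {a} ⊆ U \ {a} := sdiff_subset_sdiff_left hCU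
  rcases hC u v hu hv (hsub.trans huv)
    (subset_empty_iff.1 ((inter_subset_inter_left _ hsub).trans he.subset)) with h | h
  · exact Or.inl (key u v hu hv huv he h)
  · exact Or.inr (key v u hv hu (by rwa [union_comm]) (by rwa [inter_comm v u]) h)

theorem isPreconnected_diff_subsingleton {U A : Set Sphere} (hU : IsOpen U)
    (hc : IsPreconnected U) (hA : A.Subsingleton) : IsPreconnected (U \ A) := by
  rcases hA.eq_empty_or_singleton with rfl | ⟨a, rfl⟩
  · simpa
  · exact isPreconnected_diff_singleton hU hc a

/-! ### Approaching a point of a circle -/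

namespace GenCircle

/-- Half the gradient of the equation of a circle (its direction, at `∞`). -/
def grad (C : GenCircle) (x : Sphere) : ℂ := x.elim C.b fun z : ℂ => C.a * z + C.b

/-- The half-gradients at a point of the circle are unit vectors, so at a common point the product
of two circles is -2 times the cosine of their angle. -/
theorem grad_mul_grad {C C' : GenCircle} {x : Sphere} (h : C.form x = 0) (h' : C'.form x = 0) :
    2 * ((starRingEnd ℂ) (C.grad x) * C'.grad x).re = -mform C.vec C'.vec := by
  induction x using OnePoint.rec with
  | infty =>
    simp only [form, OnePoint.elim_infty] at h h'
    simp [grad, mform_apply, vec, h, h']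
  | coe z =>
    simp only [form, OnePoint.elim_some, sq_norm_complex, Complex.mul_re, Complex.conj_re,
      Complex.conj_im] at h h'
    simp only [grad, OnePoint.elim_some, mform_apply, vec, map_add, map_mul, Complex.conj_ofReal,
      Complex.mul_re, Complex.add_re, Complex.add_im, Complex.ofReal_re, Complex.ofReal_im,
      Complex.conj_re, Complex.conj_im, Complex.mul_im]
    linear_combination C.a * h' + C'.a * h

theorem grad_sq {C : GenCircle} {x : Sphere} (h : C.form x = 0) :
    ((starRingEnd ℂ) (C.grad x) * C.grad x).re = 1 := by
  have := grad_mul_grad h h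
  rw [C.vec_sq] at this
  linarith

/-- The filter runs along the straight ray from `x` in direction `w`, or to infinity along `w` when
`x` is infinite, and the equations grow to first order. One filter serves all circles through `x`,
so several sign conditions can be imposed at once. -/
theorem exists_approach (x : Sphere) {w : ℂ} (hw : w ≠ 0) : ∃ l : Filter Sphere, l.NeBot ∧
    l ≤ 𝓝 x ∧ ∀ C : GenCircle, C.form x = 0 → 0 < ((starRingEnd ℂ) (C.grad x) * w).re →
      ∀ᶠ y in l, 0 < C.form y := by
  induction x using OnePoint.rec with
  | infty =>
    have ht : Filter.Tendsto (fun s : ℝ => ((s * w : ℂ) : Sphere)) Filter.atTop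
        (𝓝 OnePoint.infty) := by
      have h1 := OnePoint.tendsto_coe_infty (X := ℂ)
      rw [Filter.coclosedCompact_eq_cocompact] at h1
      refine h1.comp ?_
      rw [← Metric.cobounded_eq_cocompact, ← tendsto_norm_atTop_iff_cobounded]
      simp only [norm_mul, Complex.norm_real, Real.norm_eq_abs]
      exact Filter.tendsto_abs_atTop_atTop.atTop_mul_const (norm_pos_iff.2 hw)
    refine ⟨_, Filter.map_neBot, ht, fun C h0 h => ?_⟩
    rw [Filter.eventually_map]
    simp only [form, OnePoint.elim_infty] at h0
    simp only [form, OnePoint.elim_some, h0, zero_mul, zero_add]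
    simp only [grad, OnePoint.elim_infty] at h
    have e : ∀ s : ℝ, 2 * ((starRingEnd ℂ) C.b * (s * w)).re + C.c =
        s * (2 * ((starRingEnd ℂ) C.b * w).re) + C.c := fun s => by
      rw [mul_left_comm, Complex.re_ofReal_mul]; ring
    simp only [e]
    have : Filter.Tendsto (fun s : ℝ => s * (2 * ((starRingEnd ℂ) C.b * w).re) + C.c)
        Filter.atTop Filter.atTop := Filter.tendsto_atTop_add_const_right _ _
      (Filter.tendsto_id.atTop_mul_const (by positivity))
    exact this.eventually_gt_atTop 0
  | coe z =>
    have hc : Continuous fun s : ℝ => ((z + s * w : ℂ) : Sphere) :=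
      OnePoint.continuous_coe.comp (by fun_prop)
    have ht : Filter.Tendsto (fun s : ℝ => ((z + s * w : ℂ) : Sphere)) (𝓝[>] 0)
        (𝓝 (z : Sphere)) := by
      have := hc.tendsto 0
      simp only [Complex.ofReal_zero, zero_mul, add_zero] at this
      exact this.mono_left nhdsWithin_le_nhds
    refine ⟨_, Filter.map_neBot, ht, fun C h0 h => ?_⟩
    rw [Filter.eventually_map]
    have e : ∀ s : ℝ, C.form ((z + s * w : ℂ) : Sphere) =
        s * (2 * ((starRingEnd ℂ) (C.grad z) * w).re + s * (C.a * ‖w‖ ^ 2)) := fun s => by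
      simp only [form, OnePoint.elim_some, sq_norm_complex, Complex.mul_re, Complex.conj_re,
        Complex.conj_im] at h0
      simp only [form, OnePoint.elim_some, grad, sq_norm_complex, map_add, map_mul,
        Complex.conj_ofReal, Complex.mul_re, Complex.add_re, Complex.add_im, Complex.ofReal_re,
        Complex.ofReal_im, Complex.conj_re, Complex.conj_im, Complex.mul_im]
      linear_combination h0
    simp only [e]
    have hlim : Filter.Tendsto (fun s : ℝ => 2 * ((starRingEnd ℂ) (C.grad z) * w).re +
        s * (C.a * ‖w‖ ^ 2)) (𝓝[>] 0) (𝓝 (2 * ((starRingEnd ℂ) (C.grad z) * w).re)) := by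
      have : Continuous fun s : ℝ => 2 * ((starRingEnd ℂ) (C.grad z) * w).re +
        s * (C.a * ‖w‖ ^ 2) := by fun_prop
      have := this.tendsto 0
      simp only [zero_mul, add_zero] at this
      exact this.mono_left nhdsWithin_le_nhds
    filter_upwards [hlim.eventually_const_lt (show 0 < 2 * ((starRingEnd ℂ) (C.grad z) * w).re by
      positivity), self_mem_nhdsWithin] with s h1 h2
    exact mul_pos h2 h1

theorem mem_closure_exterior {C : GenCircle} {x : Sphere} (h : C.form x = 0) :
    x ∈ closure {y | 0 < C.form y} := by
  have hg := grad_sq h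
  have h0 : C.grad x ≠ 0 := fun h' => by simp [h'] at hg
  obtain ⟨l, hl, hx, hC⟩ := exists_approach x h0
  exact mem_closure_of_frequently_of_tendsto (f := id) (b := l)
    (hC C h (by rw [hg]; norm_num)).frequently hx

theorem mem_closure_interior {C : GenCircle} {x : Sphere} (h : C.form x = 0) :
    x ∈ closure C.interior := by
  have := mem_closure_exterior (C := C.neg) (x := x) (by simp [h])
  simpa [interior] using this

theorem mem_closure_interior_of_nonpos {C : GenCircle} {x : Sphere} (h : C.form x ≤ 0) :
    x ∈ closure C.interior := by
  rcases h.lt_or_eq with h | h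
  · exact subset_closure h
  · exact mem_closure_interior h

/-- The sum of two orthogonal unit gradients has positive product with each of them, so it points
out of both discs. -/
theorem mem_closure_exteriors {C C' : GenCircle} {x : Sphere} (h : C.form x = 0)
    (h' : C'.form x = 0) (ho : mform C.vec C'.vec = 0) :
    x ∈ closure {y | 0 < C.form y ∧ 0 < C'.form y} := by
  have hg := grad_sq h
  have hg' := grad_sq h'
  have hgg := grad_mul_grad h h'
  have hgg' := grad_mul_grad h' h
  rw [mform_comm] at hgg'
  rw [ho] at hgg hgg'
  have e1 : ((starRingEnd ℂ) (C.grad x) * (C.grad x + C'.grad x)).re = 1 := by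
    rw [mul_add, Complex.add_re]; linarith
  have e2 : ((starRingEnd ℂ) (C'.grad x) * (C.grad x + C'.grad x)).re = 1 := by
    rw [mul_add, Complex.add_re]; linarith
  have h0 : C.grad x + C'.grad x ≠ 0 := fun h0 => by simp [h0] at e1
  obtain ⟨l, hl, hx, hC⟩ := exists_approach x h0
  exact mem_closure_of_frequently_of_tendsto (f := id) (b := l)
    ((hC C h (by rw [e1]; norm_num)).and (hC C' h' (by rw [e2]; norm_num))).frequently hx

theorem mem_closure_exterior_interior {C C' : GenCircle} {x : Sphere} (h : C.form x = 0)
    (h' : C'.form x = 0) (ho : mform C.vec C'.vec = 0) :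
    x ∈ closure {y | 0 < C.form y ∧ C'.form y < 0} := by
  have := mem_closure_exteriors (C := C) (C' := C'.neg) h (by simp [h']) (by simp [ho])
  simpa using this

theorem exists_two_mem_carrier (C : GenCircle) :
    ∃ x y : Sphere, x ≠ y ∧ C.form x = 0 ∧ C.form y = 0 := by
  have hn := C.normalized
  rw [sq_norm_complex] at hn
  by_cases ha : C.a = 0
  · refine ⟨OnePoint.infty, ((-(C.c / 2 : ℝ) * C.b : ℂ) : Sphere),
      (OnePoint.coe_ne_infty _).symm, by simp [form, ha], ?_⟩
    rw [ha] at hn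
    simp only [form, OnePoint.elim_some, ha, Complex.mul_re, Complex.conj_re, Complex.conj_im,
      Complex.neg_re, Complex.neg_im, Complex.ofReal_re, Complex.ofReal_im, Complex.mul_im]
    linear_combination -C.c * hn
  · have key : ∀ s : ℝ, s ^ 2 = 1 →
        C.form (((C.a⁻¹ : ℝ) * (-C.b + s) : ℂ) : Sphere) = 0 := by
      intro s hs
      simp only [form, OnePoint.elim_some, sq_norm_complex, Complex.mul_re, Complex.conj_re,
        Complex.conj_im, Complex.neg_re, Complex.neg_im, Complex.ofReal_re, Complex.ofReal_im,
        Complex.mul_im, Complex.add_re, Complex.add_im]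
      field_simp
      linear_combination hs - hn
    refine ⟨_, _, ?_, key 1 (by norm_num), key (-1) (by norm_num)⟩
    intro h
    rw [OnePoint.coe_eq_coe] at h
    have h2 : ((C.a⁻¹ : ℝ) : ℂ) ≠ 0 := by exact_mod_cast inv_ne_zero ha
    have h3 := mul_left_cancel₀ h2 h
    have h4 := congrArg Complex.re h3
    simp at h4
    linarith

/-- Two discs intersect, unless their boundary circles are disjoint or tangent. -/
theorem exists_mem_interiors {C C' : GenCircle} (h : mform C.vec C'.vec < 2) :
    ∃ x, C.form x < 0 ∧ C'.form x < 0 := by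
  set k := mform C.vec C'.vec / 2 with hk
  have hkk : mform C.vec C'.vec = 2 * k := by rw [hk]; ring
  have hk1 : k < 1 := by linarith
  -- The lift of `Y` along `C` is strictly inside `C`; the last condition says that it is inside
  -- `C'` too.
  suffices ∃ Y : Mink, IsFuture Y ∧ 0 < mform Y Y ∧ mform Y C.vec = 0 ∧
      mform C'.vec Y < -2 * k * √(mform Y Y / 2) by
    obtain ⟨Y, hY, hYY, hYC, hYC'⟩ := this
    obtain ⟨h1, h2⟩ := isFuture_add_sqrt_smul C.vec_sq hY hYC
    have hn : 0 < √(mform Y Y / 2) := Real.sqrt_pos.2 (by linarith)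
    refine ⟨toPt (Y + √(mform Y Y / 2) • C.vec), ?_, ?_⟩
    · rw [form_eq, ← neg_pos, ← LinearMap.neg_apply, ← map_neg, mform_toPt_pos_iff h1 h2]
      simp only [map_neg, LinearMap.neg_apply, map_add, map_smul, C.vec_sq, mform_comm C.vec Y,
        hYC, smul_eq_mul]
      linarith
    · rw [form_eq, ← neg_pos, ← LinearMap.neg_apply, ← map_neg, mform_toPt_pos_iff h1 h2]
      simp only [map_neg, LinearMap.neg_apply, map_add, map_smul, mform_comm C'.vec C.vec, hkk,
        smul_eq_mul]
      linarith
  set t := mform (1, 0, 1) C.vec with ht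
  set Y₀ : Mink := (1, 0, 1) + (t / 2) • C.vec with hY₀
  have hXX : mform (1, 0, 1) (1, 0, 1) = 2 := by simp [mform_apply]; norm_num
  have hX : IsFuture (1, 0, 1) := ⟨by rw [hXX]; norm_num, by simp [mtrace_apply]⟩
  have hYY : mform Y₀ Y₀ = 2 + t ^ 2 / 2 := by
    rw [hY₀, mform_add_smul_sq, hXX, C.vec_sq, ← ht]; ring
  have hYC : mform Y₀ C.vec = 0 := by
    rw [hY₀, map_add, map_smul, LinearMap.add_apply, LinearMap.smul_apply, C.vec_sq, ← ht,
      smul_eq_mul]; ring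
  have hY : IsFuture Y₀ := by
    refine hX.of_mform_pos (by rw [hYY]; positivity) ?_
    rw [hY₀, map_add, map_smul, hXX, ← ht, smul_eq_mul]; nlinarith [sq_nonneg t]
  set w := mform Y₀ Y₀
  have hw : 0 < w := by rw [hYY]; positivity
  -- The component of `C'` orthogonal to `C`. The vector `Y` is sought on the line through `Y₀`, the
  -- projection of the base point, in direction `u`.
  set u := C'.vec + k • C.vec with hu
  have huC : mform u C.vec = 0 := by
    rw [hu, map_add, map_smul, LinearMap.add_apply, LinearMap.smul_apply, C.vec_sq,
      mform_comm C'.vec, hkk, smul_eq_mul]; ring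
  have huu : mform u u = 2 * k ^ 2 - 2 := by
    rw [hu, mform_add_smul_sq, C.vec_sq, C'.vec_sq, mform_comm C'.vec, hkk]; ring
  have hC'u : mform C'.vec u = 2 * k ^ 2 - 2 := by
    rw [hu, map_add, map_smul, C'.vec_sq, mform_comm C'.vec, hkk, smul_eq_mul]; ring
  set y := mform Y₀ u with hy
  have hC'Y : mform C'.vec Y₀ = y := by
    rw [hy, hu, map_add (mform Y₀), map_smul (mform Y₀), hYC, mform_comm C'.vec]; simp
  have main : ∀ s : ℝ, 0 < w + 2 * s * y + s ^ 2 * (2 * k ^ 2 - 2) → 0 < w + s * y →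
      y + s * (2 * k ^ 2 - 2) < -2 * k * √((w + 2 * s * y + s ^ 2 * (2 * k ^ 2 - 2)) / 2) →
      ∃ Y : Mink, IsFuture Y ∧ 0 < mform Y Y ∧ mform Y C.vec = 0 ∧
        mform C'.vec Y < -2 * k * √(mform Y Y / 2) := by
    intro s h1 h2 h3
    have e : mform (Y₀ + s • u) (Y₀ + s • u) = w + 2 * s * y + s ^ 2 * (2 * k ^ 2 - 2) := by
      rw [mform_add_smul_sq, huu]
    refine ⟨Y₀ + s • u, hY.of_mform_pos (by rw [e]; exact h1.le) ?_, by rwa [e], ?_, ?_⟩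
    · rw [map_add, map_smul, smul_eq_mul]; exact h2
    · rw [map_add, map_smul, LinearMap.add_apply, LinearMap.smul_apply, hYC, huC]; simp
    · rwa [e, map_add, map_smul, hC'Y, hC'u, smul_eq_mul]
  -- If `k ≤ -1`, then `u` is causal and the parameter 0 or `y` works. Otherwise `|k| < 1`, `u` is
  -- space-like, and the parameter must stay within the time-like range.
  rcases le_or_gt k (-1) with hk2 | hk2
  · rcases lt_or_ge y 0 with hy0 | hy0
    · refine main 0 (by simpa using hw) (by simpa using hw) ?_
      have := mul_nonneg (by linarith : (0 : ℝ) ≤ -2 * k)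
        (Real.sqrt_nonneg ((w + 2 * 0 * y + 0 ^ 2 * (2 * k ^ 2 - 2)) / 2))
      linarith
    · have hD : 0 ≤ 2 * k ^ 2 - 2 := by nlinarith
      have hpos : 0 < w + 2 * y * y + y ^ 2 * (2 * k ^ 2 - 2) := by positivity
      refine main y hpos (by positivity) ?_
      have hk0 : (0 : ℝ) ≤ -2 * k := by linarith
      refine lt_of_pow_lt_pow_left₀ 2 (mul_nonneg hk0 (Real.sqrt_nonneg _)) ?_
      rw [mul_pow, Real.sq_sqrt (by linarith)]
      have h1 : 0 < k ^ 2 * w := mul_pos (by nlinarith) hw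
      have h2 : 0 ≤ y ^ 2 * (2 * k ^ 2 - 2) := by positivity
      have h3 : 0 ≤ y ^ 2 := sq_nonneg y
      nlinarith
  · have hE : 0 < 2 - 2 * k ^ 2 := by nlinarith
    set E := 2 - 2 * k ^ 2 with hEdef
    set G := w * E + y ^ 2 with hG
    have hG0 : 0 < G := by positivity
    have hk3 : k ^ 2 < 1 := by linarith
    -- At parameter `(τ + y) / E`, being time-like means `τ² < G`, and for positive `k` the last
    -- condition means `τ² > k² G`. The midpoint of the two bounds is taken.
    set τ := √(G * (1 + k ^ 2) / 2) with hτ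
    have hτ2 : τ ^ 2 = G * (1 + k ^ 2) / 2 := Real.sq_sqrt (by positivity)
    have hτ0 : 0 < τ := Real.sqrt_pos.2 (by positivity)
    have e1 : w + 2 * ((τ + y) / E) * y + ((τ + y) / E) ^ 2 * (2 * k ^ 2 - 2) =
        (G - τ ^ 2) / E := by
      rw [show 2 * k ^ 2 - 2 = -E by rw [hEdef]; ring, hG]
      field_simp
      ring
    have e2 : G - τ ^ 2 = G * E / 4 := by rw [hτ2, hEdef]; ring
    have e3 : (G - τ ^ 2) / E = G / 4 := by rw [e2]; field_simp
    refine main ((τ + y) / E) (by rw [e1, e3]; positivity) ?_ ?_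
    · by_contra! hneg
      have h1 : w + 2 * ((τ + y) / E) * y + ((τ + y) / E) ^ 2 * (2 * k ^ 2 - 2) ≤ -w := by
        have := mul_nonneg (sq_nonneg ((τ + y) / E)) hE.le
        linarith
      rw [e1, e3] at h1
      linarith
    · rw [e1, e3]
      have e4 : y + (τ + y) / E * (2 * k ^ 2 - 2) = -τ := by
        rw [show 2 * k ^ 2 - 2 = -E by rw [hEdef]; ring]
        field_simp
        ring
      rw [e4]
      have : 2 * k * √(G / 4 / 2) < τ := by
        refine lt_of_pow_lt_pow_left₀ 2 hτ0.le ?_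
        rw [mul_pow, Real.sq_sqrt (by positivity), hτ2]
        nlinarith
      linarith

theorem two_le_of_disjoint {C C' : GenCircle} (h : Disjoint C.interior C'.interior) :
    2 ≤ mform C.vec C'.vec := by
  by_contra! h'
  obtain ⟨x, h1, h2⟩ := exists_mem_interiors h'
  exact disjoint_left.1 h h1 h2

theorem form_nonneg_of_disjoint {C C' : GenCircle} (h : Disjoint C.interior C'.interior)
    {x : Sphere} (hx : C.form x ≤ 0) : 0 ≤ C'.form x := by
  by_contra! hx'
  have := h.closure_left C'.isOpen_interior
  exact disjoint_left.1 this (mem_closure_interior_of_nonpos hx) hx'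

/-- Disjoint interiors give a product of at least 2, so the sum is causal; a point where exactly one
equation vanishes shows that the sum is future rather than zero or past. -/
theorem sep_of_disjoint {C C' : GenCircle} (h : Disjoint C.interior C'.interior) {x : Sphere}
    (hx : C.form x = 0) (hx' : C'.form x ≠ 0) : Sep C C' := by
  have h1 := two_le_of_disjoint h
  have h2 := lt_of_le_of_ne (form_nonneg_of_disjoint h hx.le) hx'.symm
  refine (isFuture_pvec x).of_mform_pos ?_ ?_
  · rw [mform_add_sq, C.vec_sq, C'.vec_sq]; linarith
  · rw [mform_comm, map_add, LinearMap.add_apply, ← form_eq, ← form_eq, hx]; linarith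

/-- A causal vector orthogonal to the points of a circle vanishes. -/
theorem eq_zero_of_orthogonal {C : GenCircle} {N : Mink} (hN : 0 ≤ mform N N)
    (h : ∀ x, C.form x = 0 → mform N (pvec x) = 0) : N = 0 := by
  by_contra h0
  obtain ⟨x, y, hxy, hx, hy⟩ := C.exists_two_mem_carrier
  have key : ∀ N : Mink, IsFuture N → (∀ x, C.form x = 0 → mform N (pvec x) = 0) → False := by
    intro N hN h
    obtain ⟨r, hr⟩ := (isFuture_pvec x).eq_smul_of_mform_eq_zero (pvec_sq x) hN (h x hx)
    obtain ⟨s, hs⟩ := (isFuture_pvec y).eq_smul_of_mform_eq_zero (pvec_sq y) hN (h y hy)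
    have hN2 := hN.2
    have hr0 : r ≠ 0 := by rintro rfl; simp [hr] at hN2
    have hs0 : s ≠ 0 := by rintro rfl; simp [hs] at hN2
    exact hxy (by rw [← toPt_smul_pvec x hr0, ← hr, hs, toPt_smul_pvec y hs0])
  rcases isFuture_or_neg hN h0 with h1 | h1
  · exact key N h1 h
  · exact key (-N) h1 fun x hx => by simp [h x hx]

/-- With one orientation reversed, the two interiors are disjoint, so the difference of the vectors
is causal. It also vanishes on all points of `C`, hence is zero. -/
theorem interior_injective : Function.Injective interior := by
  intro C C' h
  have hd : Disjoint C.interior C'.neg.interior := by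
    rw [h, disjoint_left]
    intro x h1 h2
    rw [interior, mem_ofPred_eq] at h1 h2
    rw [form_neg] at h2
    linarith
  have h2 := two_le_of_disjoint hd
  rw [vec_neg, map_neg] at h2
  apply vec_injective
  rw [← sub_eq_zero]
  refine eq_zero_of_orthogonal (C := C) ?_ fun x hx => ?_
  · rw [mform_sub_sq, C.vec_sq, C'.vec_sq]; linarith
  · rw [map_sub, LinearMap.sub_apply, ← form_eq, ← form_eq, hx, zero_sub, neg_eq_zero]
    apply le_antisymm
    · have := form_nonneg_of_disjoint hd hx.le
      rw [form_neg] at this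
      linarith
    · by_contra! hneg
      have : x ∈ C.interior := by rw [h]; exact hneg
      rw [interior, mem_ofPred_eq] at this
      linarith

end GenCircle

/-! ### Finiteness and shrinking of families of circles -/

/-- The circles of the collection have disjoint interiors and do not cross. -/
def PairwiseSep (B : Set GenCircle) : Prop := ∀ C ∈ B, ∀ C' ∈ B, C ≠ C' → Sep C C'

/-- The vectors representing points of hyperbolic space. -/
def IsHyp (p : Mink) : Prop := IsFuture p ∧ mform p p = 2

theorem IsHyp.pos {p : Mink} (hp : IsHyp p) : 0 < mform p p := by rw [hp.2]; norm_num

/-- Otherwise the component of `X` orthogonal to the time-like vector `p` would be time-like, though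
time-like vectors have nonzero product with `p`. -/
theorem IsHyp.mform_sq_ge {p : Mink} (hp : IsHyp p) (X : Mink) :
    2 * mform X X ≤ mform p X ^ 2 := by
  by_contra! h
  have e : mform (X - (mform p X / 2) • p) (X - (mform p X / 2) • p) =
      mform X X - mform p X ^ 2 / 2 := by
    rw [mform_sub_sq]
    simp only [map_smul, LinearMap.smul_apply, smul_eq_mul, hp.2, mform_comm X p]; ring
  have h0 : 0 < mform (X - (mform p X / 2) • p) (X - (mform p X / 2) • p) := by rw [e]; linarith
  have h1 : mform p (X - (mform p X / 2) • p) = 0 := by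
    rw [map_sub, map_smul, hp.2, smul_eq_mul]; ring
  rcases isFuture_or_neg h0.le (by rintro h'; rw [h'] at h0; simp at h0) with h2 | h2
  · have := hp.1.mform_pos hp.pos h2; linarith
  · have := hp.1.mform_pos hp.pos h2; rw [map_neg] at this; linarith

/-- The right-hand side is a positive definite quadratic form, so compactness of the unit sphere
compares it with the norm. Bounds on products with `p` thereby become norm bounds. -/
theorem IsHyp.exists_norm_sq_le {p : Mink} (hp : IsHyp p) :
    ∃ K : ℝ, 0 < K ∧ ∀ X : Mink, ‖X‖ ^ 2 ≤ K * (mform p X ^ 2 - mform X X) := by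
  have hcont : Continuous fun X : Mink => mform p X ^ 2 - mform X X := by fun_prop
  have hpos : ∀ X : Mink, X ≠ 0 → 0 < mform p X ^ 2 - mform X X := by
    intro X hX
    have h1 := hp.mform_sq_ge X
    rcases lt_or_ge (mform X X) 0 with h | h
    · nlinarith [sq_nonneg (mform p X)]
    · have h2 : mform p X ≠ 0 := by
        rcases isFuture_or_neg h hX with h2 | h2
        · exact (hp.1.mform_pos hp.pos h2).ne'
        · have := hp.1.mform_pos hp.pos h2
          rw [map_neg] at this
          linarith
      have : 0 < mform p X ^ 2 := by positivity
      linarith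
  obtain ⟨X₀, hX₀, hmin⟩ := (isCompact_sphere (0 : Mink) 1).exists_isMinOn
    ⟨((1, 0, 0) : Mink), by simp [Prod.norm_def]⟩ hcont.continuousOn
  have h0 : X₀ ≠ 0 := by rintro rfl; simp at hX₀
  set m := mform p X₀ ^ 2 - mform X₀ X₀
  have hm : 0 < m := hpos X₀ h0
  refine ⟨m⁻¹, inv_pos.2 hm, fun X => ?_⟩
  rcases eq_or_ne X 0 with rfl | hX
  · simp
  have hn : 0 < ‖X‖ := norm_pos_iff.2 hX
  have := hmin (show ‖X‖⁻¹ • X ∈ Metric.sphere (0 : Mink) 1 by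
    simp [norm_smul, inv_mul_cancel₀ hn.ne'])
  simp only [map_smul, LinearMap.smul_apply, smul_eq_mul, mem_ofPred_eq] at this
  have e : (‖X‖⁻¹ * mform p X) ^ 2 - ‖X‖⁻¹ * (‖X‖⁻¹ * mform X X) =
    (mform p X ^ 2 - mform X X) / ‖X‖ ^ 2 := by field_simp
  rw [e, le_div_iff₀ (by positivity)] at this
  rw [inv_mul_eq_div, le_div_iff₀ hm]
  linarith

theorem neg_four_mul_norm_sq_le (X : Mink) : -(4 * ‖X‖ ^ 2) ≤ mform X X := by
  have h1 : ‖X.1‖ ≤ ‖X‖ := norm_fst_le X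
  have h2 : ‖X.2.1‖ ≤ ‖X‖ := (norm_fst_le X.2).trans (norm_snd_le X)
  have h3 : ‖X.2.2‖ ≤ ‖X‖ := (norm_snd_le X.2).trans (norm_snd_le X)
  have h4 : ‖X.2.1‖ ^ 2 ≤ ‖X‖ ^ 2 := pow_le_pow_left₀ (norm_nonneg _) h2 2
  have h5 : |X.1 * X.2.2| ≤ ‖X‖ * ‖X‖ := by
    rw [abs_mul]; exact mul_le_mul h1 h3 (abs_nonneg _) (norm_nonneg _)
  have h6 := neg_abs_le (X.1 * X.2.2)
  rw [sq_norm_complex] at h4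
  rw [mform_apply]
  nlinarith

/-- Infinitely many such vectors would accumulate in a ball, giving two of them at distance at most
1. The square of their difference would be at least -4, whereas separation makes it at most -8. -/
theorem PairwiseSep.finite_of_bounded {B : Set GenCircle} (hB : PairwiseSep B) {p : Mink}
    (hp : IsHyp p) (M : ℝ) : {C ∈ B | |mform p C.vec| ≤ M}.Finite := by
  obtain ⟨K, hK, hKX⟩ := hp.exists_norm_sq_le
  by_contra hinf
  rw [← Set.Infinite] at hinf
  set S := GenCircle.vec '' {C ∈ B | |mform p C.vec| ≤ M} with hS
  have hSinf : S.Infinite := hinf.image GenCircle.vec_injective.injOn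
  have hsub : S ⊆ Metric.closedBall 0 (√(K * (M ^ 2 + 2))) := by
    rintro _ ⟨C, ⟨-, hC⟩, rfl⟩
    rw [mem_closedBall_zero_iff]
    apply Real.le_sqrt_of_sq_le
    refine (hKX _).trans (mul_le_mul_of_nonneg_left ?_ hK.le)
    rw [C.vec_sq]
    have := sq_le_sq' (neg_le_of_abs_le hC) (le_of_abs_le hC)
    linarith
  obtain ⟨z, -, hz⟩ := hSinf.exists_accPt_of_subset_isCompact (isCompact_closedBall _ _) hsub
  rw [accPt_iff_nhds] at hz
  obtain ⟨X, ⟨hX1, hX2⟩, hXz⟩ := hz (Metric.ball z (1 / 2)) (Metric.ball_mem_nhds _ (by norm_num))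
  obtain ⟨Y, ⟨hY1, hY2⟩, hYz⟩ := hz (Metric.ball z (dist X z))
    (Metric.ball_mem_nhds _ (dist_pos.2 hXz))
  rw [Metric.mem_ball] at hX1 hY1
  have hXY : X ≠ Y := by rintro rfl; exact lt_irrefl _ hY1
  obtain ⟨C, ⟨hC, -⟩, rfl⟩ := hX2
  obtain ⟨C', ⟨hC', -⟩, rfl⟩ := hY2
  have h2 := (hB C hC C' hC' fun h => hXY (by rw [h])).two_le
  have h3 : ‖C.vec - C'.vec‖ ≤ 1 := by
    rw [← dist_eq_norm]
    have := dist_triangle_right C.vec C'.vec z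
    linarith
  have h4 := neg_four_mul_norm_sq_le (C.vec - C'.vec)
  rw [mform_sub_sq, C.vec_sq, C'.vec_sq] at h4
  have : ‖C.vec - C'.vec‖ ^ 2 ≤ 1 := by
    rw [sq_le_one_iff₀ (norm_nonneg _)]; exact h3
  linarith

/-- The sum of two separated circles has positive product with `p`, so `p` lies in at most one of
the closed half-spaces. -/
theorem PairwiseSep.subsingleton_nonpos {B : Set GenCircle} (hB : PairwiseSep B) {p : Mink}
    (hp : IsHyp p) : {C ∈ B | mform p C.vec ≤ 0}.Subsingleton := by
  rintro C ⟨hC, h⟩ C' ⟨hC', h'⟩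
  by_contra hne
  have := (hB C hC C' hC' hne).add_pos hp.1 hp.pos
  rw [mform_comm _ p, mform_comm _ p] at this
  linarith

theorem PairwiseSep.finite_of_le {B : Set GenCircle} (hB : PairwiseSep B) {p : Mink}
    (hp : IsHyp p) (M : ℝ) : {C ∈ B | mform p C.vec ≤ M}.Finite := by
  refine ((hB.finite_of_bounded hp M).union (hB.subsingleton_nonpos hp).finite).subset ?_
  rintro C ⟨hC, h⟩
  rcases le_or_gt (mform p C.vec) 0 with h0 | h0
  · exact Or.inr ⟨hC, h0⟩
  · exact Or.inl ⟨hC, by rwa [abs_of_pos h0]⟩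

theorem PairwiseSep.exists_pos_le {B : Set GenCircle} (hB : PairwiseSep B) {p : Mink}
    (hp : IsHyp p) (h : ∀ C ∈ B, 0 < mform p C.vec) :
    ∃ δ > 0, ∀ C ∈ B, δ ≤ mform p C.vec := by
  set S := {C ∈ B | mform p C.vec ≤ 1}
  have hS : S.Finite := hB.finite_of_le hp 1
  by_cases hne : S.Nonempty
  · obtain ⟨C₀, hC₀, hmin⟩ := S.exists_min_image (fun C => mform p C.vec) hS hne
    refine ⟨mform p C₀.vec, h C₀ hC₀.1, fun C hC => ?_⟩
    rcases le_or_gt (mform p C.vec) 1 with h1 | h1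
    · exact hmin C ⟨hC, h1⟩
    · exact hC₀.2.trans h1.le
  · refine ⟨1, one_pos, fun C hC => ?_⟩
    by_contra! h1
    exact hne ⟨C, hC, h1.le⟩

/-- The hyperbolic point `(0, 1)`. -/
def basePoint : Mink := (1, 0, 1)

theorem isHyp_basePoint : IsHyp basePoint := by
  have : mform basePoint basePoint = 2 := by simp [mform_apply, basePoint]; norm_num
  exact ⟨⟨by rw [this]; norm_num, by simp [mtrace_apply, basePoint]⟩, this⟩

theorem norm_sq_le_of_mtrace_eq_zero {X : Mink} (h : mtrace X = 0) : ‖X‖ ^ 2 ≤ -mform X X := by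
  rw [mtrace_apply] at h
  have e : X.2.2 = -X.1 := by linarith
  have h0 : ‖X‖ ^ 2 ≤ X.1 ^ 2 + ‖X.2.1‖ ^ 2 := by
    rw [Prod.norm_def, Prod.norm_def, e]
    have h1 : (0 : ℝ) ≤ X.1 ^ 2 := sq_nonneg _
    have h2 : (0 : ℝ) ≤ ‖X.2.1‖ ^ 2 := sq_nonneg _
    rcases max_choice ‖X.1‖ (max ‖X.2.1‖ ‖-X.1‖) with h' | h' <;> rw [h']
    · rw [Real.norm_eq_abs, sq_abs]; linarith
    · rcases max_choice ‖X.2.1‖ ‖-X.1‖ with h' | h' <;> rw [h']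
      · linarith
      · rw [norm_neg, Real.norm_eq_abs, sq_abs]; linarith
  rw [mform_apply, e]
  rw [sq_norm_complex] at h0
  nlinarith [sq_nonneg X.1, sq_nonneg X.2.1.re, sq_nonneg X.2.1.im]

/-- Half-spaces far from a given point are small in the projective model. -/
theorem IsHyp.exists_shrink {p : Mink} (hp : IsHyp p) {η : ℝ} (hη : 0 < η) :
    ∃ M : ℝ, ∀ D : GenCircle, M ≤ mform p D.vec → ∀ X X' : Mink, IsFuture X → IsFuture X' →
      mtrace X = 1 → mtrace X' = 1 → mform X D.vec ≤ 0 → mform X' D.vec ≤ 0 →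
        ‖X - X'‖ < η := by
  -- `L` bounds `mform p` on future vectors of trace one
  obtain ⟨L, hL0, hL⟩ : ∃ L : ℝ, 0 < L ∧ ∀ X : Mink, IsFuture X → mtrace X = 1 →
      mform p X ≤ L := by
    refine ⟨4 * ‖p‖ + 1, by positivity, fun X hX ht => ?_⟩
    have h1 := hX.nonneg_fst
    have h2 := hX.nonneg_snd
    rw [mtrace_apply] at ht
    have h3 := hX.1
    rw [mform_apply] at h3
    have b1 : |p.1| ≤ ‖p‖ := norm_fst_le p
    have b2 : ‖p.2.1‖ ≤ ‖p‖ := (norm_fst_le p.2).trans (norm_snd_le p)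
    have b3 : |p.2.2| ≤ ‖p‖ := (norm_snd_le p.2).trans (norm_snd_le p)
    have b4 : |p.2.1.re| ≤ ‖p‖ := (Complex.abs_re_le_norm _).trans b2
    have b5 : |p.2.1.im| ≤ ‖p‖ := (Complex.abs_im_le_norm _).trans b2
    have c4 : |X.2.1.re| ≤ 1 / 2 := by
      apply abs_le_of_sq_le_sq _ (by norm_num)
      nlinarith [sq_nonneg X.2.1.im, sq_nonneg (X.1 - X.2.2)]
    have c5 : |X.2.1.im| ≤ 1 / 2 := by
      apply abs_le_of_sq_le_sq _ (by norm_num)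
      nlinarith [sq_nonneg X.2.1.re, sq_nonneg (X.1 - X.2.2)]
    have d4 : |p.2.1.re * X.2.1.re| ≤ ‖p‖ * (1 / 2) := by
      rw [abs_mul]; exact mul_le_mul b4 c4 (abs_nonneg _) (norm_nonneg _)
    have d5 : |p.2.1.im * X.2.1.im| ≤ ‖p‖ * (1 / 2) := by
      rw [abs_mul]; exact mul_le_mul b5 c5 (abs_nonneg _) (norm_nonneg _)
    have d1 : p.1 * X.2.2 ≤ ‖p‖ * 1 :=
      mul_le_mul ((le_abs_self _).trans b1) (by linarith) h2 (norm_nonneg _)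
    have d3 : p.2.2 * X.1 ≤ ‖p‖ * 1 :=
      mul_le_mul ((le_abs_self _).trans b3) (by linarith) h1 (norm_nonneg _)
    have := neg_abs_le (p.2.1.re * X.2.1.re)
    have := neg_abs_le (p.2.1.im * X.2.1.im)
    rw [mform_apply]
    linarith
  have hη2 : 0 < η ^ 2 := by positivity
  -- With `P` the projection of `p` to the plane of `D`, the trace-one multiple of `P` serves as
  -- centre. The squared distance of `X` from it is at most twice `L / M`, which is below `η² / 8`.
  set M := 16 * L / η ^ 2 + 1 with hM
  refine ⟨M, fun D hD X X' hX hX' ht ht' hXD hX'D => ?_⟩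
  have hM0 : 0 < M := by positivity
  set s := mform p D.vec with hs
  have hs0 : 0 < s := hM0.trans_le hD
  set P := p + (s / 2) • D.vec with hP
  have hPP : mform P P = 2 + s ^ 2 / 2 := by
    rw [hP, mform_add_smul_sq, hp.2, D.vec_sq, ← hs]; ring
  have hPF : IsFuture P := by
    refine hp.1.of_mform_pos (by rw [hPP]; positivity) ?_
    rw [hP, map_add, map_smul, hp.2, ← hs, smul_eq_mul]
    positivity
  have hT : s < mtrace P := by
    have h1 := isHyp_basePoint.mform_sq_ge P
    rw [show mform basePoint P = mtrace P from (mtrace_eq P).symm, hPP] at h1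
    have h2 := hPF.2
    nlinarith
  have key : ∀ X : Mink, IsFuture X → mtrace X = 1 → mform X D.vec ≤ 0 →
      ‖X - (mtrace P)⁻¹ • P‖ < η / 2 := by
    intro X hX ht hXD
    have hPX : mform X P ≤ L := by
      rw [hP, map_add, map_smul, smul_eq_mul, mform_comm X p]
      have := mul_nonpos_of_nonneg_of_nonpos (by positivity : 0 ≤ s / 2) hXD
      linarith [hL X hX ht]
    have hTP : 0 < mtrace P := hPF.2
    have h1 := norm_sq_le_of_mtrace_eq_zero (X := X - (mtrace P)⁻¹ • P) (by
      rw [map_sub, map_smul, ht, smul_eq_mul, inv_mul_cancel₀ hTP.ne', sub_self])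
    rw [mform_sub_sq] at h1
    simp only [map_smul, LinearMap.smul_apply, smul_eq_mul] at h1
    have h2 : 0 ≤ (mtrace P)⁻¹ * ((mtrace P)⁻¹ * mform P P) := by
      have := hPF.1
      positivity
    have h3 : (mtrace P)⁻¹ * mform X P ≤ M⁻¹ * L := by
      have a1 : (mtrace P)⁻¹ ≤ M⁻¹ := inv_anti₀ hM0 (hD.trans hT.le)
      exact mul_le_mul a1 hPX (hX.mform_nonneg hPF) (inv_nonneg.2 hM0.le)
    have h4 : M⁻¹ * L < η ^ 2 / 16 := by
      rw [inv_mul_lt_iff₀ hM0, hM]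
      have : (16 * L / η ^ 2 + 1) * (η ^ 2 / 16) = L + η ^ 2 / 16 := by field_simp
      rw [this]
      linarith
    have h5 : ‖X - (mtrace P)⁻¹ • P‖ ^ 2 < (η / 2) ^ 2 := by
      have := hX.1
      nlinarith
    exact lt_of_pow_lt_pow_left₀ 2 (by positivity) h5
  have e : X - X' = (X - (mtrace P)⁻¹ • P) - (X' - (mtrace P)⁻¹ • P) := by abel
  rw [e]
  have := norm_sub_le (X - (mtrace P)⁻¹ • P) (X' - (mtrace P)⁻¹ • P)
  linarith [key X hX ht hXD, key X' hX' ht' hX'D]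

theorem exists_nvec_ball_subset {U : Set Sphere} (hU : IsOpen U) {y : Sphere} (hy : y ∈ U) :
    ∃ η > 0, ∀ x, ‖nvec x - nvec y‖ < η → x ∈ U := by
  have : U ∈ 𝓝 y := hU.mem_nhds hy
  rw [isClosedEmbedding_nvec.isInducing.nhds_eq_comap, Filter.mem_comap] at this
  obtain ⟨V, hV, hVU⟩ := this
  obtain ⟨η, hη, hb⟩ := Metric.mem_nhds_iff.1 hV
  refine ⟨η, hη, fun x hx => hVU (hb ?_)⟩
  rwa [Metric.mem_ball, dist_eq_norm]

theorem isOpen_nvec_ball (y : Sphere) (η : ℝ) : IsOpen {x | ‖nvec x - nvec y‖ < η} := by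
  refine isOpen_lt ?_ continuous_const
  have := continuous_nvec
  fun_prop

/-- Discs far from a hyperbolic point that meet a small neighbourhood of `y` lie close to `y`. -/
theorem IsHyp.exists_shrink_sphere {p : Mink} (hp : IsHyp p) {U : Set Sphere} (hU : IsOpen U)
    {y : Sphere} (hy : y ∈ U) : ∃ N : Set Sphere, IsOpen N ∧ y ∈ N ∧ ∃ M : ℝ, ∀ D : GenCircle,
      M ≤ mform p D.vec → (∃ x ∈ N, D.form x ≤ 0) → ∀ x, D.form x ≤ 0 → x ∈ U := by
  obtain ⟨η, hη, hb⟩ := exists_nvec_ball_subset hU hy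
  obtain ⟨M, hM⟩ := hp.exists_shrink (half_pos hη)
  refine ⟨_, isOpen_nvec_ball y (η / 2), by simpa using hη, M, ?_⟩
  rintro D hD ⟨x', hx', hx'D⟩ x hxD
  apply hb
  rw [D.form_nonpos_iff, mform_comm] at hx'D hxD
  have := hM D hD _ _ (isFuture_nvec x) (isFuture_nvec x') (mtrace_nvec x) (mtrace_nvec x') hxD hx'D
  have h2 := norm_sub_le_norm_sub_add_norm_sub (nvec x) (nvec x') (nvec y)
  rw [mem_ofPred_eq] at hx'
  linarith

/-- All but finitely many of the circles are far from the base point, hence small. A small disc that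
meets a small enough neighbourhood of `y` stays in the given one, so meeting neighbourhoods can
replace being contained in them. -/
theorem PairwiseSep.mem_accumulationPoints {B : Set GenCircle} (hB : PairwiseSep B) {y : Sphere}
    (h : ∀ N : Set Sphere, IsOpen N → y ∈ N → {C ∈ B | ∃ x ∈ N, C.form x ≤ 0}.Infinite) :
    y ∈ accumulationPoints B := by
  intro U hU hy
  obtain ⟨N, hN, hyN, M, hM⟩ := isHyp_basePoint.exists_shrink_sphere hU hy
  refine ((h N hN hyN).sdiff (hB.finite_of_le isHyp_basePoint M)).mono ?_
  rintro C ⟨⟨hC, hx⟩, hC'⟩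
  refine ⟨hC, fun x hxC => hM C ?_ hx x (le_of_eq hxC)⟩
  by_contra! h'
  exact hC' ⟨hC, h'.le⟩

theorem PairwiseSep.exists_mem_accumulationPoints {B : Set GenCircle} (hB : PairwiseSep B)
    {K : Set Sphere} (hK : IsCompact K) (h : {C ∈ B | ∃ x ∈ K, C.form x ≤ 0}.Infinite) :
    ∃ y ∈ K, y ∈ accumulationPoints B := by
  by_contra! hne
  have h1 : ∀ y ∈ K, ∃ N : Set Sphere, IsOpen N ∧ y ∈ N ∧
      {C ∈ B | ∃ x ∈ N, C.form x ≤ 0}.Finite := by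
    intro y hy
    by_contra! h'
    exact hne y hy (hB.mem_accumulationPoints fun N hN hyN => h' N hN hyN)
  choose! N hN hyN hfin using h1
  obtain ⟨t, ht⟩ := hK.elim_nhds_subcover' (fun y hy => N y) fun y hy =>
    (hN y hy).mem_nhds (hyN y hy)
  refine h ((t.finite_toSet.biUnion fun y _ => hfin y y.2).subset ?_)
  rintro C ⟨hC, x, hxK, hx⟩
  obtain ⟨y, hy, hxy⟩ := mem_iUnion₂.1 (ht hxK)
  exact mem_iUnion₂.2 ⟨y, hy, hC, x, hxy, hx⟩

theorem accumulationPoints_mono {B B' : Set GenCircle} (h : B ⊆ B') :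
    accumulationPoints B ⊆ accumulationPoints B' := fun _ hx U hU hxU =>
  (hx U hU hxU).mono fun _ hC => ⟨h hC.1, hC.2⟩

/-! ### Auxiliary facts about circles -/

theorem exists_isHyp_smul {X : Mink} (hX : IsFuture X) (h : 0 < mform X X) :
    ∃ r : ℝ, 0 < r ∧ IsHyp (r • X) := by
  have hr : 0 < √(2 / mform X X) := Real.sqrt_pos.2 (by positivity)
  refine ⟨_, hr, hX.smul hr, ?_⟩
  rw [map_smul, map_smul, LinearMap.smul_apply, smul_smul, ← sq, Real.sq_sqrt (by positivity),
    smul_eq_mul]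
  exact div_mul_cancel₀ _ h.ne'

/-- Projecting a time-like future vector to the orthogonal complement of a circle. -/
theorem GenCircle.projection (C : GenCircle) {m : Mink} (hm : IsFuture m) (h : 0 < mform m m) :
    IsFuture (m + (mform m C.vec / 2) • C.vec) ∧
    0 < mform (m + (mform m C.vec / 2) • C.vec) (m + (mform m C.vec / 2) • C.vec) ∧
    mform C.vec (m + (mform m C.vec / 2) • C.vec) = 0 := by
  have e : mform (m + (mform m C.vec / 2) • C.vec) (m + (mform m C.vec / 2) • C.vec) =
      mform m m + mform m C.vec ^ 2 / 2 := by
    rw [mform_add_smul_sq, C.vec_sq]; ring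
  refine ⟨hm.of_mform_pos (by rw [e]; positivity) ?_, by rw [e]; positivity, ?_⟩
  · rw [map_add, map_smul, smul_eq_mul]
    nlinarith [sq_nonneg (mform m C.vec)]
  · rw [map_add, map_smul, C.vec_sq, mform_comm C.vec m, smul_eq_mul]; ring

/-- At a common point, the causal sum of the two vectors is orthogonal to the light vector of the
point, hence proportional to it. The sum therefore determines the point of tangency. -/
theorem Sep.eq_of_form_eq_zero {C C' : GenCircle} (h : Sep C C') {x y : Sphere}
    (hx : C.form x = 0) (hx' : C'.form x = 0) (hy : C.form y = 0) (hy' : C'.form y = 0) :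
    x = y := by
  rw [GenCircle.form_eq] at hx hx' hy hy'
  obtain ⟨r, hr⟩ := (isFuture_pvec x).eq_smul_of_mform_eq_zero (pvec_sq x) h
    (by rw [map_add, LinearMap.add_apply, hx, hx', add_zero])
  obtain ⟨s, hs⟩ := (isFuture_pvec y).eq_smul_of_mform_eq_zero (pvec_sq y) h
    (by rw [map_add, LinearMap.add_apply, hy, hy', add_zero])
  have hN2 := h.2
  have hr0 : r ≠ 0 := by rintro rfl; simp [hr] at hN2
  have hs0 : s ≠ 0 := by rintro rfl; simp [hs] at hN2
  rw [← toPt_smul_pvec x hr0, ← hr, hs, toPt_smul_pvec y hs0]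

/-- The light vector of the tangency point is proportional to the sum of the two circles, and `d` is
orthogonal to that sum. -/
theorem Sep.form_eq_zero_of_orthogonal {C C' d : GenCircle} (h : Sep C C') {x : Sphere}
    (hx : C.form x = 0) (hx' : C'.form x = 0) (hd : mform C.vec d.vec = 0)
    (hd' : mform C'.vec d.vec = 0) : d.form x = 0 := by
  rw [GenCircle.form_eq] at hx hx' ⊢
  obtain ⟨r, hr⟩ := (isFuture_pvec x).eq_smul_of_mform_eq_zero (pvec_sq x) h
    (by rw [map_add, LinearMap.add_apply, hx, hx', add_zero])
  have hN2 := h.2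
  have hr0 : r ≠ 0 := by rintro rfl; simp [hr] at hN2
  have : mform (C.vec + C'.vec) d.vec = 0 := by
    rw [map_add, LinearMap.add_apply, hd, hd', add_zero]
  rw [hr, map_smul, LinearMap.smul_apply, smul_eq_mul, mul_eq_zero] at this
  rw [mform_comm]
  exact this.resolve_left hr0

theorem eq_zero_of_mform_eq_zero {X : Mink} (h : ∀ Y, mform Y X = 0) : X = 0 := by
  have h1 := h (1, 0, 0)
  have h2 := h (0, 1, 0)
  have h3 := h (0, Complex.I, 0)
  have h4 := h (0, 0, 1)
  simp [mform_apply] at h1 h2 h3 h4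
  exact Prod.ext h4 (Prod.ext (Complex.ext h2 h3) h1)

/-- Three circles of a packing and a circle orthogonal to them are linearly independent. -/
theorem linearIndependent_of_orthogonal {c₁ c₂ c₃ d : GenCircle} (h12 : Sep c₁ c₂)
    (h13 : Sep c₁ c₃) (h23 : Sep c₂ c₃) (h1 : mform c₁.vec d.vec = 0)
    (h2 : mform c₂.vec d.vec = 0) (h3 : mform c₃.vec d.vec = 0) :
    LinearIndependent ℝ ![c₁.vec, c₂.vec, c₃.vec, d.vec] := by
  rw [Fintype.linearIndependent_iff]
  intro g hg
  simp only [Fin.sum_univ_four, Matrix.cons_val] at hg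
  have p := h12.two_le
  have q := h13.two_le
  have r := h23.two_le
  have e1 := congrArg (mform c₁.vec) hg
  have e2 := congrArg (mform c₂.vec) hg
  have e3 := congrArg (mform c₃.vec) hg
  have e4 := congrArg (mform d.vec) hg
  simp only [map_add, map_smul, map_zero, smul_eq_mul, GenCircle.vec_sq, h1, h2, h3,
    mform_comm c₂.vec c₁.vec, mform_comm c₃.vec c₁.vec, mform_comm c₃.vec c₂.vec,
    mform_comm d.vec c₁.vec, mform_comm d.vec c₂.vec, mform_comm d.vec c₃.vec] at e1 e2 e3 e4
  set a := mform c₁.vec c₂.vec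
  set b := mform c₁.vec c₃.vec
  set c := mform c₂.vec c₃.vec
  -- The Gram determinant of the three circles, positive because all products are at least 2. The
  -- coefficients below are rows of the adjugate matrix.
  have hdet : 0 < -8 + 2 * (a * b * c) + 2 * (a ^ 2 + b ^ 2 + c ^ 2) := by
    have : 0 ≤ a * b * c := by positivity
    nlinarith
  have g0 : g 0 = 0 := by
    refine (mul_eq_zero.1 (?_ : (-8 + 2 * (a * b * c) + 2 * (a ^ 2 + b ^ 2 + c ^ 2)) * g 0 =
      0)).resolve_left hdet.ne'
    linear_combination (4 - c ^ 2) * e1 + (2 * a + b * c) * e2 + (a * c + 2 * b) * e3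
  have g1 : g 1 = 0 := by
    refine (mul_eq_zero.1 (?_ : (-8 + 2 * (a * b * c) + 2 * (a ^ 2 + b ^ 2 + c ^ 2)) * g 1 =
      0)).resolve_left hdet.ne'
    linear_combination (2 * a + b * c) * e1 + (4 - b ^ 2) * e2 + (a * b + 2 * c) * e3
  have g2 : g 2 = 0 := by
    refine (mul_eq_zero.1 (?_ : (-8 + 2 * (a * b * c) + 2 * (a ^ 2 + b ^ 2 + c ^ 2)) * g 2 =
      0)).resolve_left hdet.ne'
    linear_combination (a * c + 2 * b) * e1 + (a * b + 2 * c) * e2 + (4 - a ^ 2) * e3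
  have g3 : g 3 = 0 := by linarith
  intro i
  fin_cases i <;> assumption

/-- Together with `d` the three circles form a basis. A suitable combination of `d` and `d'` is
orthogonal to all of it, so `d'` is a multiple of `d`, and the squares leave only a sign. This lets
a face determine its dual circle. -/
theorem eq_or_eq_neg_of_orthogonal {c₁ c₂ c₃ d d' : GenCircle} (h12 : Sep c₁ c₂)
    (h13 : Sep c₁ c₃) (h23 : Sep c₂ c₃) (h1 : mform c₁.vec d.vec = 0)
    (h2 : mform c₂.vec d.vec = 0) (h3 : mform c₃.vec d.vec = 0) (h1' : mform c₁.vec d'.vec = 0)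
    (h2' : mform c₂.vec d'.vec = 0) (h3' : mform c₃.vec d'.vec = 0) : d' = d ∨ d' = d.neg := by
  have hli := linearIndependent_of_orthogonal h12 h13 h23 h1 h2 h3
  set k := mform d.vec d'.vec / 2
  have hu : d'.vec + k • d.vec = 0 := by
    apply eq_zero_of_mform_eq_zero
    suffices ∀ Y ∈ Submodule.span ℝ (range ![c₁.vec, c₂.vec, c₃.vec, d.vec]),
        mform Y (d'.vec + k • d.vec) = 0 by
      intro Y
      apply this
      rw [hli.span_eq_top_of_card_eq_finrank' (by simp)]
      trivial
    intro Y hY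
    induction hY using Submodule.span_induction with
    | zero => simp
    | add x y _ _ hx hy => rw [map_add mform, LinearMap.add_apply, hx, hy, add_zero]
    | smul r x _ hx => rw [map_smul mform, LinearMap.smul_apply, hx, smul_zero]
    | mem x hx =>
      obtain ⟨i, rfl⟩ := hx
      fin_cases i
      · simp [h1, h1']
      · simp [h2, h2']
      · simp [h3, h3']
      · simp only [Fin.reduceFinMk, Matrix.cons_val, map_add, map_smul, d.vec_sq, smul_eq_mul]
        simp only [k]; ring
  have hk : k ^ 2 = 1 := by
    have h5 := d'.vec_sq
    rw [eq_neg_of_add_eq_zero_left hu] at h5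
    simp only [map_neg, map_smul, LinearMap.neg_apply, LinearMap.smul_apply, smul_eq_mul,
      d.vec_sq] at h5
    linarith
  rcases mul_self_eq_one_iff.1 ((sq k).symm.trans hk) with h | h
  · right
    apply GenCircle.vec_injective
    rw [GenCircle.vec_neg, eq_neg_of_add_eq_zero_left hu, h, one_smul]
  · left
    apply GenCircle.vec_injective
    rw [eq_neg_of_add_eq_zero_left hu, h, neg_smul, one_smul, neg_neg]

section

/-! ### The faces of the tangency graphs -/

/-- Duality is symmetric. -/
def GraphDuality.symm {A : Set Sphere} {B B' : Set GenCircle} (D : GraphDuality A B B') :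
    GraphDuality A B' B where
  face := D.face'
  face' := D.face
  edge := D.edge.symm
  edge_face c e := by have := D.edge_face' c (D.edge.symm e); rwa [Equiv.apply_symm_apply] at this
  edge_face' d e := by have := D.edge_face d (D.edge.symm e); rwa [Equiv.apply_symm_apply] at this
  vertex_face d c := (D.vertex_face c d).symm

/-- Dual configurations, with the metric relations of the circles expressed by the form. -/
structure DualConfig (A : Set Sphere) (B B' : Set GenCircle) (D : GraphDuality A B B') : Prop where
  sep : PairwiseSep B
  sep' : PairwiseSep B'
  nontrivial : B.Nontrivial
  nontrivial' : B'.Nontrivial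
  orth_or_sep : ∀ c ∈ B, ∀ d ∈ B', mform c.vec d.vec = 0 ∨ Sep c d
  meet : ∀ c ∈ B, ∀ d ∈ B', mform c.vec d.vec = 0 → ∃ x, c.form x = 0 ∧ d.form x = 0
  orth_of_meet : ∀ c ∈ B, ∀ d ∈ B', ∀ x, c.form x = 0 → d.form x = 0 → mform c.vec d.vec = 0
  incident : ∀ (c : B) (d : B'), Incident A c (D.face d) ↔ mform c.1.vec d.1.vec = 0
  subsingleton : A.Subsingleton
  accumulation : accumulationPoints (B ∪ B') = A

theorem mem_of_mem_closure_connectedComponentIn {U : Set Sphere} {x y : Sphere} (hx : x ∈ U)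
    (hy : y ∈ closure (connectedComponentIn U x)) (hyU : y ∈ U) : y ∈ connectedComponentIn U x := by
  have h1 : IsPreconnected (insert y (connectedComponentIn U x)) :=
    isPreconnected_connectedComponentIn.subset_closure (subset_insert _ _)
      (insert_subset hy subset_closure)
  exact h1.subset_connectedComponentIn (mem_insert_of_mem _ (mem_connectedComponentIn hx))
    (insert_subset hyU (connectedComponentIn_subset _ _)) (mem_insert _ _)

namespace DualConfig

variable {A : Set Sphere} {B B' : Set GenCircle} {D : GraphDuality A B B'}

theorem symm (h : DualConfig A B B' D) : DualConfig A B' B D.symm where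
  sep := h.sep'
  sep' := h.sep
  nontrivial := h.nontrivial'
  nontrivial' := h.nontrivial
  orth_or_sep d hd c hc := by
    rw [mform_comm]; exact (h.orth_or_sep c hc d hd).imp id Sep.symm
  meet d hd c hc hm := by
    rw [mform_comm] at hm
    obtain ⟨x, h1, h2⟩ := h.meet c hc d hd hm
    exact ⟨x, h2, h1⟩
  orth_of_meet d hd c hc x hx hx' := by rw [mform_comm]; exact h.orth_of_meet c hc d hd x hx' hx
  incident d c := by
    rw [mform_comm, ← h.incident]; exact (D.vertex_face c d).symm
  subsingleton := h.subsingleton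
  accumulation := by rw [union_comm]; exact h.accumulation

/-- Otherwise some circle of the configurations would lie entirely inside `d`, but each of them is
`d` itself, crosses it, or is separated from it. -/
theorem notMem_of_mem_interior (h : DualConfig A B B' D) {d : GenCircle} (hd : d ∈ B')
    {x : Sphere} (hx : d.form x < 0) : x ∉ A := by
  intro hxA
  rw [← h.accumulation] at hxA
  obtain ⟨C, hC, hCd⟩ := (hxA _ d.isOpen_interior hx).nonempty
  have hneg : ∀ y, C.form y = 0 → d.form y < 0 := fun y hy => hCd hy
  have hsep : ¬ Sep C d := fun hs => by
    obtain ⟨y, -, -, hy, -⟩ := C.exists_two_mem_carrier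
    have := hs.form_add_nonneg y
    linarith [hneg y hy]
  rcases hC with hC | hC
  · rcases h.orth_or_sep C hC d hd with h1 | h1
    · obtain ⟨y, hy, hy'⟩ := h.meet C hC d hd h1
      linarith [hneg y hy]
    · exact hsep h1
  · by_cases e : C = d
    · subst e
      obtain ⟨y, -, -, hy, -⟩ := C.exists_two_mem_carrier
      linarith [hneg y hy]
    · exact hsep (h.sep' C hC d hd e)

/-- Away from the accumulation point the base discs are locally finite, so those not containing `y`
can be avoided by shrinking the neighbourhood. -/
theorem exists_nhds (h : DualConfig A B B' D) {y : Sphere} (hy : y ∉ A) :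
    ∃ N : Set Sphere, IsOpen N ∧ y ∈ N ∧ Disjoint N A ∧
      ∀ C ∈ B, ∀ x ∈ N, C.form x ≤ 0 → C.form y ≤ 0 := by
  have h1 : ∃ N : Set Sphere, IsOpen N ∧ y ∈ N ∧ {C ∈ B | ∃ x ∈ N, C.form x ≤ 0}.Finite := by
    by_contra! h'
    refine hy ?_
    rw [← h.accumulation]
    exact accumulationPoints_mono subset_union_left
      (h.sep.mem_accumulationPoints fun N hN hyN => h' N hN hyN)
  obtain ⟨N, hN, hyN, hfin⟩ := h1
  set S := {C ∈ B | ∃ x ∈ N, C.form x ≤ 0} ∩ {C | 0 < C.form y}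
  have hS : S.Finite := hfin.inter_of_left _
  refine ⟨(N ∩ Aᶜ) ∩ ⋂ C ∈ S, {x | 0 < C.form x}, ?_, ⟨⟨hyN, hy⟩, ?_⟩, ?_, ?_⟩
  · exact (hN.inter h.subsingleton.isClosed.isOpen_compl).inter
      (hS.isOpen_biInter fun C _ => C.isOpen_form_pos)
  · exact mem_iInter₂.2 fun C hC => hC.2
  · exact disjoint_left.2 fun x hx => hx.1.2
  · intro C hC x hx hxC
    by_contra! h'
    have := mem_iInter₂.1 hx.2 C ⟨⟨hC, x, hx.1.1, hxC⟩, h'⟩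
    rw [mem_ofPred_eq] at this
    linarith

theorem isOpen_outside (h : DualConfig A B B' D) : IsOpen (outside A B) := by
  rw [isOpen_iff_forall_mem_open]
  rintro y ⟨hyA, hy⟩
  obtain ⟨N, hN, hyN, hNA, hNB⟩ := h.exists_nhds hyA
  refine ⟨N, fun x hx => ⟨disjoint_left.1 hNA hx, fun C hC => ?_⟩, hN, hyN⟩
  by_contra! h'
  have := hNB C hC x hx h'
  linarith [hy C hC]

theorem face_eq {F : Set Sphere} (hF : F ∈ faces A B) {x : Sphere} (hx : x ∈ F) :
    x ∈ outside A B ∧ F = connectedComponentIn (outside A B) x := by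
  obtain ⟨y, hy, rfl⟩ := hF
  exact ⟨connectedComponentIn_subset _ _ hx, connectedComponentIn_eq hx⟩

theorem face_nonempty {F : Set Sphere} (hF : F ∈ faces A B) : F.Nonempty := by
  obtain ⟨y, hy, rfl⟩ := hF
  exact ⟨y, mem_connectedComponentIn hy⟩

theorem isOpen_face (h : DualConfig A B B' D) {F : Set Sphere} (hF : F ∈ faces A B) :
    IsOpen F := by
  obtain ⟨y, hy, rfl⟩ := hF
  exact h.isOpen_outside.connectedComponentIn

theorem face_injective {d d' : B'} {x : Sphere} (hx : x ∈ (D.face d : Set Sphere))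
    (hx' : x ∈ (D.face d' : Set Sphere)) : d = d' := by
  apply D.face.injective
  apply Subtype.ext
  rw [(face_eq (D.face d).2 hx).2, (face_eq (D.face d').2 hx').2]

theorem subset_face {F S : Set Sphere} (hF : F ∈ faces A B) (hS : IsPreconnected S)
    (hSo : S ⊆ outside A B) {x : Sphere} (hx : x ∈ F) (hxS : x ∈ S) : S ⊆ F := by
  rw [(face_eq hF hx).2]
  exact hS.subset_connectedComponentIn hxS hSo

theorem mem_face_of_mem_closure {F : Set Sphere} (hF : F ∈ faces A B) {y : Sphere}
    (hy : y ∈ closure F) (hyo : y ∈ outside A B) : y ∈ F := by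
  obtain ⟨x, hx, rfl⟩ := hF
  exact mem_of_mem_closure_connectedComponentIn hx hy hyo

theorem exists_mem_face {D : GraphDuality A B B'} {x : Sphere} (hx : x ∈ outside A B) :
    ∃ d : B', x ∈ (D.face d : Set Sphere) := by
  refine ⟨D.face.symm ⟨connectedComponentIn (outside A B) x, x, hx, rfl⟩, ?_⟩
  rw [Equiv.apply_symm_apply]
  exact mem_connectedComponentIn hx

/-- There is a hyperbolic point outside all the half-spaces bounded by circles of `B`. -/
theorem exists_isHyp (h : DualConfig A B B' D) : ∃ p, IsHyp p ∧ ∀ c ∈ B, 0 < mform p c.vec := by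
  obtain ⟨d, hd, d', hd', hne⟩ := h.nontrivial'
  obtain ⟨x, hx⟩ := face_nonempty (D.face ⟨d, hd⟩).2
  obtain ⟨y, hy⟩ := face_nonempty (D.face ⟨d', hd'⟩).2
  have hxy : x ≠ y := by
    rintro rfl
    exact hne (congrArg Subtype.val (face_injective hx hy))
  have hpos : 0 < mform (pvec x) (pvec y) := by
    refine lt_of_le_of_ne ((isFuture_pvec x).mform_nonneg (isFuture_pvec y)) fun h0 => hxy ?_
    obtain ⟨r, hr⟩ := (isFuture_pvec y).eq_smul_of_mform_eq_zero (pvec_sq y) (isFuture_pvec x)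
      h0.symm
    have hr0 : r ≠ 0 := by
      rintro rfl
      have := (isFuture_pvec x).2
      rw [hr, zero_smul, map_zero] at this
      exact lt_irrefl _ this
    have := toPt_smul_pvec x one_ne_zero
    rw [one_smul, hr, toPt_smul_pvec y hr0] at this
    exact this.symm
  -- A point of the geodesic joining points of two different faces: both ends are outside all base
  -- discs, hence so is every point of the geodesic.
  obtain ⟨r, hr, hp⟩ := exists_isHyp_smul ((isFuture_pvec x).add (isFuture_pvec y))
    (by rw [mform_add_sq, pvec_sq, pvec_sq]; linarith)
  refine ⟨_, hp, fun c hc => ?_⟩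
  have h1 := (face_eq (D.face ⟨d, hd⟩).2 hx).1.2 c hc
  have h2 := (face_eq (D.face ⟨d', hd'⟩).2 hy).1.2 c hc
  rw [c.form_eq, mform_comm] at h1 h2
  rw [map_smul, LinearMap.smul_apply, smul_eq_mul, map_add, LinearMap.add_apply]
  positivity

/-- If only two base circles bordered the face, it would fill the connected region outside both of
them, apart from the accumulation point. It would then be the only face, although there are at least
two dual circles. -/
theorem exists_third (h : DualConfig A B B' D) {d : GenCircle} (hd : d ∈ B') {c₁ c₂ : GenCircle}
    (h1 : c₁ ∈ B) (h2 : c₂ ∈ B) : ∃ c ∈ B, mform c.vec d.vec = 0 ∧ c ≠ c₁ ∧ c ≠ c₂ := by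
  by_contra! hcon
  set F : Set Sphere := (D.face ⟨d, hd⟩).1 with hFdef
  have hF : F ∈ faces A B := (D.face ⟨d, hd⟩).2
  set U : Set Sphere := {x | 0 < c₁.form x ∧ 0 < c₂.form x}
  have hU : IsOpen U := c₁.isOpen_form_pos.inter c₂.isOpen_form_pos
  have hsub : outside A B ⊆ U \ A := fun x hx => ⟨⟨hx.2 c₁ h1, hx.2 c₂ h2⟩, hx.1⟩
  have hFo : F ⊆ outside A B := fun x hx => (face_eq hF hx).1
  have hpre := isPreconnected_diff_subsingleton hU (c₁.isPreconnected_exteriors c₂) h.subsingleton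
  obtain ⟨x, hx⟩ := face_nonempty hF
  have key : U \ A ⊆ F := by
    refine hpre.subset_of_closure_inter_subset (h.isOpen_face hF) ⟨x, hsub (hFo hx), hx⟩ ?_
    rintro y ⟨hyF, hyU, hyA⟩
    refine mem_face_of_mem_closure hF hyF ⟨hyA, fun c hc => ?_⟩
    by_contra! hle
    have h0 : c.form y = 0 := by
      refine le_antisymm hle ?_
      by_contra! hneg
      obtain ⟨z, hz1, hz2⟩ := mem_closure_iff.1 hyF _ c.isOpen_interior hneg
      have := (hFo hz2).2 c hc
      rw [GenCircle.interior, mem_ofPred_eq] at hz1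
      linarith
    have hc0 := (h.incident ⟨c, hc⟩ ⟨d, hd⟩).1 ⟨y, hyA, h0, hyF⟩
    by_cases e : c = c₁
    · subst e; linarith [hyU.1]
    · have := hcon c hc hc0 e
      subst this; linarith [hyU.2]
  obtain ⟨d', hd', hne⟩ := h.nontrivial'.exists_ne d
  obtain ⟨y, hy⟩ := face_nonempty (D.face ⟨d', hd'⟩).2
  have hy' : y ∈ F := key (hsub (face_eq (D.face ⟨d', hd'⟩).2 hy).1)
  exact hne (congrArg Subtype.val (face_injective hy hy'))

theorem exists_three (h : DualConfig A B B' D) {d : GenCircle} (hd : d ∈ B') :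
    ∃ c₁ ∈ B, ∃ c₂ ∈ B, ∃ c₃ ∈ B, (Sep c₁ c₂ ∧ Sep c₁ c₃ ∧ Sep c₂ c₃) ∧
      mform c₁.vec d.vec = 0 ∧ mform c₂.vec d.vec = 0 ∧ mform c₃.vec d.vec = 0 := by
  obtain ⟨c₀, hc₀⟩ := h.nontrivial.nonempty
  obtain ⟨c₁, h1, o1, -, -⟩ := h.exists_third hd hc₀ hc₀
  obtain ⟨c₂, h2, o2, n2, -⟩ := h.exists_third hd h1 h1
  obtain ⟨c₃, h3, o3, n3, n3'⟩ := h.exists_third hd h1 h2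
  exact ⟨c₁, h1, c₂, h2, c₃, h3, ⟨h.sep _ h1 _ h2 n2.symm, h.sep _ h1 _ h3 n3.symm,
    h.sep _ h2 _ h3 n3'.symm⟩, o1, o2, o3⟩

/-- The part of the interior of a dual circle lying outside the base circles that cross it. -/
def core (B : Set GenCircle) (d : GenCircle) : Set Sphere :=
  {x | d.form x < 0 ∧ ∀ c ∈ B, mform c.vec d.vec = 0 → 0 < c.form x}

theorem core_subset_outside (h : DualConfig A B B' D) {d : GenCircle} (hd : d ∈ B') :
    core B d ⊆ outside A B := by
  rintro x ⟨h1, h2⟩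
  refine ⟨h.notMem_of_mem_interior hd h1, fun c hc => ?_⟩
  rcases h.orth_or_sep c hc d hd with h3 | h3
  · exact h2 c hc h3
  · linarith [h3.form_add_nonneg x]

theorem isPreconnected_core (B : Set GenCircle) (d : GenCircle) : IsPreconnected (core B d) := by
  have := isPreconnected_dome d.vec_sq (𝒞 := GenCircle.vec '' {c ∈ B | mform c.vec d.vec = 0})
    (by rintro _ ⟨c, hc, rfl⟩; exact hc.2)
  convert this using 1
  ext x
  simp only [core, GenCircle.form_eq, mem_ofPred_eq, forall_mem_image, and_imp]

/-- The part of the interior of a dual circle that lies outside the base circles is contained in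
the corresponding face. -/
theorem core_subset_face (h : DualConfig A B B' D) (d : B') :
    core B d.1 ⊆ (D.face d : Set Sphere) := by
  obtain ⟨d, hd⟩ := d
  obtain ⟨p, hp, hpB⟩ := h.exists_isHyp
  -- The projection to the plane of `d` of a point outside all base half-spaces stays outside those
  -- orthogonal to `d`. Lifting it into the disc of `d` gives a point of the core.
  obtain ⟨m1, m2, m3⟩ := d.projection hp.1 hp.pos
  set m := p + (mform p d.vec / 2) • d.vec with hmdef
  have hmc : ∀ c ∈ B, mform c.vec d.vec = 0 → 0 < mform m c.vec := fun c hc ho => by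
    rw [hmdef, map_add, map_smul, LinearMap.add_apply, LinearMap.smul_apply, mform_comm d.vec, ho]
    simpa using hpB c hc
  have hmd : mform m d.vec = 0 := by rw [mform_comm]; exact m3
  have hneg : ∀ m' : Mink, IsFuture m' → 0 < mform m' m' → mform m' d.vec = 0 →
      d.form (toPt (m' + √(mform m' m' / 2) • d.vec)) < 0 := by
    intro m' h1 h2 h3
    obtain ⟨h5, h6⟩ := isFuture_add_sqrt_smul d.vec_sq h1 h3
    rw [d.form_eq, ← neg_pos, ← LinearMap.neg_apply, ← map_neg, mform_toPt_pos_iff h5 h6]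
    have := Real.sqrt_pos.2 (half_pos h2)
    simp only [map_neg, map_add, map_smul, LinearMap.neg_apply, mform_comm d.vec m', h3, d.vec_sq,
      smul_eq_mul]
    linarith
  obtain ⟨w, hw⟩ : (core B d).Nonempty := by
    obtain ⟨h5, h6⟩ := isFuture_add_sqrt_smul d.vec_sq m1 hmd
    refine ⟨toPt (m + √(mform m m / 2) • d.vec), hneg m m1 m2 hmd, fun c hc ho => ?_⟩
    rw [c.form_eq, mform_toPt_pos_iff h5 h6, map_add, map_smul, ho, mform_comm]
    simpa using hmc c hc ho
  obtain ⟨⟨d', hd'⟩, hwd'⟩ := exists_mem_face (D := D) (h.core_subset_outside hd hw)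
  have hsub := subset_face (D.face ⟨d', hd'⟩).2 (isPreconnected_core B d)
    (h.core_subset_outside hd) hwd' hw
  suffices d' = d by subst this; exact hsub
  -- The core lies in the face of some `d'`. Every base circle crossing `d` turns out to border that
  -- face and hence to cross `d'`; three such circles then force `d' = d`.
  have key : ∀ c ∈ B, mform c.vec d.vec = 0 → mform c.vec d'.vec = 0 := by
    intro c hc ho
    rw [← h.incident ⟨c, hc⟩ ⟨d', hd'⟩]
    obtain ⟨n1, n2, n3⟩ := c.projection m1 m2
    -- A second projection, to the plane of `c`. It gives a point of `c` inside `d` that is strictly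
    -- outside the other circles crossing `d`, hence in the closure of the core.
    set m' := m + (mform m c.vec / 2) • c.vec with hm'def
    have hm'd : mform m' d.vec = 0 := by
      rw [hm'def, map_add, map_smul, LinearMap.add_apply, LinearMap.smul_apply, ho, hmd]; simp
    obtain ⟨h5, h6⟩ := isFuture_add_sqrt_smul d.vec_sq n1 hm'd
    set y := toPt (m' + √(mform m' m' / 2) • d.vec)
    have hyd : d.form y < 0 := hneg m' n1 n2 hm'd
    have hyc : c.form y = 0 := by
      have e : mform c.vec (m' + √(mform m' m' / 2) • d.vec) = 0 := by
        rw [map_add, map_smul, ho, n3]; simp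
      apply le_antisymm
      · rw [c.form_eq, ← neg_nonneg, ← LinearMap.neg_apply, ← map_neg,
          mform_toPt_nonneg_iff h5 h6, map_neg, LinearMap.neg_apply, e, neg_zero]
      · rw [c.form_eq, mform_toPt_nonneg_iff h5 h6, e]
    have hyc' : ∀ c' ∈ B, mform c'.vec d.vec = 0 → c' ≠ c → 0 < c'.form y := by
      intro c' hc' ho' hne
      rw [c'.form_eq, mform_toPt_pos_iff h5 h6, map_add, map_smul, ho', hm'def, map_add, map_smul,
        mform_comm _ m, smul_eq_mul, smul_zero, add_zero]
      have h7 := (h.sep c' hc' c hc hne).two_le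
      have h8 := hmc c hc ho
      have h9 := hmc c' hc' ho'
      positivity
    have hyA := h.notMem_of_mem_interior hd hyd
    refine ⟨y, hyA, hyc, closure_mono hsub ?_⟩
    obtain ⟨N, hN, hyN, -, hNB⟩ := h.exists_nhds hyA
    rw [mem_closure_iff]
    intro O hO hyO
    obtain ⟨z, ⟨⟨hz1, hz2⟩, hz3⟩, hz4⟩ := mem_closure_iff.1 (GenCircle.mem_closure_exterior hyc) _
      ((hO.inter hN).inter d.isOpen_interior) ⟨⟨hyO, hyN⟩, hyd⟩
    refine ⟨z, hz1, hz3, fun c' hc' ho' => ?_⟩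
    by_cases e : c' = c
    · subst e; exact hz4
    · by_contra! hle
      have := hNB c' hc' z hz2 hle
      linarith [hyc' c' hc' ho' e]
  obtain ⟨c₁, h1, c₂, h2, c₃, h3, ⟨s1, s2, s3⟩, o1, o2, o3⟩ := h.exists_three hd
  rcases eq_or_eq_neg_of_orthogonal s1 s2 s3 o1 o2 o3 (key _ h1 o1) (key _ h2 o2) (key _ h3 o3)
    with e | e
  · exact e
  · by_contra hne
    have := (h.sep' d' hd' d hd hne).2
    rw [e, GenCircle.vec_neg, neg_add_cancel, map_zero] at this
    exact absurd this (lt_irrefl _)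

/-- Corresponding edges of the two graphs are the same points of tangency. -/
theorem edge_eq (h : DualConfig A B B' D) (e : edges A B) : (D.edge e : Sphere) = e := by
  obtain ⟨heA, c, hc, c', hc', hcc, hec, hec'⟩ := e.2
  obtain ⟨heA', d, hd, d', hd', hdd, hed, hed'⟩ := (D.edge e).2
  -- Both base circles tangent at `e` border each face incident to `e`, so the dual circle of that
  -- face is orthogonal to both and passes through their tangency point. Two dual circles through
  -- both `e` and its partner identify the points.
  have key : ∀ d (hd : d ∈ B'), (D.edge e : Sphere) ∈ d.carrier → d.form e = 0 := by
    intro d hd hed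
    have h1 := (D.edge_face ⟨d, hd⟩ e).2 hed
    have h2 := (h.incident ⟨c, hc⟩ ⟨d, hd⟩).1 ⟨e, heA, hec, h1⟩
    have h3 := (h.incident ⟨c', hc'⟩ ⟨d, hd⟩).1 ⟨e, heA, hec', h1⟩
    exact (h.sep c hc c' hc' hcc).form_eq_zero_of_orthogonal hec hec' h2 h3
  exact (h.sep' d hd d' hd' hdd).eq_of_form_eq_zero hed hed' (key d hd hed) (key d' hd' hed')

theorem form_eq_zero_of_edge (h : DualConfig A B B' D) {y : Sphere} (hy : y ∈ edges A B) (d : B')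
    (hd : y ∈ closure (D.face d : Set Sphere)) : d.1.form y = 0 := by
  have := (D.edge_face d ⟨y, hy⟩).1 hd
  rwa [h.edge_eq] at this

theorem edges_subset (h : DualConfig A B B' D) : edges A B ⊆ edges A B' := fun y hy => by
  rw [← show (D.edge ⟨y, hy⟩ : Sphere) = y from h.edge_eq _]
  exact (D.edge ⟨y, hy⟩).2

theorem mem_edges (h : DualConfig A B B' D) {y : Sphere} (hyA : y ∉ A) {c c' : GenCircle}
    (hc : c ∈ B) (hc' : c' ∈ B) (hcc : c ≠ c') (hy : c.form y ≤ 0) (hy' : c'.form y ≤ 0) :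
    y ∈ edges A B := by
  have := (h.sep c hc c' hc' hcc).form_add_nonneg y
  have h1 : c.form y = 0 := by linarith
  have h2 : c'.form y = 0 := by linarith
  exact ⟨hyA, c, hc, c', hc', hcc, h1, h2⟩

theorem core_of_outside {d : GenCircle} {x : Sphere} (hx : x ∈ outside A B) (hd : d.form x < 0) :
    x ∈ core B d := ⟨hd, fun c hc _ => hx.2 c hc⟩

/-- Near a point of a base circle that is not a point of tangency, the outside of the base circles
is connected. -/
theorem exists_halfDisc (h : DualConfig A B B' D) {y : Sphere} (hyA : y ∉ A)
    (hye : y ∉ edges A B) {c : GenCircle} (hc : c ∈ B) (hyc : c.form y ≤ 0) :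
    ∃ N : Set Sphere, IsOpen N ∧ y ∈ N ∧ IsPreconnected (N ∩ {x | 0 < c.form x}) ∧
      N ∩ {x | 0 < c.form x} ⊆ outside A B := by
  obtain ⟨N, hN, hyN, hNA, hNB⟩ := h.exists_nhds hyA
  obtain ⟨u, hyu, huN, -⟩ := exists_disc_subset hN hyN
  refine ⟨u.interior, u.isOpen_interior, hyu, ?_, ?_⟩
  · have := u.neg.isPreconnected_exteriors c
    simp only [GenCircle.form_neg, neg_pos] at this
    exact this
  · rintro x ⟨hx1, hx2⟩
    refine ⟨disjoint_left.1 hNA (huN hx1), fun c' hc' => ?_⟩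
    by_contra! hle
    by_cases e : c = c'
    · subst e; exact absurd hx2 hle.not_gt
    · exact hye (h.mem_edges hyA hc hc' e hyc (hNB c' hc' x (huN hx1) hle))

/-- The closed discs of a configuration and its dual cover the sphere, up to the accumulation
point. -/
theorem exists_form_nonpos (h : DualConfig A B B' D) {x : Sphere} (hxA : x ∉ A) :
    ∃ C ∈ B ∪ B', C.form x ≤ 0 := by
  by_contra! hcon
  have hxB : x ∈ outside A B := ⟨hxA, fun c hc => hcon c (Or.inl hc)⟩
  have hxB' : x ∈ outside A B' := ⟨hxA, fun c hc => hcon c (Or.inr hc)⟩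
  obtain ⟨⟨d, hd⟩, hxd⟩ := exists_mem_face (D := D) hxB
  obtain ⟨⟨c, hc⟩, hxc⟩ := exists_mem_face (D := D.symm) hxB'
  set Y := outside A B ∩ outside A B' with hY
  have hYo : IsOpen Y := h.isOpen_outside.inter h.symm.isOpen_outside
  have hxY : x ∈ Y := ⟨hxB, hxB'⟩
  -- A component of the uncovered region. It will be shown to fill everything outside the two discs
  -- `c` and `d` of the faces containing it, apart from `A`.
  set Q := connectedComponentIn Y x with hQdef
  have hQo : IsOpen Q := hYo.connectedComponentIn
  have hxQ : x ∈ Q := mem_connectedComponentIn hxY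
  have hQY : Q ⊆ Y := connectedComponentIn_subset _ _
  have hQF : Q ⊆ (D.face ⟨d, hd⟩ : Set Sphere) := subset_face (D.face _).2
    isPreconnected_connectedComponentIn (hQY.trans inter_subset_left) hxd hxQ
  have hQF' : Q ⊆ (D.symm.face ⟨c, hc⟩ : Set Sphere) := subset_face (D.symm.face _).2
    isPreconnected_connectedComponentIn (hQY.trans inter_subset_right) hxc hxQ
  set U : Set Sphere := {x | 0 < c.form x ∧ 0 < d.form x}
  have hU : IsOpen U := c.isOpen_form_pos.inter d.isOpen_form_pos
  have hYU : Y ⊆ U \ A := fun z hz => ⟨⟨hz.1.2 c hc, hz.2.2 d hd⟩, hz.1.1⟩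
  have hpre := isPreconnected_diff_subsingleton hU (c.isPreconnected_exteriors d) h.subsingleton
  have key : U \ A ⊆ Q := by
    refine hpre.subset_of_closure_inter_subset hQo ⟨x, hYU hxY, hxQ⟩ ?_
    rintro y ⟨hyQ, ⟨hyc, hyd⟩, hyA⟩
    refine mem_of_mem_closure_connectedComponentIn hxY hyQ ?_
    have hnn : ∀ C ∈ B ∪ B', 0 ≤ C.form y := by
      intro C hC
      by_contra! hneg
      obtain ⟨z, hz1, hz2⟩ := mem_closure_iff.1 hyQ _ C.isOpen_interior hneg
      have h0 : 0 < C.form z := hC.elim (fun hC => (hQY hz2).1.2 C hC) fun hC => (hQY hz2).2.2 C hC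
      rw [GenCircle.interior, mem_ofPred_eq] at hz1
      linarith
    by_contra hyY
    -- Here `y` is in the face of `d` and in a closed dual disc `d'`. Points inside `d'` near `y`
    -- lie in the core of `d'`, so `d' = d`, contrary to `y` being outside `d`.
    by_cases hyB : y ∈ outside A B
    · have hyF := mem_face_of_mem_closure (D.face ⟨d, hd⟩).2 (closure_mono hQF hyQ) hyB
      have hyB' : ¬ ∀ C ∈ B', 0 < C.form y := fun h' => hyY ⟨hyB, hyA, h'⟩
      push Not at hyB'
      obtain ⟨d', hd', hle⟩ := hyB'
      obtain ⟨z, hz1, hz2⟩ := mem_closure_iff.1 (GenCircle.mem_closure_interior_of_nonpos hle) _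
        (h.isOpen_face (D.face ⟨d, hd⟩).2) hyF
      have hz3 := h.core_subset_face ⟨d', hd'⟩
        (core_of_outside (face_eq (D.face ⟨d, hd⟩).2 hz1).1 hz2)
      have := congrArg Subtype.val (face_injective hz1 hz3)
      simp only at this
      subst this
      linarith
    by_cases hyB' : y ∈ outside A B'
    · have hyF := mem_face_of_mem_closure (D.symm.face ⟨c, hc⟩).2 (closure_mono hQF' hyQ) hyB'
      have hyB : ¬ ∀ C ∈ B, 0 < C.form y := fun h' => hyY ⟨⟨hyA, h'⟩, hyB'⟩
      push Not at hyB
      obtain ⟨c', hc', hle⟩ := hyB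
      obtain ⟨z, hz1, hz2⟩ := mem_closure_iff.1 (GenCircle.mem_closure_interior_of_nonpos hle) _
        (h.symm.isOpen_face (D.symm.face ⟨c, hc⟩).2) hyF
      have hz3 := h.symm.core_subset_face ⟨c', hc'⟩
        (core_of_outside (face_eq (D.symm.face ⟨c, hc⟩).2 hz1).1 hz2)
      have := congrArg Subtype.val (face_injective hz1 hz3)
      simp only at this
      subst this
      linarith
    -- Here `y` is an orthogonal crossing of a base circle `c'` and a dual circle `d'`. It is not a
    -- tangency point, since otherwise `d` would pass through it. A half-disc beside `c'` is thus
    -- contained in the face of `d` and contains points inside `d'`, so again `d' = d`.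
    have hB0 : ¬ ∀ C ∈ B, 0 < C.form y := fun h' => hyB ⟨hyA, h'⟩
    have hB0' : ¬ ∀ C ∈ B', 0 < C.form y := fun h' => hyB' ⟨hyA, h'⟩
    push Not at hB0 hB0'
    obtain ⟨c', hc', hle⟩ := hB0
    obtain ⟨d', hd', hle'⟩ := hB0'
    have hc0 : c'.form y = 0 := le_antisymm hle (hnn c' (Or.inl hc'))
    have hd0 : d'.form y = 0 := le_antisymm hle' (hnn d' (Or.inr hd'))
    have ho := h.orth_of_meet c' hc' d' hd' y hc0 hd0
    have hye : y ∉ edges A B := fun hye => by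
      have := h.form_eq_zero_of_edge hye ⟨d, hd⟩ (closure_mono hQF hyQ)
      simp only at this
      linarith
    obtain ⟨N, hN, hyN, hNp, hNo⟩ := h.exists_halfDisc hyA hye hc' hle
    obtain ⟨z, hz1, hz2⟩ := mem_closure_iff.1 hyQ N hN hyN
    have hNF : N ∩ {x | 0 < c'.form x} ⊆ (D.face ⟨d, hd⟩ : Set Sphere) :=
      subset_face (D.face _).2 hNp hNo (hQF hz2) ⟨hz1, (hQY hz2).1.2 c' hc'⟩
    obtain ⟨z', hz1', hz2', hz3'⟩ := mem_closure_iff.1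
      (GenCircle.mem_closure_exterior_interior hc0 hd0 ho) N hN hyN
    have hz4 := h.core_subset_face ⟨d', hd'⟩ (core_of_outside (hNo ⟨hz1', hz2'⟩) hz3')
    have := congrArg Subtype.val (face_injective (hNF ⟨hz1', hz2'⟩) hz4)
    simp only at this
    subst this
    linarith
  -- A second dual disc has an interior point outside `c` and `d`, which would belong to the
  -- uncovered region.
  obtain ⟨d', hd', hne⟩ := h.nontrivial'.exists_ne d
  obtain ⟨z, hzd', hzc⟩ : ∃ z, d'.form z < 0 ∧ 0 < c.form z := by
    rcases h.orth_or_sep c hc d' hd' with ho | hs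
    · obtain ⟨y, hy, hy'⟩ := h.meet c hc d' hd' ho
      obtain ⟨z, hz1, hz2, hz3⟩ := mem_closure_iff.1
        (GenCircle.mem_closure_exterior_interior hy hy' ho) univ isOpen_univ trivial
      exact ⟨z, hz3, hz2⟩
    · obtain ⟨y, -, -, hy, -⟩ := d'.exists_two_mem_carrier
      obtain ⟨z, -, hz⟩ := mem_closure_iff.1 (GenCircle.mem_closure_interior hy) univ isOpen_univ
        trivial
      rw [GenCircle.interior, mem_ofPred_eq] at hz
      exact ⟨z, hz, by linarith [hs.form_add_nonneg z]⟩
  have hzd : 0 < d.form z := by linarith [(h.sep' d' hd' d hd hne).form_add_nonneg z]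
  have := (hQY (key ⟨⟨hzc, hzd⟩, h.notMem_of_mem_interior hd' hzd'⟩)).2.2 d' hd'
  linarith

end DualConfig

end

/-! ### The covering by discs, and its derivation from the hypotheses -/

section

namespace DualConfig

variable {A : Set Sphere} {B B' : Set GenCircle} {D : GraphDuality A B B'}

/-- A face of the tangency graph is contained in the interior of the dual circle. -/
theorem face_subset_interior (h : DualConfig A B B' D) (d : B') {x : Sphere}
    (hx : x ∈ (D.face d : Set Sphere)) : d.1.form x < 0 := by
  have key : ∀ z ∈ (D.face d : Set Sphere), d.1.form z ≤ 0 := by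
    intro z hz
    have hzo := (face_eq (D.face d).2 hz).1
    obtain ⟨C, hC | hC, hle⟩ := h.exists_form_nonpos hzo.1
    · linarith [hzo.2 C hC]
    -- Points of the face just inside the covering dual disc `C` are in the core of `C`, hence in
    -- its face, so `C` is the dual circle of the face at hand.
    · obtain ⟨w, hw1, hw2⟩ := mem_closure_iff.1 (GenCircle.mem_closure_interior_of_nonpos hle) _
        (h.isOpen_face (D.face d).2) hz
      have hw3 := h.core_subset_face ⟨C, hC⟩
        (core_of_outside (face_eq (D.face d).2 hw1).1 hw2)
      rwa [face_injective hw1 hw3]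
  refine lt_of_le_of_ne (key x hx) fun h0 => ?_
  obtain ⟨z, hz1, hz2⟩ := mem_closure_iff.1 (GenCircle.mem_closure_exterior h0) _
    (h.isOpen_face (D.face d).2) hx
  exact absurd hz2 (key z hz1).not_gt

/-- A point in no interior is a point of tangency of the dual circles. -/
theorem mem_edges_of_nonneg (h : DualConfig A B B' D) {x : Sphere} (hxA : x ∉ A)
    (hx : ∀ C ∈ B ∪ B', 0 ≤ C.form x) : x ∈ edges A B' := by
  by_contra hxe
  have hxe' : x ∉ edges A B := fun h' => hxe (h.edges_subset h')
  have hxo : x ∉ outside A B := fun hxo => by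
    obtain ⟨d, hd⟩ := exists_mem_face (D := D) hxo
    linarith [h.face_subset_interior d hd, hx d.1 (Or.inr d.2)]
  have : ¬ ∀ c ∈ B, 0 < c.form x := fun h' => hxo ⟨hxA, h'⟩
  push Not at this
  obtain ⟨c, hc, hle⟩ := this
  have hc0 := le_antisymm hle (hx c (Or.inl hc))
  -- A half-disc beside `c` lies in one face and hence inside its dual circle. That circle passes
  -- through `x` orthogonally to `c`, yet points outside both circles come arbitrarily close to `x`.
  obtain ⟨N, hN, hxN, hNp, hNo⟩ := h.exists_halfDisc hxA hxe' hc hle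
  obtain ⟨z, hz⟩ := mem_closure_iff.1 (GenCircle.mem_closure_exterior hc0) N hN hxN
  obtain ⟨d, hzd⟩ := exists_mem_face (D := D) (hNo hz)
  have hsub : ∀ w ∈ N ∩ {x | 0 < c.form x}, d.1.form w < 0 := fun w hw =>
    h.face_subset_interior d (subset_face (D.face d).2 hNp hNo hzd hz hw)
  have hd0 : d.1.form x = 0 := by
    refine le_antisymm ?_ (hx d.1 (Or.inr d.2))
    by_contra! hpos
    obtain ⟨w, hw1, hw2⟩ := mem_closure_iff.1 (GenCircle.mem_closure_exterior hc0) _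
      (hN.inter d.1.isOpen_form_pos) ⟨hxN, hpos⟩
    have := hsub w ⟨hw1.1, hw2⟩
    have := hw1.2
    rw [mem_ofPred_eq] at this
    linarith
  obtain ⟨w, hw1, hw2, hw3⟩ := mem_closure_iff.1
    (GenCircle.mem_closure_exteriors hc0 hd0 (h.orth_of_meet c hc d d.2 x hc0 hd0)) N hN hxN
  linarith [hsub w ⟨hw1, hw2⟩]

end DualConfig

theorem GenCircle.orthogonal_iff {C C' : GenCircle} : C.Orthogonal C' ↔ mform C.vec C'.vec = 0 := by
  simp only [GenCircle.Orthogonal, mform_apply, GenCircle.vec, Complex.mul_re, Complex.conj_re,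
    Complex.conj_im]
  constructor <;> intro h <;> linarith

theorem GenCircle.sep_of_disjoint_interior {C C' : GenCircle}
    (h : Disjoint C.carrier C'.carrier ∨ C.Tangent C')
    (hi : Disjoint C.interior C'.interior) : Sep C C' := by
  obtain ⟨x, y, hxy, hx, hy⟩ := C.exists_two_mem_carrier
  by_cases hx' : C'.form x = 0
  · by_cases hy' : C'.form y = 0
    · exfalso
      rcases h with h | ⟨z, hz⟩
      · exact disjoint_left.1 h hx hx'
      · have h1 : x ∈ C.carrier ∩ C'.carrier := ⟨hx, hx'⟩
        have h2 : y ∈ C.carrier ∩ C'.carrier := ⟨hy, hy'⟩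
        rw [hz] at h1 h2
        exact hxy (h1.trans h2.symm)
    · exact sep_of_disjoint hi hy hy'
  · exact sep_of_disjoint hi hx hx'

theorem DisjointOrTangent.pairwiseSep {B : Set GenCircle} (h : DisjointOrTangent B) :
    PairwiseSep B := fun C hC C' hC' hne =>
  GenCircle.sep_of_disjoint_interior (h C hC C' hC' hne).1 (h C hC C' hC' hne).2

theorem IsBaseDual.exists_dualConfig {B B' : Set GenCircle} (h : IsBaseDual B B') :
    ∃ D, DualConfig (accumulationPoints (B ∪ B')) B B' D := by
  obtain ⟨D, hD⟩ := h.duality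
  have key : ∀ c ∈ B, ∀ d ∈ B', ((c.carrier ∩ d.carrier).Nonempty ↔ mform c.vec d.vec = 0) ∧
      (mform c.vec d.vec = 0 ∨ Sep c d) := by
    intro c hc d hd
    obtain ⟨-, h2, h3⟩ := hD ⟨c, hc⟩ ⟨d, hd⟩
    by_cases hne : (c.carrier ∩ d.carrier).Nonempty
    · have := GenCircle.orthogonal_iff.1 (h2 hne)
      exact ⟨⟨fun _ => this, fun _ => hne⟩, Or.inl this⟩
    · have hs : Sep c d := GenCircle.sep_of_disjoint_interior
        (Or.inl (disjoint_iff_inter_eq_empty.2 (not_nonempty_iff_eq_empty.1 hne))) (h3 hne)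
      exact ⟨⟨fun h => absurd h hne, fun h => by linarith [hs.two_le]⟩, Or.inr hs⟩
  refine ⟨D, h.base_disjoint.pairwiseSep, h.dual_disjoint.pairwiseSep, h.base_nontrivial,
    h.dual_nontrivial, fun c hc d hd => (key c hc d hd).2,
    fun c hc d hd h => (key c hc d hd).1.2 h,
    fun c hc d hd x h1 h2 => (key c hc d hd).1.1 ⟨x, h1, h2⟩,
    fun c d => ?_, h.accumulation, rfl⟩
  rw [← (hD c d).1]
  exact (key c c.2 d d.2).1

end

/-! ### The Lorentz group and its actions -/

/-- The orthochronous Lorentz group. -/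
def lor : Subgroup (Mink ≃ₗ[ℝ] Mink) where
  carrier := {T | (∀ X Y, mform (T X) (T Y) = mform X Y) ∧ ∀ X, IsFuture (T X) ↔ IsFuture X}
  one_mem' := ⟨fun _ _ => rfl, fun _ => Iff.rfl⟩
  mul_mem' := fun {S T} hS hT => ⟨fun X Y => (hS.1 _ _).trans (hT.1 _ _),
    fun X => (hS.2 _).trans (hT.2 _)⟩
  inv_mem' := fun {T} hT => by
    have e : ∀ X, T (T⁻¹ X) = X := T.apply_symm_apply
    exact ⟨fun X Y => by rw [← hT.1, e, e], fun X => by rw [← hT.2, e]⟩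

@[simp] theorem lor_mform (T : lor) (X Y : Mink) : mform (T.1 X) (T.1 Y) = mform X Y := T.2.1 X Y

@[simp] theorem lor_isFuture (T : lor) {X : Mink} : IsFuture (T.1 X) ↔ IsFuture X := T.2.2 X

@[simp] theorem lor_isHyp (T : lor) {X : Mink} : IsHyp (T.1 X) ↔ IsHyp X := by simp [IsHyp]

theorem lor_mul_apply (S T : lor) (X : Mink) : (S * T).1 X = S.1 (T.1 X) := rfl

@[simp] theorem lor_one_apply (X : Mink) : (1 : lor).1 X = X := rfl

@[simp] theorem lor_apply_inv (T : lor) (X : Mink) : T.1 (T⁻¹.1 X) = X := T.1.apply_symm_apply X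

@[simp] theorem lor_inv_apply (T : lor) (X : Mink) : T⁻¹.1 (T.1 X) = X := T.1.symm_apply_apply X

theorem lor_mform_inv (T : lor) (X Y : Mink) : mform (T⁻¹.1 X) Y = mform X (T.1 Y) := by
  rw [← lor_mform T, lor_apply_inv]

theorem lor_mform_left (T : lor) (X Y : Mink) : mform (T.1 X) Y = mform X (T⁻¹.1 Y) := by
  rw [← lor_mform T X, lor_apply_inv]

theorem lor_continuous (T : lor) : Continuous T.1 :=
  LinearMap.continuous_of_finiteDimensional (T.1 : Mink →ₗ[ℝ] Mink)

theorem lor_ext {S T : lor} (h : ∀ X, S.1 X = T.1 X) : S = T :=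
  Subtype.ext (LinearEquiv.ext h)

/-- The two light vectors spanning the time axis detect future vectors. -/
theorem IsFuture.pos_pvec {X : Mink} (hX : IsFuture X) :
    0 < mform X (pvec OnePoint.infty) ∨ 0 < mform X (pvec ((0 : ℂ) : Sphere)) := by
  have h1 := hX.2
  have h2 := hX.nonneg_fst
  rw [mtrace_apply] at h1
  simp only [mform_apply, pvec_infty, pvec_coe]
  simp
  by_contra! h
  linarith

/-- A linear map that preserves the form and sends two light vectors to future vectors is in the
Lorentz group. -/
theorem exists_lor (f : Mink →ₗ[ℝ] Mink) (h : ∀ X, mform (f X) (f X) = mform X X)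
    (h0 : IsFuture (f (pvec OnePoint.infty))) (h1 : IsFuture (f (pvec ((0 : ℂ) : Sphere)))) :
    ∃ T : lor, ∀ X, T.1 X = f X := by
  have hp : ∀ X Y, mform (f X) (f Y) = mform X Y := by
    intro X Y
    have e1 := h (X + Y)
    rw [map_add, mform_add_sq, mform_add_sq, h, h] at e1
    linarith
  have hinj : Function.Injective f := by
    rw [injective_iff_map_eq_zero]
    intro X hX
    exact eq_zero_of_mform_eq_zero fun Y => by rw [← hp, hX, map_zero]
  -- Every future vector has positive product with one of the two light vectors, and `f` preserves
  -- products.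
  have hF : ∀ X, IsFuture X → IsFuture (f X) := fun X hX => by
    rcases hX.pos_pvec with h2 | h2
    · exact h0.of_mform_pos (by rw [h]; exact hX.1) (by rwa [hp, mform_comm])
    · exact h1.of_mform_pos (by rw [h]; exact hX.1) (by rwa [hp, mform_comm])
  refine ⟨⟨LinearEquiv.ofInjectiveEndo f hinj, fun X Y => hp X Y, fun X => ⟨fun hX => ?_, hF X⟩⟩,
    fun X => rfl⟩
  have hX' : IsFuture (f X) := hX
  have hnn : 0 ≤ mform X X := by rw [← h]; exact hX'.1
  have hX0 : X ≠ 0 := by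
    rintro rfl
    have := hX'.2
    simp at this
  refine (isFuture_or_neg hnn hX0).resolve_right fun hneg => ?_
  have := (hX'.add (hF _ hneg)).2
  simp at this

/-- The linear reflection across the circle `C`. -/
def reflMap (C : GenCircle) : Mink →ₗ[ℝ] Mink := LinearMap.id + (mform C.vec).smulRight C.vec

theorem reflMap_apply (C : GenCircle) (X : Mink) :
    reflMap C X = X + mform C.vec X • C.vec := rfl

/-- If the image of a future vector were past, their difference, a nonzero multiple of `C.vec`,
would be causal; but `C.vec` is space-like. -/
theorem exists_refl (C : GenCircle) : ∃ T : lor, ∀ X, T.1 X = X + mform C.vec X • C.vec := by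
  have hsq : ∀ X, mform (reflMap C X) (reflMap C X) = mform X X := fun X => by
    rw [reflMap_apply, mform_add_smul_sq, C.vec_sq, mform_comm X C.vec]; ring
  have hF : ∀ X, IsFuture X → IsFuture (reflMap C X) := by
    intro X hX
    by_cases h0 : mform C.vec X = 0
    · rwa [reflMap_apply, h0, zero_smul, add_zero]
    have hne : reflMap C X ≠ 0 := fun h => by
      have h2 := congrArg (mform C.vec) h
      rw [reflMap_apply, map_add, map_smul, C.vec_sq, smul_eq_mul, map_zero] at h2
      exact h0 (by linarith)
    refine (isFuture_or_neg ((hsq X).symm ▸ hX.1) hne).resolve_right fun hneg => ?_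
    have h1 := (hX.add hneg).1
    rw [reflMap_apply, neg_add, add_neg_cancel_left] at h1
    simp only [map_neg, map_smul, LinearMap.neg_apply, LinearMap.smul_apply, C.vec_sq,
      smul_eq_mul] at h1
    have := mul_self_pos.2 h0
    linarith
  exact exists_lor (reflMap C) hsq (hF _ (isFuture_pvec _)) (hF _ (isFuture_pvec _))

/-- The reflection across the circle `C`, in the Lorentz group. -/
def refl (C : GenCircle) : lor := (exists_refl C).choose

theorem refl_apply (C : GenCircle) (X : Mink) : (refl C).1 X = X + mform C.vec X • C.vec :=
  (exists_refl C).choose_spec X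

@[simp] theorem refl_mul_self (C : GenCircle) : refl C * refl C = 1 := lor_ext fun X => by
  rw [lor_mul_apply, refl_apply, refl_apply, map_add, map_smul, C.vec_sq, lor_one_apply]
  simp only [smul_eq_mul, add_smul, mul_neg, neg_smul]
  module

@[simp] theorem refl_inv (C : GenCircle) : (refl C)⁻¹ = refl C :=
  inv_eq_of_mul_eq_one_left (refl_mul_self C)

theorem refl_vec (C : GenCircle) : (refl C).1 C.vec = -C.vec := by
  rw [refl_apply, C.vec_sq]; module

theorem refl_mform (C : GenCircle) (X Y : Mink) :
    mform ((refl C).1 X) Y = mform X Y + mform C.vec X * mform C.vec Y := by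
  rw [refl_apply, map_add, map_smul, LinearMap.add_apply, LinearMap.smul_apply, smul_eq_mul]

theorem refl_mform_right (C : GenCircle) (X Y : Mink) :
    mform X ((refl C).1 Y) = mform X Y + mform C.vec X * mform C.vec Y := by
  rw [mform_comm, refl_mform, mform_comm Y]; ring

theorem refl_apply_of_eq_zero {C : GenCircle} {X : Mink} (h : mform C.vec X = 0) :
    (refl C).1 X = X := by rw [refl_apply, h, zero_smul, add_zero]

/-! #### Circles -/

instance : MulAction lor GenCircle where
  smul T C := GenCircle.ofVec (T.1 C.vec) (by rw [lor_mform, C.vec_sq])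
  one_smul C := GenCircle.vec_injective rfl
  mul_smul S T C := GenCircle.vec_injective rfl

@[simp] theorem vec_smul (T : lor) (C : GenCircle) : (T • C).vec = T.1 C.vec := rfl

theorem sep_smul (T : lor) {C C' : GenCircle} : Sep (T • C) (T • C') ↔ Sep C C' := by
  rw [Sep, vec_smul, vec_smul, ← map_add, lor_isFuture, Sep]

theorem refl_smul (T : lor) (C : GenCircle) : refl (T • C) = T * refl C * T⁻¹ :=
  lor_ext fun X => by
    rw [lor_mul_apply, lor_mul_apply, refl_apply, refl_apply, vec_smul, map_add, map_smul,
      lor_apply_inv, lor_mform_left]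

/-! #### The sphere -/

theorem lor_exists_pvec (T : lor) (x : Sphere) :
    ∃ r : ℝ, 0 < r ∧ T.1 (pvec x) = r • pvec (toPt (T.1 (pvec x))) :=
  exists_eq_smul_pvec ((lor_isFuture T).2 (isFuture_pvec x)) (by rw [lor_mform, pvec_sq])

instance : MulAction lor Sphere where
  smul T x := toPt (T.1 (pvec x))
  one_smul x := by
    have := toPt_smul_pvec x one_ne_zero
    rwa [one_smul] at this
  mul_smul S T x := by
    obtain ⟨r, hr, e⟩ := lor_exists_pvec T x
    obtain ⟨r', hr', e'⟩ := lor_exists_pvec S (toPt (T.1 (pvec x)))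
    change toPt (S.1 (T.1 (pvec x))) = toPt (S.1 (pvec (toPt (T.1 (pvec x)))))
    conv_lhs => rw [e, map_smul, e', smul_smul]
    rw [toPt_smul_pvec _ (by positivity)]

theorem lor_smul_def (T : lor) (x : Sphere) : T • x = toPt (T.1 (pvec x)) := rfl

theorem exists_smul_pvec (T : lor) (x : Sphere) :
    ∃ r : ℝ, 0 < r ∧ T.1 (pvec x) = r • pvec (T • x) := lor_exists_pvec T x

theorem exists_form_smul (T : lor) (C : GenCircle) (x : Sphere) :
    ∃ r : ℝ, 0 < r ∧ C.form x = r * (T • C).form (T • x) := by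
  obtain ⟨r, hr, e⟩ := exists_smul_pvec T x
  refine ⟨r, hr, ?_⟩
  rw [GenCircle.form_eq, GenCircle.form_eq, ← lor_mform T, e, map_smul, smul_eq_mul, vec_smul]

theorem form_smul_neg_iff (T : lor) {C : GenCircle} {x : Sphere} :
    (T • C).form (T • x) < 0 ↔ C.form x < 0 := by
  obtain ⟨r, hr, e⟩ := exists_form_smul T C x
  rw [e]
  rw [← neg_pos, ← neg_pos (a := r * _), ← mul_neg]
  exact (mul_pos_iff_of_pos_left hr).symm

theorem form_smul_pos_iff (T : lor) {C : GenCircle} {x : Sphere} :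
    0 < (T • C).form (T • x) ↔ 0 < C.form x := by
  obtain ⟨r, hr, e⟩ := exists_form_smul T C x
  rw [e]
  exact (mul_pos_iff_of_pos_left hr).symm

theorem form_smul_nonpos_iff (T : lor) {C : GenCircle} {x : Sphere} :
    (T • C).form (T • x) ≤ 0 ↔ C.form x ≤ 0 := by
  rw [← not_lt, ← not_lt, form_smul_pos_iff]

theorem form_smul_eq_zero_iff (T : lor) {C : GenCircle} {x : Sphere} :
    (T • C).form (T • x) = 0 ↔ C.form x = 0 := by
  rw [le_antisymm_iff, le_antisymm_iff, form_smul_nonpos_iff, ← not_lt (b := 0),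
    form_smul_neg_iff, not_lt]

theorem interior_smul (T : lor) (C : GenCircle) :
    (T • C).interior = (fun x => T • x) '' C.interior := by
  ext x
  constructor
  · intro hx
    refine ⟨T⁻¹ • x, ?_, smul_inv_smul T x⟩
    rw [GenCircle.interior, mem_ofPred_eq, ← form_smul_neg_iff T, smul_inv_smul]
    exact hx
  · rintro ⟨y, hy, rfl⟩
    exact (form_smul_neg_iff T).2 hy

theorem continuous_lor_smul (T : lor) : Continuous fun x : Sphere => T • x := by
  have e : (fun x : Sphere => T • x) = fun x => toPt (T.1 (nvec x)) := by
    ext x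
    obtain ⟨r, hr, e⟩ := exists_smul_pvec T x
    rw [nvec, map_smul, e, smul_smul, toPt_smul_pvec _ (mul_pos (inv_pos.2 (mtrace_pvec_pos x)) hr).ne']
  rw [e]
  refine continuousOn_toPt.comp_continuous ((lor_continuous T).comp continuous_nvec) fun x => ?_
  exact ⟨(lor_isFuture T).2 (isFuture_nvec x), by rw [lor_mform, nvec_sq]⟩

/-- The action on the sphere. -/
def toSphere : lor →* Equiv.Perm Sphere := MulAction.toPermHom lor Sphere

@[simp] theorem toSphere_apply (T : lor) (x : Sphere) : toSphere T x = T • x := rfl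

theorem image_toSphere_interior (T : lor) (C : GenCircle) :
    toSphere T '' C.interior = (T • C).interior := (interior_smul T C).symm

/-- The linear formula gives numerator and denominator with the common factor `a z + b`, by the
normalization of the circle. Cancelling it leaves the inversion formula; where the factor vanishes,
the image is infinity. -/
theorem toSphere_refl (C : GenCircle) : toSphere (refl C) = C.reflection := by
  ext x : 1
  rw [toSphere_apply, lor_smul_def, refl_apply, ← GenCircle.form_eq]
  rw [GenCircle.reflection, Equiv.Perm.mul_apply, MulAction.toPerm_apply, conjPerm_apply]
  have hn := C.normalized
  rw [sq_norm_complex] at hn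
  induction x using OnePoint.rec with
  | infty =>
    rw [OnePoint.map_infty, OnePoint.smul_infty_eq_ite]
    simp only [toPt, GenCircle.form, pvec_infty, GenCircle.vec, Matrix.GeneralLinearGroup.mkOfDetNeZero]
    simp
    by_cases ha : C.a = 0
    · simp [ha]
    · rw [if_neg ha, if_neg ha]
      have : (C.a : ℂ) ≠ 0 := by exact_mod_cast ha
      congr 1
      field_simp
  | coe z =>
    rw [OnePoint.map_some, OnePoint.smul_some_eq_ite]
    simp only [toPt, GenCircle.form, pvec_coe, GenCircle.vec,
      Matrix.GeneralLinearGroup.mkOfDetNeZero]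
    simp
    set F : ℝ := C.a * ‖z‖ ^ 2 + 2 * (C.b.re * z.re + C.b.im * z.im) + C.c with hF
    have h1 : ((1 + F * C.a : ℝ) : ℂ) =
        (C.a * (starRingEnd ℂ) z + (starRingEnd ℂ) C.b) * (C.a * z + C.b) := by
      rw [hF, sq_norm_complex, sq, sq]
      apply Complex.ext
      · simp; linear_combination -hn
      · simp; ring
    have h2 : -(F * C.b : ℂ) + z = (-(C.b * (starRingEnd ℂ) z) + -C.c) * (C.a * z + C.b) := by
      rw [hF, sq_norm_complex, sq, sq]
      apply Complex.ext
      · simp; linear_combination -z.re * hn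
      · simp; linear_combination -z.im * hn
    have h3 : (starRingEnd ℂ) (C.a * z + C.b) =
        C.a * (starRingEnd ℂ) z + (starRingEnd ℂ) C.b := by simp
    push_cast at h1
    by_cases hw : (C.a : ℂ) * z + C.b = 0
    · rw [← h3, hw, map_zero, zero_mul] at h1
      rw [← h3, hw, map_zero, if_pos (by exact_mod_cast h1), if_pos rfl]
    · have hw' : (C.a : ℂ) * (starRingEnd ℂ) z + (starRingEnd ℂ) C.b ≠ 0 :=
        fun h => hw ((map_eq_zero _).1 (h3.trans h))
      have h4 : 1 + F * C.a ≠ 0 := by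
        have := mul_ne_zero hw' hw
        rw [← h1] at this
        exact_mod_cast this
      rw [if_neg h4, if_neg hw']
      congr 1
      push_cast [hF] at h1 h2 ⊢
      rw [h1, h2, mul_div_mul_right _ _ hw]

/-! ### Hyperbolic space in the Lorentz model -/

/-- The vector of a point of hyperbolic space. -/
def vecH (p : H3) : Mink := (p.1.2⁻¹, -(p.1.2⁻¹ • p.1.1), p.1.2⁻¹ * (‖p.1.1‖ ^ 2 + p.1.2 ^ 2))

theorem isHyp_vecH (p : H3) : IsHyp (vecH p) := by
  obtain ⟨⟨z, t⟩, ht⟩ := p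
  have ht' : 0 < t := ht
  have h : mform (vecH ⟨(z, t), ht⟩) (vecH ⟨(z, t), ht⟩) = 2 := by
    simp only [vecH, mform_apply, sq_norm_complex]
    simp
    field_simp
    ring
  refine ⟨⟨by rw [h]; norm_num, ?_⟩, h⟩
  simp only [vecH, mtrace_apply]
  positivity

/-- The point of hyperbolic space with a given vector. -/
def ofHyp (X : Mink) (hX : IsHyp X) : H3 :=
  ⟨(-(X.1⁻¹ • X.2.1), X.1⁻¹), inv_pos.2 (hX.1.fst_pos hX.pos)⟩

theorem vecH_ofHyp (X : Mink) (hX : IsHyp X) : vecH (ofHyp X hX) = X := by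
  have h0 := hX.1.fst_pos hX.pos
  have h1 := hX.2
  obtain ⟨a, b, c⟩ := X
  simp only [mform_apply] at h0 h1
  refine Prod.ext ?_ (Prod.ext ?_ ?_)
  · simp [vecH, ofHyp]
  · simp [vecH, ofHyp, h0.ne']
  · simp only [vecH, ofHyp, sq_norm_complex]
    simp
    field_simp
    linarith

theorem vecH_injective : Function.Injective vecH := by
  rintro ⟨⟨z, t⟩, ht⟩ ⟨⟨z', t'⟩, ht'⟩ h
  simp only [vecH, Prod.mk.injEq] at h
  have ht : t ≠ 0 := ne_of_gt ht
  obtain ⟨h1, h2, -⟩ := h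
  have e := inv_injective h1
  subst e
  have := smul_right_injective ℂ (inv_ne_zero ht) (neg_injective h2)
  subst this
  rfl

theorem IsHyp.mform_nonneg {X Y : Mink} (hX : IsHyp X) (hY : IsHyp Y) : 0 < mform X Y :=
  hX.1.mform_pos hX.pos hY.1

theorem IsHyp.two_le {X Y : Mink} (hX : IsHyp X) (hY : IsHyp Y) : 2 ≤ mform X Y := by
  have h1 := hX.mform_sq_ge Y
  have h2 := hX.mform_nonneg hY
  rw [hY.2] at h1
  nlinarith

/-- The hyperbolic distance in terms of the form. -/
theorem hdist_eq (p q : H3) : hdist p q = Real.arcosh (mform (vecH p) (vecH q) / 2) := by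
  obtain ⟨⟨z, t⟩, ht⟩ := p
  obtain ⟨⟨w, s⟩, hs⟩ := q
  have ht' : t ≠ 0 := ne_of_gt ht
  have hs' : s ≠ 0 := ne_of_gt hs
  rw [hdist]
  congr 1
  simp only [vecH, mform_apply, sq_norm_complex]
  simp
  field_simp
  ring

theorem hdist_le_hdist_iff (p q p' q' : H3) :
    hdist p q ≤ hdist p' q' ↔ mform (vecH p) (vecH q) ≤ mform (vecH p') (vecH q') := by
  have h1 := (isHyp_vecH p).two_le (isHyp_vecH q)
  have h2 := (isHyp_vecH p').two_le (isHyp_vecH q')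
  rw [hdist_eq, hdist_eq, Real.arcosh_le_arcosh (by linarith) (by linarith)]
  exact div_le_div_iff_of_pos_right two_pos

theorem mform_le_of_hdist_le {p q : H3} {r : ℝ} (h : hdist p q ≤ r) :
    mform (vecH p) (vecH q) ≤ 2 * Real.cosh r := by
  have h1 := (isHyp_vecH p).two_le (isHyp_vecH q)
  have h2 : (1 : ℝ) ≤ mform (vecH p) (vecH q) / 2 := by linarith
  rw [hdist_eq] at h
  have h3 := Real.arcosh_nonneg h2
  have h4 := Real.cosh_arcosh h2
  have : Real.cosh (Real.arcosh (mform (vecH p) (vecH q) / 2)) ≤ Real.cosh r := by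
    rw [Real.cosh_le_cosh, abs_of_nonneg h3, abs_of_nonneg (h3.trans h)]; exact h
  linarith

instance : MulAction lor H3 where
  smul T p := ofHyp (T.1 (vecH p)) ((lor_isHyp T).2 (isHyp_vecH p))
  one_smul p := vecH_injective (vecH_ofHyp _ _)
  mul_smul S T p := vecH_injective (by
    change vecH (ofHyp _ _) = vecH (ofHyp _ _)
    rw [vecH_ofHyp, vecH_ofHyp]
    change _ = S.1 (vecH (ofHyp _ _))
    rw [vecH_ofHyp]; rfl)

@[simp] theorem vecH_smul (T : lor) (p : H3) : vecH (T • p) = T.1 (vecH p) := vecH_ofHyp _ _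

/-- The action on hyperbolic space. -/
def toH3 : lor →* Equiv.Perm H3 := MulAction.toPermHom lor H3

@[simp] theorem toH3_apply (T : lor) (p : H3) : toH3 T p = T • p := rfl

theorem toH3_mem_isometryGroup (T : lor) : toH3 T ∈ isometryGroup := fun p q => by
  rw [hdist_eq, hdist_eq, toH3_apply, toH3_apply, vecH_smul, vecH_smul, lor_mform]

theorem mem_hyperbolicPlane_iff (C : GenCircle) (p : H3) :
    p ∈ hyperbolicPlane C ↔ mform C.vec (vecH p) = 0 := by
  obtain ⟨⟨z, t⟩, ht⟩ := p
  have ht' : t ≠ 0 := ne_of_gt ht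
  rw [hyperbolicPlane, mem_ofPred_eq]
  have : mform C.vec (vecH ⟨(z, t), ht⟩) = t⁻¹ * (C.a * (‖z‖ ^ 2 + t ^ 2) +
      2 * ((starRingEnd ℂ) C.b * z).re + C.c) := by
    simp only [vecH, mform_apply, GenCircle.vec]
    simp
    ring
  rw [this, mul_eq_zero, or_iff_right (inv_ne_zero ht')]

theorem exists_mform_ne_zero (C : GenCircle) : ∃ X, IsHyp X ∧ mform C.vec X ≠ 0 := by
  obtain ⟨x, hx⟩ := mem_closure_iff.1 (GenCircle.mem_closure_interior
    C.exists_two_mem_carrier.choose_spec.choose_spec.2.1) univ isOpen_univ trivial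
  have hx : C.form x < 0 := hx.2
  by_contra! h
  have h1 := h _ isHyp_basePoint
  obtain ⟨r, hr, hX⟩ := exists_isHyp_smul (isHyp_basePoint.1.add (isFuture_pvec x))
    (isHyp_basePoint.1.add_pos_sq isHyp_basePoint.pos (isFuture_pvec x))
  have h2 := h _ hX
  rw [map_smul, map_add, h1, zero_add, ← GenCircle.form_eq, smul_eq_mul] at h2
  exact mul_ne_zero hr.ne' hx.ne h2

theorem isReflection_refl (C : GenCircle) : IsReflection (toH3 (refl C)) := by
  refine ⟨toH3_mem_isometryGroup _, fun h => ?_, C, fun p hp => ?_⟩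
  · obtain ⟨X, hX, h0⟩ := exists_mform_ne_zero C
    have h1 := congrArg vecH (Equiv.Perm.ext_iff.1 h (ofHyp X hX))
    rw [toH3_apply, vecH_smul, Equiv.Perm.one_apply, vecH_ofHyp, refl_apply] at h1
    have h2 := congrArg (mform C.vec) h1
    rw [map_add, map_smul, C.vec_sq, smul_eq_mul] at h2
    exact h0 (by linarith)
  · apply vecH_injective
    rw [toH3_apply, vecH_smul, refl_apply_of_eq_zero ((mem_hyperbolicPlane_iff C p).1 hp)]

/-! ### The compactification of hyperbolic space -/

/-- The vector of a point of hyperbolic space, normalized by its trace. -/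
def nvecH (p : H3) : Mink := (mtrace (vecH p))⁻¹ • vecH p

theorem mtrace_vecH_pos (p : H3) : 0 < mtrace (vecH p) := (isHyp_vecH p).1.2

theorem mtrace_nvecH (p : H3) : mtrace (nvecH p) = 1 := by
  rw [nvecH, map_smul, smul_eq_mul, inv_mul_cancel₀ (mtrace_vecH_pos p).ne']

theorem isFuture_nvecH (p : H3) : IsFuture (nvecH p) :=
  (isHyp_vecH p).1.smul (inv_pos.2 (mtrace_vecH_pos p))

theorem sqrt_mform_nvecH (p : H3) :
    √(mform (nvecH p) (nvecH p) / 2) = (mtrace (vecH p))⁻¹ := by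
  have : mform (nvecH p) (nvecH p) / 2 = (mtrace (vecH p))⁻¹ ^ 2 := by
    rw [nvecH, map_smul, map_smul, LinearMap.smul_apply, (isHyp_vecH p).2, smul_eq_mul, smul_eq_mul]
    ring
  rw [this, Real.sqrt_sq (inv_pos.2 (mtrace_vecH_pos p)).le]

/-- An embedding of the compactification of the half-space, compatible with the vectors of points
of the sphere and of hyperbolic space. -/
def compactVec (x : OnePoint (ℂ × ℝ)) : Mink × ℝ :=
  x.elim (((0, 0, 1) : Mink), 0) fun w =>
    (1 + (‖w.1‖ ^ 2 + w.2 ^ 2))⁻¹ • (((1, -w.1, ‖w.1‖ ^ 2 + w.2 ^ 2) : Mink), w.2)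

theorem compactVec_coe (w : ℂ × ℝ) : compactVec (w : OnePoint (ℂ × ℝ)) =
    (1 + (‖w.1‖ ^ 2 + w.2 ^ 2))⁻¹ • (((1, -w.1, ‖w.1‖ ^ 2 + w.2 ^ 2) : Mink), w.2) := rfl

theorem compactVec_ofBoundary (y : Sphere) : compactVec (ofBoundary y) = (nvec y, 0) := by
  induction y using OnePoint.rec with
  | infty => rw [nvec_infty]; rfl
  | coe z =>
    rw [ofBoundary, OnePoint.map_some, compactVec_coe, nvec_coe]
    simp

theorem compactVec_ofH3 (p : H3) : compactVec (ofH3 p) = (nvecH p, (mtrace (vecH p))⁻¹) := by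
  obtain ⟨⟨z, t⟩, ht⟩ := p
  have ht' : 0 < t := ht
  have e : mtrace (vecH ⟨(z, t), ht⟩) = t⁻¹ * (1 + (‖z‖ ^ 2 + t ^ 2)) := by
    simp only [vecH, mtrace_apply]; ring
  rw [ofH3, compactVec_coe, nvecH, e, mul_inv, inv_inv]
  refine Prod.ext ?_ (by simp; ring)
  have : vecH ⟨(z, t), ht⟩ = t⁻¹ • ((1, -z, ‖z‖ ^ 2 + t ^ 2) : Mink) := by
    simp [vecH]
  rw [this, smul_smul]
  simp only [Prod.smul_fst]
  congr 1
  field_simp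

theorem compactVec_injective : Function.Injective compactVec := by
  have hne : ∀ w : ℂ × ℝ, 0 < 1 + (‖w.1‖ ^ 2 + w.2 ^ 2) := fun w => by positivity
  intro x y h
  induction x using OnePoint.rec with
  | infty =>
    induction y using OnePoint.rec with
    | infty => rfl
    | coe w =>
      have := congrArg (fun X => X.1.1) h
      simp [compactVec] at this
      exact absurd this (hne w).ne
  | coe w =>
    induction y using OnePoint.rec with
    | infty =>
      have := congrArg (fun X => X.1.1) h
      simp [compactVec] at this
      exact absurd this (hne w).ne'
    | coe w' =>
      rw [compactVec_coe, compactVec_coe] at h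
      have h1 := congrArg (fun X => X.1.1) h
      simp only [Prod.smul_fst, smul_eq_mul, mul_one] at h1
      rw [← h1] at h
      have h2 := smul_right_injective _ (inv_ne_zero (hne w).ne') h
      simp only [Prod.mk.injEq, neg_inj, true_and] at h2
      rw [Prod.ext h2.1.1 h2.2]

theorem continuous_compactVec : Continuous compactVec := by
  rw [OnePoint.continuous_iff]
  have hsq : ∀ w : ℂ × ℝ, ‖w‖ ^ 2 ≤ ‖w.1‖ ^ 2 + w.2 ^ 2 := fun w => by
    rw [show w.2 ^ 2 = ‖w.2‖ ^ 2 by rw [Real.norm_eq_abs, sq_abs]]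
    rcases max_choice ‖w.1‖ ‖w.2‖ with h | h
    · rw [show ‖w‖ = ‖w.1‖ from h]; nlinarith [sq_nonneg ‖w.2‖]
    · rw [show ‖w‖ = ‖w.2‖ from h]; nlinarith [sq_nonneg ‖w.1‖]
  constructor
  · rw [Filter.coclosedCompact_eq_cocompact]
    have h1 : Filter.Tendsto (fun w : ℂ × ℝ => ‖w‖) (Filter.cocompact (ℂ × ℝ)) Filter.atTop :=
      tendsto_norm_cocompact_atTop
    have e : (fun w : ℂ × ℝ => compactVec (w : OnePoint (ℂ × ℝ))) = fun w : ℂ × ℝ =>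
        ((((1 + (‖w.1‖ ^ 2 + w.2 ^ 2))⁻¹, -((1 + (‖w.1‖ ^ 2 + w.2 ^ 2))⁻¹ • w.1),
          1 - (1 + (‖w.1‖ ^ 2 + w.2 ^ 2))⁻¹) : Mink), (1 + (‖w.1‖ ^ 2 + w.2 ^ 2))⁻¹ • w.2) := by
      funext w
      rw [compactVec_coe]
      refine Prod.ext (Prod.ext (by simp) (Prod.ext (by simp) ?_)) rfl
      simp only [Prod.smul_mk, smul_eq_mul]
      have : 0 < 1 + (‖w.1‖ ^ 2 + w.2 ^ 2) := by positivity
      field_simp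
      ring
    have h0 : Filter.Tendsto (fun w : ℂ × ℝ => (1 + (‖w.1‖ ^ 2 + w.2 ^ 2))⁻¹)
        (Filter.cocompact (ℂ × ℝ)) (𝓝 0) := by
      refine squeeze_zero (fun w => by positivity) (fun w => ?_)
        (tendsto_inv_one_add_sq_atTop.comp h1)
      simp only [Function.comp_apply]
      gcongr
      exact hsq w
    have hE : ∀ {E : Type} [NormedAddCommGroup E] [NormedSpace ℝ E] (f : ℂ × ℝ → E),
        (∀ w, ‖f w‖ ≤ ‖w‖) → Filter.Tendsto
          (fun w : ℂ × ℝ => (1 + (‖w.1‖ ^ 2 + w.2 ^ 2))⁻¹ • f w)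
          (Filter.cocompact (ℂ × ℝ)) (𝓝 0) := by
      intro E _ _ f hf
      rw [tendsto_zero_iff_norm_tendsto_zero]
      refine squeeze_zero (fun w => norm_nonneg _) (fun w => ?_)
        (tendsto_norm_div_atTop.comp h1)
      simp only [Function.comp_apply]
      rw [norm_smul, Real.norm_eq_abs, abs_of_pos (by positivity)]
      gcongr
      · exact hsq w
      · exact hf w
    rw [e]
    change Filter.Tendsto _ _ (𝓝 (((0, 0, 1) : Mink), (0 : ℝ)))
    refine Filter.Tendsto.prodMk_nhds
      (h0.prodMk_nhds (Filter.Tendsto.prodMk_nhds ?_ ?_)) (hE _ fun w => norm_snd_le w)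
    · rw [show (0 : ℂ) = -0 by simp]
      exact (hE _ fun w => norm_fst_le w).neg
    · simpa using h0.const_sub 1
  · have h1 : Continuous fun w : ℂ × ℝ => (1 + (‖w.1‖ ^ 2 + w.2 ^ 2))⁻¹ :=
      Continuous.inv₀ (by fun_prop) fun z => by positivity
    have h2 : Continuous fun w : ℂ × ℝ =>
        ((((1, -w.1, ‖w.1‖ ^ 2 + w.2 ^ 2) : Mink), w.2) : Mink × ℝ) := by fun_prop
    exact (h1.smul h2).congr fun z => (compactVec_coe z).symm

/-- The compactification embeds in trace-one vectors together with one more coordinate. On both the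
space and its boundary that coordinate is a continuous function of the vector, so closures can be
tested on the vector alone. -/
theorem mem_closure_ofH3_iff (y : Sphere) (S : Set H3) :
    ofBoundary y ∈ closure (ofH3 '' S) ↔ nvec y ∈ closure (nvecH '' S) := by
  have hΘ := continuous_compactVec.isClosedEmbedding compactVec_injective
  rw [hΘ.isInducing.closure_eq_preimage_closure_image, mem_preimage, compactVec_ofBoundary,
    image_image]
  simp only [compactVec_ofH3]
  constructor
  · intro h
    have := image_closure_subset_closure_image continuous_fst (mem_image_of_mem Prod.fst h)
    rwa [image_image] at this
  · intro h
    have hg : Continuous fun X : Mink => (X, √(mform X X / 2)) := by fun_prop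
    have := image_closure_subset_closure_image hg (mem_image_of_mem _ h)
    simp only [nvec_sq, zero_div, Real.sqrt_zero, image_image, sqrt_mform_nvecH] at this
    exact this

section

/-! ### Reduced words in reflections -/

/-- `ReducedWord S n d w D`: the element `w` is a product of `n` reflections across circles of `S`,
consecutive ones being distinct and the first one being `d`, and `D` is the image of the last circle
under the product of the others. -/
inductive ReducedWord (S : Set GenCircle) : ℕ → GenCircle → lor → GenCircle → Prop
  | one {d : GenCircle} (hd : d ∈ S) : ReducedWord S 1 d (refl d) d
  | cons {n : ℕ} {d d' : GenCircle} {w : lor} {D : GenCircle} (hd : d ∈ S) (hne : d ≠ d')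
      (h : ReducedWord S n d' w D) : ReducedWord S (n + 1) d (refl d * w) (refl d • D)

/-- The vector `v` is at depth at least `μ` beyond the circle `d`, compared with the other circles
of `S`. -/
def Beyond (S : Set GenCircle) (μ : ℝ) (d : GenCircle) (v : Mink) : Prop :=
  ∃ ν, μ ≤ ν ∧ mform v d.vec = -ν ∧ ∀ d' ∈ S, d' ≠ d → ν ≤ mform v d'.vec

variable {S : Set GenCircle}

theorem Beyond.le {μ : ℝ} {d d' : GenCircle} {v : Mink} (h : Beyond S μ d v) (hd' : d' ∈ S)
    (hne : d' ≠ d) : μ ≤ mform v d'.vec := by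
  obtain ⟨ν, h1, -, h2⟩ := h
  exact h1.trans (h2 d' hd' hne)

theorem beyond_refl (hS : PairwiseSep S) {μ : ℝ} (hμ : 0 ≤ μ) {v : Mink}
    (hv : ∀ d ∈ S, μ ≤ mform v d.vec) {d : GenCircle} (hd : d ∈ S) :
    Beyond S μ d ((refl d).1 v) := by
  refine ⟨mform v d.vec, hv d hd, ?_, fun d' hd' hne => ?_⟩
  · rw [refl_mform, d.vec_sq, mform_comm d.vec]; ring
  · have h1 := (hS d hd d' hd' hne.symm).two_le
    have h2 := hv d hd
    have h3 := hv d' hd'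
    rw [refl_mform, mform_comm d.vec v]
    nlinarith

/-- The ping-pong step. The product with any other circle gains at least twice the new depth, which
outweighs the old depth even for `d'` itself, where the product was negative. -/
theorem Beyond.step (hS : PairwiseSep S) {μ : ℝ} (hμ : 0 ≤ μ) {v : Mink} {d d' : GenCircle}
    (h : Beyond S μ d' v) (hd : d ∈ S) (hne : d ≠ d') : Beyond S μ d ((refl d).1 v) := by
  obtain ⟨ν, h1, h2, h3⟩ := h
  have h4 := h3 d hd hne
  refine ⟨mform v d.vec, h1.trans h4, ?_, fun d'' hd'' hne' => ?_⟩
  · rw [refl_mform, d.vec_sq, mform_comm d.vec]; ring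
  · have h5 := (hS d hd d'' hd'' hne'.symm).two_le
    have h6 : -ν ≤ mform v d''.vec := by
      by_cases e : d'' = d'
      · rw [e, h2]
      · linarith [h3 d'' hd'' e]
    rw [refl_mform, mform_comm d.vec v]
    nlinarith

namespace ReducedWord

variable {n : ℕ} {d D : GenCircle} {w : lor}

theorem mem (h : ReducedWord S n d w D) : d ∈ S := by
  cases h <;> assumption

theorem beyond_tip (hS : PairwiseSep S) (h : ReducedWord S n d w D) : Beyond S 2 d D.vec := by
  induction h with
  | @one d hd => exact ⟨2, le_rfl, d.vec_sq, fun d' hd' hne => (hS d hd d' hd' hne.symm).two_le⟩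
  | cons hd hne _ ih => exact ih.step hS (by norm_num) hd hne

theorem beyond (hS : PairwiseSep S) {μ : ℝ} (hμ : 0 ≤ μ) {q : Mink}
    (hq : ∀ d ∈ S, μ ≤ mform q d.vec) (h : ReducedWord S n d w D) : Beyond S μ d (w.1 q) := by
  induction h with
  | one hd => exact beyond_refl hS hμ hq hd
  | cons hd hne _ ih => exact ih.step hS hμ hd hne

/-- By `beyond_tip` the previous tip has product at least 2 with the next letter, so each reflection
adds at least `2 δ`, more than required. Tips of long words are thus far from `q`, and therefore
small. -/
theorem le_mform_tip (hS : PairwiseSep S) {δ : ℝ} (hδ : 0 ≤ δ) {q : Mink}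
    (hq : ∀ d ∈ S, δ ≤ mform q d.vec) (h : ReducedWord S n d w D) : n * δ ≤ mform q D.vec := by
  induction h with
  | one hd => simpa using hq _ hd
  | @cons n d d' w D hd hne h ih =>
    have h1 := (h.beyond_tip hS).le hd hne
    have h2 := hq d hd
    rw [vec_smul, refl_mform_right, mform_comm d.vec q, mform_comm d.vec D.vec]
    push_cast
    nlinarith

theorem mform_tip_nonpos {q : Mink} (hq : ∀ d ∈ S, 0 ≤ mform q d.vec)
    (h : ReducedWord S n d w D) : mform (w.1 q) D.vec ≤ 0 := by
  induction h with
  | @one d hd =>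
    have := hq d hd
    rw [refl_mform, d.vec_sq, mform_comm d.vec]; linarith
  | cons hd hne _ ih => rwa [vec_smul, lor_mul_apply, lor_mform]

theorem mem_closure (h : ReducedWord S n d w D) : w ∈ Subgroup.closure (refl '' S) := by
  induction h with
  | one hd => exact Subgroup.subset_closure (mem_image_of_mem _ hd)
  | cons hd _ _ ih => exact mul_mem (Subgroup.subset_closure (mem_image_of_mem _ hd)) ih

/-- Each letter adds the product of the depths of the two points relative to its circle. This one
estimate bounds word lengths, excludes fixed points and proves the Dirichlet inequalities. -/
theorem add_le_mform (hS : PairwiseSep S) {δ δ' : ℝ} (hδ : 0 ≤ δ) (hδ' : 0 ≤ δ') {q q' : Mink}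
    (hq : ∀ d ∈ S, δ ≤ mform q d.vec) (hq' : ∀ d ∈ S, δ' ≤ mform q' d.vec)
    (h : ReducedWord S n d w D) : mform q' q + n * (δ * δ') ≤ mform q' (w.1 q) := by
  induction h with
  | @one d hd =>
    have := mul_le_mul (hq d hd) (hq' d hd) hδ' (hδ.trans (hq d hd))
    rw [refl_mform_right, mform_comm d.vec, mform_comm d.vec]
    push_cast
    linarith
  | @cons n d d' w D hd hne h ih =>
    have h1 := (h.beyond hS hδ hq).le hd hne
    have := mul_le_mul h1 (hq' d hd) hδ' (hδ.trans h1)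
    rw [lor_mul_apply, refl_mform_right, mform_comm d.vec, mform_comm d.vec]
    push_cast
    linarith

/-- The product only decreases when first letters are removed, so every letter inherits the bound
`R`. Only finitely many circles then remain possible. -/
theorem restrict (hS : PairwiseSep S) {δ R : ℝ} (hδ : 0 ≤ δ) {p q : Mink}
    (hp : ∀ d ∈ S, 0 ≤ mform p d.vec) (hq : ∀ d ∈ S, δ ≤ mform q d.vec) (hpq : 0 ≤ mform p q)
    (h : ReducedWord S n d w D) (hR : mform p (w.1 q) ≤ R) :
    ReducedWord {d ∈ S | δ * mform p d.vec ≤ R} n d w D := by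
  induction h with
  | @one d hd =>
    refine one ⟨hd, ?_⟩
    have := mul_le_mul_of_nonneg_right (hq d hd) (hp d hd)
    rw [refl_mform_right, mform_comm d.vec, mform_comm d.vec] at hR
    linarith
  | @cons n d d' w D hd hne h ih =>
    have h1 := (h.beyond hS hδ hq).le hd hne
    have h2 := mul_le_mul_of_nonneg_right h1 (hp d hd)
    have h3 := mul_nonneg hδ (hp d hd)
    have h4 := h.add_le_mform hS hδ le_rfl hq hp
    rw [lor_mul_apply, refl_mform_right, mform_comm d.vec, mform_comm d.vec] at hR
    refine cons ⟨hd, by linarith⟩ hne (ih (by linarith))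

theorem finite (hS : S.Finite) (n : ℕ) : {w | ∃ d D, ReducedWord S n d w D}.Finite := by
  induction n with
  | zero =>
    convert finite_empty
    rw [eq_empty_iff_forall_notMem]
    rintro w ⟨d, D, h⟩
    generalize e : 0 = m at h
    cases h <;> simp at e
  | succ n ih =>
    refine ((hS.image refl).union (Finite.image2 (fun d w => refl d * w) hS ih)).subset ?_
    rintro w ⟨d, D, h⟩
    generalize e : n + 1 = m at h
    cases h with
    | one hd => exact Or.inl (mem_image_of_mem _ hd)
    | cons hd hne h =>
      obtain rfl : n = _ := Nat.succ_injective e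
      exact Or.inr ⟨_, hd, _, ⟨_, _, h⟩, rfl⟩

theorem exists_of_mem_closure (hw : w ∈ Subgroup.closure (refl '' S)) :
    w = 1 ∨ ∃ n d D, ReducedWord S n d w D := by
  have key : ∀ d ∈ S, ∀ y : lor, (y = 1 ∨ ∃ n d D, ReducedWord S n d y D) →
      (refl d * y = 1 ∨ ∃ n d' D, ReducedWord S n d' (refl d * y) D) := by
    rintro d hd y (rfl | ⟨n, d', D, h⟩)
    · exact Or.inr ⟨_, _, _, by rw [mul_one]; exact one hd⟩
    · by_cases e : d = d'
      · subst e
        cases h with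
        | one => exact Or.inl (refl_mul_self d)
        | cons hd hne h =>
          rw [← mul_assoc, refl_mul_self, one_mul]
          exact Or.inr ⟨_, _, _, h⟩
      · exact Or.inr ⟨_, _, _, cons hd e h⟩
  induction hw using Subgroup.closure_induction_left with
  | one => exact Or.inl rfl
  | mul_left x hx y hy ih =>
    obtain ⟨d, hd, rfl⟩ := hx
    exact key d hd y ih
  | inv_mul_cancel x hx y hy ih =>
    obtain ⟨d, hd, rfl⟩ := hx
    rw [refl_inv]
    exact key d hd y ih

/-- A circle that is orthogonal to or separated from all the circles of `S` is either fixed by a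
reduced word or moved beyond its first circle. -/
theorem smul_eq_or (hS : PairwiseSep S) {c : GenCircle}
    (hc : ∀ d ∈ S, mform c.vec d.vec = 0 ∨ Sep c d) (h : ReducedWord S n d w D) :
    w • c = c ∨ IsFuture ((w • c).vec - d.vec) := by
  have key : ∀ d ∈ S, refl d • c = c ∨ IsFuture ((refl d • c).vec - d.vec) := by
    intro d hd
    rcases hc d hd with h0 | h0
    · left
      apply GenCircle.vec_injective
      rw [vec_smul, refl_apply_of_eq_zero (by rwa [mform_comm])]
    · right
      rwa [Sep, ← lor_isFuture (refl d), map_add, refl_vec, ← sub_eq_add_neg] at h0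
  induction h with
  | one hd => exact key _ hd
  | @cons n d d' w D hd hne h ih =>
    rw [mul_smul]
    rcases ih with e | e
    · rw [e]; exact key d hd
    · right
      have := e.add (hS d hd d' h.mem hne)
      rw [← lor_isFuture (refl d)] at this
      convert this using 1
      rw [vec_smul, sub_eq_add_neg, ← refl_vec, ← map_add]
      congr 1
      abel

/-- Unless `c` is fixed, its image lies beyond the first letter `d`. A circle `c'` separated from
`d` is then separated from the image, and one orthogonal to `d` is fixed by its reflection, which
reduces to a shorter word. -/
theorem eq_or_sep (hS : PairwiseSep S) {c c' : GenCircle}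
    (hc : ∀ d ∈ S, mform c.vec d.vec = 0 ∨ Sep c d)
    (hc' : ∀ d ∈ S, mform c'.vec d.vec = 0 ∨ Sep c' d) (hcc : c = c' ∨ Sep c c')
    (h : ReducedWord S n d w D) : w • c = c' ∨ Sep (w • c) c' := by
  have key : ∀ (w : lor) d, d ∈ S → (w • c = c' ∨ Sep (w • c) c') →
      (refl d * w) • c = c ∨ IsFuture (((refl d * w) • c).vec - d.vec) →
      (refl d * w) • c = c' ∨ Sep ((refl d * w) • c) c' := by
    intro w d hd hw hd'
    rcases hd' with e | e
    · rw [e]; exact hcc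
    · rcases hc' d hd with h0 | h0
      · have e' : refl d • c' = c' := GenCircle.vec_injective
          (by rw [vec_smul, refl_apply_of_eq_zero (by rwa [mform_comm])])
        rw [mul_smul]
        rcases hw with hw | hw
        · rw [hw, e']; exact Or.inl rfl
        · right
          rwa [← sep_smul (refl d), e'] at hw
      · right
        have := e.add h0
        rw [Sep]
        convert this using 1
        abel
  induction h with
  | @one d hd =>
    have := key 1 d hd (by rwa [one_smul])
    rw [mul_one] at this
    exact this ((one hd).smul_eq_or hS hc)
  | @cons n d d' w D hd hne h ih => exact key w d hd ih ((cons hd hne h).smul_eq_or hS hc)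

end ReducedWord

end

/-! ### The packing: separation and density -/

section

/-- The metric and topological properties of a configuration and its dual that are used to study
the packing. -/
structure GoodPair (A : Set Sphere) (B B' : Set GenCircle) : Prop where
  sep : PairwiseSep B
  sep' : PairwiseSep B'
  nontrivial' : B'.Nontrivial
  orth_or_sep : ∀ c ∈ B, ∀ d ∈ B', mform c.vec d.vec = 0 ∨ Sep c d
  crossing : ∀ d ∈ B', ∃ c₁ ∈ B, ∃ c₂ ∈ B, ∃ c₃ ∈ B, (Sep c₁ c₂ ∧ Sep c₁ c₃ ∧ Sep c₂ c₃) ∧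
    mform c₁.vec d.vec = 0 ∧ mform c₂.vec d.vec = 0 ∧ mform c₃.vec d.vec = 0
  cover : ∀ x ∉ A, (∃ C ∈ B ∪ B', C.form x < 0) ∨
    ∃ d ∈ B', ∃ d' ∈ B', d ≠ d' ∧ d.form x = 0 ∧ d'.form x = 0
  exists_isHyp : ∃ p, IsHyp p ∧ ∀ d ∈ B', 0 < mform p d.vec
  subsingleton : A.Subsingleton
  accumulation : accumulationPoints (B ∪ B') = A
  dense : ∀ a ∈ A, ∀ U : Set Sphere, IsOpen U → a ∈ U → ∃ c ∈ B, (U ∩ c.interior).Nonempty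

theorem DualConfig.goodPair {A : Set Sphere} {B B' : Set GenCircle} {D : GraphDuality A B B'}
    (h : DualConfig A B B' D) : GoodPair A B B' where
  sep := h.sep
  sep' := h.sep'
  nontrivial' := h.nontrivial'
  orth_or_sep := h.orth_or_sep
  crossing := fun d hd => h.exists_three hd
  cover x hx := by
    by_cases h' : ∃ C ∈ B ∪ B', C.form x < 0
    · exact Or.inl h'
    · push Not at h'
      obtain ⟨-, d, hd, d', hd', hne, h1, h2⟩ := h.mem_edges_of_nonneg hx h'
      exact Or.inr ⟨d, hd, d', hd', hne, h1, h2⟩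
  exists_isHyp := h.symm.exists_isHyp
  subsingleton := h.subsingleton
  accumulation := h.accumulation
  dense a ha U hU haU := by
    rw [← h.accumulation] at ha
    have key : ∀ c ∈ B, ∀ y ∈ U, c.form y = 0 → (U ∩ c.interior).Nonempty :=
      fun c _ y hy h0 => mem_closure_iff.1 (GenCircle.mem_closure_interior h0) U hU hy
    obtain ⟨C, hC | hC, hCU⟩ := (ha U hU haU).nonempty
    · obtain ⟨y, -, -, hy, -⟩ := C.exists_two_mem_carrier
      exact ⟨C, hC, key C hC y (hCU hy) hy⟩
    · obtain ⟨c, hc, -, -, -, -, -, h0, -, -⟩ := h.exists_three hC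
      obtain ⟨y, h1, h2⟩ := h.meet c hc C hC h0
      exact ⟨c, hc, key c hc y (hCU h2) h1⟩

/-- A group of symmetries of a configuration and its dual, with a base point of its Dirichlet
domain, for which the fundamental domain of the extension by the reflections across the dual circles
is finite-sided. -/
structure SymmetryDatum (A : Set Sphere) (B B' : Set GenCircle) (Γ : Subgroup lor) (p : Mink) :
    Prop where
  isHyp : IsHyp p
  pos : ∀ d ∈ B', 0 < mform p d.vec
  smul_mem : ∀ e ∈ Γ, ∀ c ∈ B, e • c ∈ B
  smul_mem' : ∀ e ∈ Γ, ∀ d ∈ B', e • d ∈ B'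
  stabilizer : ∀ e ∈ Γ, e.1 p = p → e = 1
  finite : ∀ R : ℝ, {e | e ∈ Γ ∧ mform p (e.1 p) ≤ R}.Finite
  dirichlet : ∃ T : Set lor, T.Finite ∧ T ⊆ Γ ∧ ∃ S : Set GenCircle, S.Finite ∧ S ⊆ B' ∧
    ∀ q, IsHyp q → (∀ e ∈ T, mform q p ≤ mform q (e.1 p)) → (∀ d ∈ S, 0 ≤ mform q d.vec) →
      (∀ e ∈ Γ, mform q p ≤ mform q (e.1 p)) ∧ ∀ d ∈ B', 0 ≤ mform q d.vec
  shrink : ∀ a ∈ A, ∀ q, IsHyp q → ∀ M : ℝ, ∃ e ∈ Γ, ∃ D : GenCircle, D.form a ≤ 0 ∧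
    mform (e.1 p) D.vec ≤ 0 ∧ M ≤ mform q D.vec

/-- The circles of the packing. -/
def orbit (B B' : Set GenCircle) : Set GenCircle :=
  {C | ∃ w ∈ Subgroup.closure (refl '' B'), ∃ c ∈ B, C = w • c}

section

variable {A : Set Sphere} {B B' : Set GenCircle}

theorem smul_mem_orbit {w : lor} (hw : w ∈ Subgroup.closure (refl '' B')) {C : GenCircle}
    (hC : C ∈ orbit B B') : w • C ∈ orbit B B' := by
  obtain ⟨w', hw', c, hc, rfl⟩ := hC
  exact ⟨w * w', mul_mem hw hw', c, hc, (mul_smul _ _ _).symm⟩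

theorem subset_orbit : B ⊆ orbit B B' := fun c hc => ⟨1, one_mem _, c, hc, (one_smul _ _).symm⟩

/-- Moving one of the circles back to `B` leaves a single element of the reflection group, which is
trivial or a reduced word. -/
theorem GoodPair.pairwiseSep_orbit (h : GoodPair A B B') : PairwiseSep (orbit B B') := by
  rintro _ ⟨w, hw, c, hc, rfl⟩ _ ⟨w', hw', c', hc', rfl⟩ hne
  have hcc : c = c' ∨ Sep c c' := by
    by_cases e : c = c'
    · exact Or.inl e
    · exact Or.inr (h.sep c hc c' hc' e)
  have key : (w'⁻¹ * w) • c = c' ∨ Sep ((w'⁻¹ * w) • c) c' := by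
    rcases ReducedWord.exists_of_mem_closure (mul_mem (inv_mem hw') hw) with e | ⟨n, d, D, hD⟩
    · rw [e, one_smul]; exact hcc
    · exact hD.eq_or_sep h.sep' (h.orth_or_sep c hc) (h.orth_or_sep c' hc') hcc
  rcases key with e | e
  · refine absurd ?_ hne
    rw [← e, mul_smul, smul_inv_smul]
  · rwa [← sep_smul w', mul_smul, smul_inv_smul] at e

theorem Sep.disjoint_interior {C C' : GenCircle} (h : Sep C C') :
    Disjoint C.interior C'.interior := by
  rw [disjoint_left]
  intro x h1 h2
  have := h.form_add_nonneg x
  rw [GenCircle.interior, mem_ofPred_eq] at h1 h2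
  linarith

/-- The tip of a reduced word is orthogonal to a circle of the packing. -/
theorem GoodPair.exists_orthogonal (h : GoodPair A B B') {n : ℕ} {d D : GenCircle} {w : lor}
    (hD : ReducedWord B' n d w D) : ∃ C ∈ orbit B B', mform C.vec D.vec = 0 := by
  induction hD with
  | @one d hd =>
    obtain ⟨c, hc, -, -, -, -, -, h0, -, -⟩ := h.crossing d hd
    exact ⟨c, subset_orbit hc, h0⟩
  | @cons n d d' w D hd hne h ih =>
    obtain ⟨C, hC, h0⟩ := ih
    exact ⟨refl d • C, smul_mem_orbit (Subgroup.subset_closure (mem_image_of_mem _ hd)) hC,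
      by rwa [vec_smul, vec_smul, lor_mform]⟩

/-- The itinerary of a residual point. -/
theorem GoodPair.itinerary (h : GoodPair A B B') (n : ℕ) : ∀ {x : Sphere},
    (∀ C ∈ orbit B B', 0 ≤ C.form x) → ∀ {d₀ : GenCircle}, 0 ≤ d₀.form x →
    (∃ d w D, ReducedWord B' (n + 1) d w D ∧ d ≠ d₀ ∧ D.form x ≤ 0) ∨
      ∃ w ∈ Subgroup.closure (refl '' B'), w • x ∈ A := by
  have step : ∀ {x : Sphere}, (∀ C ∈ orbit B B', 0 ≤ C.form x) → ∀ {d₀ : GenCircle},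
      0 ≤ d₀.form x → (∃ d ∈ B', d ≠ d₀ ∧ d.form x ≤ 0) ∨ x ∈ A := by
    intro x hx d₀ hd₀
    by_cases hA : x ∈ A
    · exact Or.inr hA
    left
    rcases h.cover x hA with ⟨C, hC | hC, hneg⟩ | ⟨d, hd, d', hd', hne, h1, h2⟩
    · exact absurd hneg (hx C (subset_orbit hC)).not_gt
    · exact ⟨C, hC, by rintro rfl; linarith, hneg.le⟩
    -- The circle `d₀` is the one just reflected across, and avoiding it keeps the word reduced. At
    -- a tangency point two dual circles are available, so one of them differs from `d₀`.
    · by_cases e : d = d₀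
      · exact ⟨d', hd', e ▸ hne.symm, h2.le⟩
      · exact ⟨d, hd, e, h1.le⟩
  induction n with
  | zero =>
    intro x hx d₀ hd₀
    rcases step hx hd₀ with ⟨d, hd, hne, hle⟩ | hA
    · exact Or.inl ⟨d, _, d, ReducedWord.one hd, hne, hle⟩
    · exact Or.inr ⟨1, one_mem _, by rwa [one_smul]⟩
  | succ n ih =>
    intro x hx d₀ hd₀
    rcases step hx hd₀ with ⟨d, hd, hne, hle⟩ | hA
    · have hdm : refl d ∈ Subgroup.closure (refl '' B') :=
        Subgroup.subset_closure (mem_image_of_mem _ hd)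
      have hdx : 0 ≤ d.form (refl d • x) := by
        have e : refl d • d = d.neg := GenCircle.vec_injective (refl_vec d)
        rw [← form_smul_nonpos_iff (refl d), e, GenCircle.form_neg] at hle
        linarith
      have hx' : ∀ C ∈ orbit B B', 0 ≤ C.form (refl d • x) := by
        intro C hC
        have := hx _ (smul_mem_orbit hdm hC)
        by_contra! hneg
        rw [← form_smul_neg_iff (refl d), ← mul_smul, refl_mul_self, one_smul] at hneg
        linarith
      rcases ih hx' hdx with ⟨d', w, D, hD, hne', hle'⟩ | ⟨w, hw, hA⟩
      · refine Or.inl ⟨d, _, _, ReducedWord.cons hd hne'.symm hD, hne, ?_⟩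
        rwa [← form_smul_nonpos_iff (refl d), ← mul_smul, refl_mul_self, one_smul] at hle'
      · exact Or.inr ⟨w * refl d, mul_mem hw hdm, by rwa [mul_smul]⟩
    · exact Or.inr ⟨1, one_mem _, by rwa [one_smul]⟩

/-- A residual point lies in small discs cut off by long reduced words, or is mapped to the
accumulation point. -/
theorem GoodPair.exists_word (h : GoodPair A B B') {p : Mink} (hp : IsHyp p)
    (hpd : ∀ d ∈ B', 0 < mform p d.vec) {x : Sphere} (hx : ∀ C ∈ orbit B B', 0 ≤ C.form x)
    (M : ℝ) : (∃ n d w D, ReducedWord B' n d w D ∧ D.form x ≤ 0 ∧ M ≤ mform p D.vec) ∨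
      ∃ w ∈ Subgroup.closure (refl '' B'), w • x ∈ A := by
  obtain ⟨δ, hδ, hδB⟩ := h.sep'.exists_pos_le hp hpd
  obtain ⟨d₀, -, hd₀⟩ : ∃ d₀ ∈ B', 0 ≤ d₀.form x := by
    obtain ⟨d, hd, d', hd', hne⟩ := h.nontrivial'
    have := (h.sep' d hd d' hd' hne).form_add_nonneg x
    by_contra! hcon
    linarith [hcon d hd, hcon d' hd']
  obtain ⟨n, hn⟩ := exists_nat_ge (M / δ)
  rw [div_le_iff₀ hδ] at hn
  rcases h.itinerary n hx hd₀ with ⟨d, w, D, hD, -, hle⟩ | hA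
  · refine Or.inl ⟨_, d, w, D, hD, hle, ?_⟩
    have := hD.le_mform_tip h.sep' hδ.le hδB
    push_cast at this
    linarith
  · exact Or.inr hA

/-- A residual point lies either in small tips, each crossed by a circle of the packing, or in the
orbit of the accumulation point, where base discs accumulate. -/
theorem GoodPair.exists_mem_interior (h : GoodPair A B B') {x : Sphere} {U : Set Sphere}
    (hU : IsOpen U) (hxU : x ∈ U) : ∃ C ∈ orbit B B', (U ∩ C.interior).Nonempty := by
  by_cases hx : ∃ C ∈ orbit B B', C.form x < 0
  · obtain ⟨C, hC, hneg⟩ := hx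
    exact ⟨C, hC, x, hxU, hneg⟩
  push Not at hx
  obtain ⟨p, hp, hpd⟩ := h.exists_isHyp
  obtain ⟨N, -, hxN, M, hM⟩ := hp.exists_shrink_sphere hU hxU
  rcases h.exists_word hp hpd hx M with ⟨n, d, w, D, hD, hle, hMD⟩ | ⟨w, hw, hA⟩
  · obtain ⟨C, hC, h0⟩ := h.exists_orthogonal hD
    obtain ⟨y, hy1, hy2⟩ := GenCircle.exists_mem_interiors (C := C) (C' := D) (by rw [h0]; norm_num)
    exact ⟨C, hC, y, hM D hMD ⟨x, hxN, hle⟩ y (le_of_lt hy2), hy1⟩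
  · obtain ⟨c, hc, y, hy1, hy2⟩ := h.dense _ hA ((fun y => w⁻¹ • y) ⁻¹' U)
      (hU.preimage (continuous_lor_smul _)) (by simpa using hxU)
    refine ⟨w⁻¹ • c, ⟨w⁻¹, inv_mem hw, c, hc, rfl⟩, w⁻¹ • y, hy1, ?_⟩
    exact (form_smul_neg_iff _).2 hy2

theorem GoodPair.disjointDense (h : GoodPair A B B') : DisjointDense (orbit B B') := by
  refine ⟨fun C hC C' hC' hne => (h.pairwiseSep_orbit C hC C' hC' hne).disjoint_interior, ?_⟩
  intro x
  rw [mem_closure_iff]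
  intro U hU hxU
  obtain ⟨C, hC, y, hy1, hy2⟩ := h.exists_mem_interior hU hxU
  exact ⟨y, hy1, mem_iUnion₂.2 ⟨C, hC, hy2⟩⟩

end

end

/-! ### The group generated by the dual reflections and the symmetries -/

section

theorem ReducedWord.pos {S : Set GenCircle} {n : ℕ} {d D : GenCircle} {w : lor}
    (h : ReducedWord S n d w D) : 0 < n := by
  cases h <;> omega

/-- Products with different hyperbolic points are comparable on future vectors, so finiteness
statements do not depend on the base point. -/
theorem IsHyp.exists_mform_le {p q : Mink} (hq : IsHyp q) :
    ∃ K : ℝ, 0 ≤ K ∧ ∀ X, IsFuture X → mform p X ≤ K * mform q X := by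
  obtain ⟨K, hK, hKX⟩ := hq.exists_norm_sq_le
  set f : Mink →L[ℝ] ℝ := LinearMap.toContinuousLinearMap (mform p)
  refine ⟨‖f‖ * √K, by positivity, fun X hX => ?_⟩
  have h1 : ‖X‖ ≤ √K * mform q X := by
    have h0 := hq.1.mform_nonneg hX
    rw [← abs_of_nonneg (norm_nonneg X), ← abs_of_nonneg (mul_nonneg (Real.sqrt_nonneg K) h0),
      ← sq_le_sq, mul_pow, Real.sq_sqrt hK.le]
    exact (hKX X).trans (mul_le_mul_of_nonneg_left (by linarith [hX.1]) hK.le)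
  calc mform p X ≤ ‖f X‖ := le_abs_self _
    _ ≤ ‖f‖ * ‖X‖ := f.le_opNorm X
    _ ≤ ‖f‖ * (√K * mform q X) := by gcongr
    _ = _ := by ring

variable {A : Set Sphere} {B B' : Set GenCircle} {Γ : Subgroup lor} {p : Mink}

theorem conj_mem_closure {R : Set GenCircle} {e : lor} (he : ∀ d ∈ R, e • d ∈ R) {w : lor}
    (hw : w ∈ Subgroup.closure (refl '' R)) :
    e * w * e⁻¹ ∈ Subgroup.closure (refl '' R) := by
  have : Subgroup.closure (refl '' R) ≤
      (Subgroup.closure (refl '' R)).comap (MulAut.conj e).toMonoidHom := by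
    rw [Subgroup.closure_le]
    rintro _ ⟨d, hd, rfl⟩
    rw [SetLike.mem_coe, Subgroup.mem_comap]
    refine Subgroup.subset_closure ⟨e • d, he d hd, ?_⟩
    rw [refl_smul]; rfl
  exact this hw

namespace SymmetryDatum

/-- The group generated by the symmetries and the reflections across the dual circles. -/
abbrev extension (B' : Set GenCircle) (Γ : Subgroup lor) : Subgroup lor :=
  Subgroup.closure (refl '' B') ⊔ Γ

/-- The symmetries permute the dual circles, so they normalize the reflection group and the products
already form a group. -/
theorem exists_mul (h : SymmetryDatum A B B' Γ p) {g : lor} (hg : g ∈ extension B' Γ) :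
    ∃ w ∈ Subgroup.closure (refl '' B'), ∃ e ∈ Γ, g = w * e := by
  let K : Subgroup lor :=
    { carrier := {g | ∃ w ∈ Subgroup.closure (refl '' B'), ∃ e ∈ Γ, g = w * e}
      one_mem' := ⟨1, one_mem _, 1, one_mem _, by simp⟩
      mul_mem' := by
        rintro _ _ ⟨w, hw, e, he, rfl⟩ ⟨w', hw', e', he', rfl⟩
        exact ⟨w * (e * w' * e⁻¹), mul_mem hw (conj_mem_closure (h.smul_mem' e he) hw'), e * e',
          mul_mem he he', by group⟩
      inv_mem' := by
        rintro _ ⟨w, hw, e, he, rfl⟩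
        refine ⟨e⁻¹ * w⁻¹ * e⁻¹⁻¹, conj_mem_closure (h.smul_mem' _ (inv_mem he)) (inv_mem hw), e⁻¹,
          inv_mem he, by group⟩ }
  have : extension B' Γ ≤ K := sup_le (fun w hw => ⟨w, hw, 1, one_mem _, by simp⟩)
    fun e he => ⟨1, one_mem _, e, he, by simp⟩
  exact this hg

theorem smul_mem_orbit (h : SymmetryDatum A B B' Γ p) {g : lor} (hg : g ∈ extension B' Γ)
    {C : GenCircle} (hC : C ∈ orbit B B') : g • C ∈ orbit B B' := by
  obtain ⟨w, hw, e, he, rfl⟩ := h.exists_mul hg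
  rw [mul_smul]
  refine CirclePacking.smul_mem_orbit hw ?_
  obtain ⟨w', hw', c, hc, rfl⟩ := hC
  refine ⟨e * w' * e⁻¹, conj_mem_closure (h.smul_mem' e he) hw', e • c, h.smul_mem e he c hc, ?_⟩
  rw [← mul_smul, ← mul_smul]
  congr 1
  group

theorem exists_le (h : SymmetryDatum A B B' Γ p) (hg : GoodPair A B B') :
    ∃ δ > 0, ∀ e ∈ Γ, ∀ d ∈ B', δ ≤ mform (e.1 p) d.vec := by
  obtain ⟨δ, hδ, hδB⟩ := hg.sep'.exists_pos_le h.isHyp h.pos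
  refine ⟨δ, hδ, fun e he d hd => ?_⟩
  rw [lor_mform_left]
  exact hδB _ (h.smul_mem' _ (inv_mem he) d hd)

/-- In a product `w * e`, a bound on the displacement of `p` bounds the length of `w`, confines its
letters to finitely many circles by `restrict`, and bounds the displacement by `e`. -/
theorem finite_extension (h : SymmetryDatum A B B' Γ p) (hg : GoodPair A B B') (R : ℝ) :
    {g | g ∈ extension B' Γ ∧ mform p (g.1 p) ≤ R}.Finite := by
  obtain ⟨δ, hδ, hδe⟩ := h.exists_le hg
  have hδp : ∀ d ∈ B', δ ≤ mform p d.vec := hδe 1 (one_mem _)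
  obtain ⟨N, hN⟩ := exists_nat_ge (R / (δ * δ))
  rw [div_le_iff₀ (by positivity)] at hN
  set S : Set GenCircle := {d ∈ B' | δ * mform p d.vec ≤ R}
  have hS : S.Finite := (hg.sep'.finite_of_le h.isHyp (R / δ)).subset fun d hd =>
    ⟨hd.1, by rw [le_div_iff₀ hδ, mul_comm]; exact hd.2⟩
  refine (Finite.image2 (· * ·) ((finite_singleton (1 : lor)).union
    ((finite_Iic N).biUnion fun n _ => ReducedWord.finite hS n)) (h.finite R)).subset ?_
  rintro g ⟨hgG, hgR⟩
  obtain ⟨w, hw, e, he, rfl⟩ := h.exists_mul hgG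
  rw [lor_mul_apply] at hgR
  rcases ReducedWord.exists_of_mem_closure hw with rfl | ⟨n, d, D, hD⟩
  · exact ⟨1, Or.inl rfl, e, ⟨he, hgR⟩, rfl⟩
  · have h1 := hD.add_le_mform hg.sep' hδ.le hδ.le (hδe e he) hδp
    have h2 := h.isHyp.mform_nonneg ((lor_isHyp e).2 h.isHyp)
    have h3 : (n : ℝ) ≤ N := by
      by_contra! hlt
      have := mul_lt_mul_of_pos_right hlt (mul_pos hδ hδ)
      linarith
    refine ⟨w, Or.inr (mem_iUnion₂.2 ⟨n, by exact_mod_cast h3, d, D,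
      hD.restrict hg.sep' hδ.le (fun d hd => (h.pos d hd).le) (hδe e he) h2.le hgR⟩), e,
      ⟨he, ?_⟩, rfl⟩
    have : 0 ≤ n * (δ * δ) := by positivity
    change mform p (e.1 p) ≤ R
    linarith

/-- A nonempty reduced word makes the product exceed 2, its value at a fixed point. -/
theorem stabilizer_extension (h : SymmetryDatum A B B' Γ p) (hg : GoodPair A B B') {g : lor}
    (hgG : g ∈ extension B' Γ) (hgp : g.1 p = p) : g = 1 := by
  obtain ⟨δ, hδ, hδe⟩ := h.exists_le hg
  obtain ⟨w, hw, e, he, rfl⟩ := h.exists_mul hgG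
  rcases ReducedWord.exists_of_mem_closure hw with rfl | ⟨n, d, D, hD⟩
  · rw [one_mul] at hgp ⊢
    exact h.stabilizer e he hgp
  · have h1 := hD.add_le_mform hg.sep' hδ.le hδ.le (hδe e he) (hδe 1 (one_mem _))
    rw [← lor_mul_apply, hgp, lor_one_apply, h.isHyp.2] at h1
    have h2 := h.isHyp.two_le ((lor_isHyp e).2 h.isHyp)
    have h3 : (0 : ℝ) < n := by exact_mod_cast hD.pos
    have : 0 < n * (δ * δ) := by positivity
    linarith

/-- The Dirichlet domain of the extension is finite-sided. -/
theorem dirichlet_extension (h : SymmetryDatum A B B' Γ p) (hg : GoodPair A B B') :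
    ∃ T : Set lor, T.Finite ∧ T ⊆ extension B' Γ ∧ ∀ q, IsHyp q →
      (∀ g ∈ T, mform q p ≤ mform q (g.1 p)) → ∀ g ∈ extension B' Γ,
        mform q p ≤ mform q (g.1 p) := by
  obtain ⟨T, hT, hTΓ, S, hS, hSB, hD⟩ := h.dirichlet
  refine ⟨T ∪ refl '' S, hT.union (hS.image _), ?_, fun q hq hqT g hgG => ?_⟩
  · rintro g (hgT | ⟨d, hd, rfl⟩)
    · exact Subgroup.mem_sup_right (hTΓ hgT)
    · exact Subgroup.mem_sup_left (Subgroup.subset_closure (mem_image_of_mem _ (hSB hd)))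
  obtain ⟨h1, h2⟩ := hD q hq (fun e he => hqT e (Or.inl he)) fun d hd => by
    have h3 := hqT _ (Or.inr (mem_image_of_mem _ hd))
    have h4 := h.pos d (hSB hd)
    -- The Dirichlet inequality of a reflection says that the product of the depths of `p` and `q`
    -- is non-negative; as `p` is outside `d`, so is `q`.
    rw [refl_mform_right, mform_comm d.vec p, mform_comm d.vec q] at h3
    by_contra! hneg
    linarith [mul_neg_of_neg_of_pos hneg h4]
  obtain ⟨w, hw, e, he, rfl⟩ := h.exists_mul hgG
  refine (h1 e he).trans ?_
  rcases ReducedWord.exists_of_mem_closure hw with rfl | ⟨n, d, D, hD'⟩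
  · rw [one_mul]
  · obtain ⟨δ, hδ, hδe⟩ := h.exists_le hg
    -- The depth bound for `q` is only 0, so the reflections add nothing negative and the inequality
    -- for `e` passes to `w * e`.
    have := hD'.add_le_mform hg.sep' hδ.le le_rfl (hδe e he) h2
    simpa [lor_mul_apply] using this

/-- The orbit of the base point accumulates at the residual points. -/
theorem exists_mem_extension (h : SymmetryDatum A B B' Γ p) (hg : GoodPair A B B') {x : Sphere}
    (hx : ∀ C ∈ orbit B B', 0 ≤ C.form x) (M : ℝ) :
    ∃ g ∈ extension B' Γ, ∃ D : GenCircle, D.form x ≤ 0 ∧ mform (g.1 p) D.vec ≤ 0 ∧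
      M ≤ mform p D.vec := by
  rcases hg.exists_word h.isHyp h.pos hx M with ⟨n, d, w, D, hD, hle, hM⟩ | ⟨w, hw, hA⟩
  · exact ⟨w, Subgroup.mem_sup_left hD.mem_closure, D, hle,
      hD.mform_tip_nonpos fun d hd => (h.pos d hd).le, hM⟩
  · obtain ⟨e, he, D, h1, h2, h3⟩ := h.shrink _ hA (w.1 p) ((lor_isHyp w).2 h.isHyp) M
    refine ⟨w⁻¹ * e, mul_mem (inv_mem (Subgroup.mem_sup_left hw)) (Subgroup.mem_sup_right he),
      w⁻¹ • D, ?_, ?_, ?_⟩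
    · rwa [← form_smul_nonpos_iff w, smul_inv_smul]
    · rwa [lor_mul_apply, vec_smul, lor_mform]
    · rwa [vec_smul, mform_comm, lor_mform_inv, mform_comm]

theorem limitSet_eq (G : Subgroup lor) : limitSet (G.map toH3) =
    {x | ∃ q : H3, nvec x ∈ closure (nvecH '' {y | ∃ g ∈ G, y = g • q})} := by
  ext x
  rw [limitSet, mem_ofPred_eq, mem_ofPred_eq]
  refine exists_congr fun q => ?_
  rw [← mem_closure_ofH3_iff]
  congr! 2
  ext y
  constructor
  · rintro ⟨_, ⟨g, hg, rfl⟩, rfl⟩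
    exact ⟨_, ⟨g, hg, rfl⟩, rfl⟩
  · rintro ⟨_, ⟨g, hg, rfl⟩, rfl⟩
    exact ⟨_, ⟨g, hg, rfl⟩, rfl⟩

/-- Orbit points and a residual point share half-spaces arbitrarily far from `p`, hence small.
Conversely, the depth of an orbit in a half-space of the packing is bounded by invariance, and a
bounded depth disappears in the limit at the boundary. -/
theorem residualSet_eq (h : SymmetryDatum A B B' Γ p) (hg : GoodPair A B B') :
    residualSet (orbit B B') = limitSet ((extension B' Γ).map toH3) := by
  rw [limitSet_eq]
  ext x
  constructor
  · intro hx
    have hx' : ∀ C ∈ orbit B B', 0 ≤ C.form x := fun C hC => not_lt.1 (hx C hC)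
    refine ⟨ofHyp p h.isHyp, Metric.mem_closure_iff.2 fun η hη => ?_⟩
    obtain ⟨M, hM⟩ := h.isHyp.exists_shrink hη
    obtain ⟨g, hgG, D, h1, h2, h3⟩ := h.exists_mem_extension hg hx' M
    refine ⟨_, ⟨_, ⟨g, hgG, rfl⟩, rfl⟩, ?_⟩
    rw [dist_eq_norm]
    refine hM D h3 _ _ (isFuture_nvec x) (isFuture_nvecH _) (mtrace_nvec x) (mtrace_nvecH _) ?_ ?_
    · rwa [mform_comm, ← D.form_nonpos_iff]
    · rw [nvecH, map_smul, LinearMap.smul_apply, vecH_smul, vecH_ofHyp, smul_eq_mul]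
      exact mul_nonpos_of_nonneg_of_nonpos
        (inv_nonneg.2 ((lor_isFuture g).2 h.isHyp.1).2.le) h2
  · rintro ⟨q, hq⟩ C hC
    -- At most one half-space of the packing contains `q`; its depth serves as `M`.
    obtain ⟨M, hM0, hM⟩ : ∃ M : ℝ, 0 ≤ M ∧ ∀ C ∈ orbit B B', -M ≤ mform (vecH q) C.vec := by
      by_cases hne : ∃ C₀ ∈ orbit B B', mform (vecH q) C₀.vec ≤ 0
      · obtain ⟨C₀, hC₀, h0⟩ := hne
        refine ⟨_, neg_nonneg.2 h0, fun C hC => ?_⟩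
        by_cases hle : mform (vecH q) C.vec ≤ 0
        · rw [hg.pairwiseSep_orbit.subsingleton_nonpos (isHyp_vecH q) ⟨hC, hle⟩ ⟨hC₀, h0⟩, neg_neg]
        · linarith
      · push Not at hne
        exact ⟨0, le_rfl, fun C hC => by linarith [hne C hC]⟩
    -- The bound rescaled to trace-one vectors, where the square root is the inverse of the original
    -- trace. It is a closed condition, and its error term vanishes on light vectors.
    have hcl : IsClosed {X : Mink | 0 ≤ mform X C.vec + M * √(mform X X / 2)} :=
      isClosed_le continuous_const (by fun_prop)
    have hsub : nvecH '' {y | ∃ g ∈ extension B' Γ, y = g • q} ⊆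
        {X : Mink | 0 ≤ mform X C.vec + M * √(mform X X / 2)} := by
      rintro _ ⟨_, ⟨g, hgG, rfl⟩, rfl⟩
      rw [mem_ofPred_eq, sqrt_mform_nvecH, nvecH, map_smul, LinearMap.smul_apply, smul_eq_mul,
        vecH_smul, lor_mform_left, mul_comm M, ← mul_add]
      have h1 := hM _ (h.smul_mem_orbit (inv_mem hgG) hC)
      rw [vec_smul] at h1
      have h2 := ((lor_isFuture g).2 (isHyp_vecH q).1).2
      exact mul_nonneg (inv_nonneg.2 h2.le) (by linarith)
    have := hcl.closure_subset_iff.2 hsub hq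
    rw [mem_ofPred_eq, nvec_sq, zero_div, Real.sqrt_zero, mul_zero, add_zero, mform_comm] at this
    rw [GenCircle.interior, mem_ofPred_eq, GenCircle.form_neg_iff]
    exact this.not_gt

theorem isDiscrete (h : SymmetryDatum A B B' Γ p) (hg : GoodPair A B B') :
    IsDiscrete ((extension B' Γ).map toH3) := by
  intro q r
  obtain ⟨K, hK, hKX⟩ := (isHyp_vecH q).exists_mform_le (p := p)
  refine ((h.finite_extension hg (K * (K * (2 * Real.cosh r)))).image toH3).subset ?_
  rintro _ ⟨⟨g, hgG, rfl⟩, hr⟩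
  refine ⟨g, ⟨hgG, ?_⟩, rfl⟩
  have h1 := mform_le_of_hdist_le hr
  rw [toH3_apply, vecH_smul] at h1
  calc mform p (g.1 p) ≤ K * mform (vecH q) (g.1 p) := hKX _ ((lor_isFuture g).2 h.isHyp.1)
    _ = K * mform p (g⁻¹.1 (vecH q)) := by rw [mform_comm p, lor_mform_inv]
    _ ≤ K * (K * mform (vecH q) (g⁻¹.1 (vecH q))) :=
      mul_le_mul_of_nonneg_left (hKX _ ((lor_isFuture _).2 (isHyp_vecH q).1)) hK
    _ ≤ _ := by
      rw [mform_comm _ (g⁻¹.1 _), lor_mform_inv]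
      gcongr

theorem isGeometricallyFinite (h : SymmetryDatum A B B' Γ p) (hg : GoodPair A B B') :
    IsGeometricallyFinite ((extension B' Γ).map toH3) := by
  refine ⟨?_, h.isDiscrete hg, ofHyp p h.isHyp, ?_, ?_⟩
  · rintro _ ⟨g, -, rfl⟩
    exact toH3_mem_isometryGroup g
  · rintro _ ⟨g, hgG, rfl⟩ hgp
    have h1 := congrArg vecH hgp
    rw [toH3_apply, vecH_smul, vecH_ofHyp] at h1
    rw [h.stabilizer_extension hg hgG h1, map_one]
  · obtain ⟨T, hT, hTG, hTq⟩ := h.dirichlet_extension hg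
    refine ⟨toH3 '' T, hT.image _, image_mono hTG, ?_⟩
    ext q
    constructor
    · rintro hq _ ⟨g, hgT, rfl⟩
      exact hq _ ⟨g, hTG hgT, rfl⟩
    · rintro hq _ ⟨g, hgG, rfl⟩
      rw [hdist_le_hdist_iff, toH3_apply, vecH_smul, vecH_ofHyp]
      refine hTq _ (isHyp_vecH q) (fun e he => ?_) g hgG
      have := hq _ ⟨e, he, rfl⟩
      rwa [hdist_le_hdist_iff, toH3_apply, vecH_smul, vecH_ofHyp] at this

theorem isKleinian (h : SymmetryDatum A B B' Γ p) (hg : GoodPair A B B') :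
    IsKleinian (orbit B B') :=
  ⟨hg.disjointDense, _, h.isGeometricallyFinite hg, h.residualSet_eq hg⟩

/-- If the symmetries are generated by reflections across `R`, then the extension is generated by
the reflections across `B' ∪ R`. -/
theorem isCrystallographic {R : Set GenCircle}
    (h : SymmetryDatum A B B' (Subgroup.closure (refl '' R)) p) (hg : GoodPair A B B') :
    IsCrystallographic (orbit B B') := by
  refine ⟨hg.disjointDense, _, ?_, h.isGeometricallyFinite hg, h.residualSet_eq hg⟩
  refine ⟨toH3 '' (refl '' (B' ∪ R)), ?_, ?_⟩
  · rintro _ ⟨_, ⟨C, -, rfl⟩, rfl⟩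
    exact isReflection_refl C
  · rw [extension, ← Subgroup.closure_union, ← image_union, MonoidHom.map_closure]

end SymmetryDatum

/-! ### Images of configurations -/

theorem mapCircles_toSphere (T : lor) (B : Set GenCircle) :
    mapCircles (toSphere T) B = (fun C => T • C) '' B := by
  ext C
  constructor
  · rintro ⟨C', hC', h⟩
    rw [image_toSphere_interior] at h
    exact ⟨C', hC', (GenCircle.interior_injective h).symm⟩
  · rintro ⟨C', hC', rfl⟩
    exact ⟨C', hC', (image_toSphere_interior T C').symm⟩

theorem preserves_toSphere (T : lor) (B : Set GenCircle) :
    Preserves (toSphere T) B ↔ (fun C => T • C) '' B = B := by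
  rw [Preserves]
  simp only [image_toSphere_interior]
  rw [← image_image (g := GenCircle.interior) (f := fun C => T • C)]
  exact (GenCircle.interior_injective.image_injective).eq_iff

theorem packing_eq (B B' : Set GenCircle) : packing B B' = orbit B B' := by
  have hW : reflectionGroup B' = (Subgroup.closure (refl '' B')).map toSphere := by
    rw [MonoidHom.map_closure, image_image, reflectionGroup]
    simp only [toSphere_refl]
  ext C
  rw [packing, mem_ofPred_eq, hW]
  constructor
  · rintro ⟨_, ⟨w, hw, rfl⟩, hC⟩
    rw [mapCircles_toSphere] at hC
    obtain ⟨c, hc, rfl⟩ := hC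
    exact ⟨w, hw, c, hc, rfl⟩
  · rintro ⟨w, hw, c, hc, rfl⟩
    exact ⟨_, ⟨w, hw, rfl⟩, by rw [mapCircles_toSphere]; exact ⟨c, hc, rfl⟩⟩

end

/-! ### Transport by Lorentz transformations, and finite configurations -/

section

theorem smul_mem_accumulationPoints (T : lor) {S : Set GenCircle} {x : Sphere}
    (hx : x ∈ accumulationPoints S) :
    T • x ∈ accumulationPoints ((fun C => T • C) '' S) := by
  intro U hU hxU
  have h1 := hx ((fun y => T • y) ⁻¹' U) (hU.preimage (continuous_lor_smul T)) hxU
  refine (h1.image (f := fun C : GenCircle => T • C) (MulAction.injective T).injOn).mono ?_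
  rintro _ ⟨C, ⟨hC, hCU⟩, rfl⟩
  refine ⟨mem_image_of_mem _ hC, fun y hy => ?_⟩
  have : T⁻¹ • y ∈ C.carrier := by
    rw [GenCircle.carrier, mem_ofPred_eq, ← form_smul_eq_zero_iff T, smul_inv_smul]
    exact hy
  simpa using hCU this

theorem image_smul_image (T : lor) {α : Type*} [MulAction lor α] (S : Set α) :
    (fun x => T⁻¹ • x) '' ((fun x => T • x) '' S) = S := by
  simp [image_image]

theorem accumulationPoints_image (T : lor) (S : Set GenCircle) :
    accumulationPoints ((fun C => T • C) '' S) = (fun x => T • x) '' accumulationPoints S := by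
  ext x
  constructor
  · intro hx
    refine ⟨T⁻¹ • x, ?_, smul_inv_smul T x⟩
    have := smul_mem_accumulationPoints T⁻¹ hx
    rwa [image_smul_image] at this
  · rintro ⟨y, hy, rfl⟩
    exact smul_mem_accumulationPoints T hy

theorem PairwiseSep.image (T : lor) {S : Set GenCircle} (h : PairwiseSep S) :
    PairwiseSep ((fun C => T • C) '' S) := by
  rintro _ ⟨C, hC, rfl⟩ _ ⟨C', hC', rfl⟩ hne
  exact (sep_smul T).2 (h C hC C' hC' fun e => hne (by rw [e]))

variable {A : Set Sphere} {B B' : Set GenCircle} {Γ : Subgroup lor} {p : Mink}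

theorem GoodPair.image (h : GoodPair A B B') (T : lor) : GoodPair ((fun x => T • x) '' A)
    ((fun C => T • C) '' B) ((fun C => T • C) '' B') where
  sep := h.sep.image T
  sep' := h.sep'.image T
  nontrivial' := h.nontrivial'.image (MulAction.injective T)
  orth_or_sep := by
    rintro _ ⟨c, hc, rfl⟩ _ ⟨d, hd, rfl⟩
    rw [sep_smul, vec_smul, vec_smul, lor_mform]
    exact h.orth_or_sep c hc d hd
  crossing := by
    rintro _ ⟨d, hd, rfl⟩
    obtain ⟨c₁, h1, c₂, h2, c₃, h3, ⟨s1, s2, s3⟩, o1, o2, o3⟩ := h.crossing d hd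
    refine ⟨_, mem_image_of_mem _ h1, _, mem_image_of_mem _ h2, _, mem_image_of_mem _ h3, ?_⟩
    simp only [sep_smul, vec_smul, lor_mform]
    exact ⟨⟨s1, s2, s3⟩, o1, o2, o3⟩
  cover x hx := by
    have hx' : T⁻¹ • x ∉ A := fun h' => hx ⟨_, h', smul_inv_smul T x⟩
    rcases h.cover _ hx' with ⟨C, hC, hneg⟩ | ⟨d, hd, d', hd', hne, h1, h2⟩
    · refine Or.inl ⟨T • C, ?_, ?_⟩
      · rw [← image_union]; exact mem_image_of_mem _ hC
      · rwa [← form_smul_neg_iff T, smul_inv_smul] at hneg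
    · refine Or.inr ⟨_, mem_image_of_mem _ hd, _, mem_image_of_mem _ hd',
        fun e => hne (MulAction.injective T e), ?_, ?_⟩
      · rwa [← form_smul_eq_zero_iff T, smul_inv_smul] at h1
      · rwa [← form_smul_eq_zero_iff T, smul_inv_smul] at h2
  exists_isHyp := by
    obtain ⟨p, hp, hpd⟩ := h.exists_isHyp
    refine ⟨T.1 p, (lor_isHyp T).2 hp, ?_⟩
    rintro _ ⟨d, hd, rfl⟩
    rw [vec_smul, lor_mform]
    exact hpd d hd
  subsingleton := h.subsingleton.image _
  accumulation := by rw [← image_union, accumulationPoints_image, h.accumulation]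
  dense := by
    rintro _ ⟨a, ha, rfl⟩ U hU haU
    obtain ⟨c, hc, y, hy1, hy2⟩ := h.dense a ha _ (hU.preimage (continuous_lor_smul T)) haU
    exact ⟨T • c, mem_image_of_mem _ hc, T • y, hy1, (form_smul_neg_iff T).2 hy2⟩

/-- The conjugate of a subgroup of the Lorentz group. -/
abbrev conjGroup (T : lor) (Γ : Subgroup lor) : Subgroup lor :=
  Γ.map (MulAut.conj T).toMonoidHom

theorem conjGroup_closure (T : lor) (R : Set GenCircle) :
    conjGroup T (Subgroup.closure (refl '' R)) =
      Subgroup.closure (refl '' ((fun C => T • C) '' R)) := by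
  rw [conjGroup, MonoidHom.map_closure, image_image, image_image]
  simp only [refl_smul]
  rfl

theorem SymmetryDatum.image (h : SymmetryDatum A B B' Γ p) (T : lor) :
    SymmetryDatum ((fun x => T • x) '' A) ((fun C => T • C) '' B) ((fun C => T • C) '' B')
      (conjGroup T Γ) (T.1 p) where
  isHyp := (lor_isHyp T).2 h.isHyp
  pos := by
    rintro _ ⟨d, hd, rfl⟩
    rw [vec_smul, lor_mform]
    exact h.pos d hd
  smul_mem := by
    rintro _ ⟨e, he, rfl⟩ _ ⟨c, hc, rfl⟩
    refine ⟨e • c, h.smul_mem e he c hc, ?_⟩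
    simp [mul_smul]
  smul_mem' := by
    rintro _ ⟨e, he, rfl⟩ _ ⟨c, hc, rfl⟩
    refine ⟨e • c, h.smul_mem' e he c hc, ?_⟩
    simp [mul_smul]
  stabilizer := by
    rintro _ ⟨e, he, rfl⟩ hfix
    have h1 : (T * e * T⁻¹).1 (T.1 p) = T.1 p := hfix
    rw [lor_mul_apply, lor_mul_apply, lor_inv_apply] at h1
    rw [h.stabilizer e he (T.1.injective h1), map_one]
  finite R := by
    refine ((h.finite R).image (MulAut.conj T).toMonoidHom).subset ?_
    rintro _ ⟨⟨e, he, rfl⟩, hR⟩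
    refine ⟨e, ⟨he, ?_⟩, rfl⟩
    change mform (T.1 p) ((T * e * T⁻¹).1 (T.1 p)) ≤ R at hR
    rwa [lor_mul_apply, lor_mul_apply, lor_inv_apply, lor_mform] at hR
  dirichlet := by
    have hconj : ∀ (e : lor) (q : Mink), mform q (((MulAut.conj T).toMonoidHom e).1 (T.1 p)) =
        mform (T⁻¹.1 q) (e.1 p) := by
      intro e q
      change mform q ((T * e * T⁻¹).1 (T.1 p)) = _
      rw [lor_mul_apply, lor_mul_apply, lor_inv_apply, lor_mform_inv]
    obtain ⟨T', hT', hTΓ, S, hS, hSB, hD⟩ := h.dirichlet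
    refine ⟨_, hT'.image (MulAut.conj T).toMonoidHom, ?_, _, hS.image (fun C => T • C),
      image_mono hSB, fun q hq h1 h2 => ?_⟩
    · rintro _ ⟨e, he, rfl⟩
      exact ⟨e, hTΓ he, rfl⟩
    · obtain ⟨h3, h4⟩ := hD _ ((lor_isHyp T⁻¹).2 hq)
        (fun e he => by
          have := h1 _ (mem_image_of_mem _ he)
          rwa [hconj, ← lor_mform_inv T] at this)
        (fun d hd => by
          have := h2 _ (mem_image_of_mem _ hd)
          rwa [vec_smul, ← lor_mform_inv T] at this)
      constructor
      · rintro _ ⟨e, he, rfl⟩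
        rw [hconj, ← lor_mform_inv T]
        exact h3 e he
      · simpa only [forall_mem_image, vec_smul, ← lor_mform_inv T] using h4
  shrink := by
    rintro _ ⟨a, ha, rfl⟩ q hq M
    obtain ⟨e, he, D, h1, h2, h3⟩ := h.shrink a ha (T⁻¹.1 q) ((lor_isHyp _).2 hq) M
    refine ⟨_, ⟨e, he, rfl⟩, T • D, (form_smul_nonpos_iff T).2 h1, ?_, ?_⟩
    · change mform ((T * e * T⁻¹).1 (T.1 p)) _ ≤ 0
      rwa [lor_mul_apply, lor_mul_apply, lor_inv_apply, vec_smul, lor_mform]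
    · rwa [vec_smul, ← lor_mform_inv]

theorem SymmetryDatum.exists_of_image {T : lor}
    (h : SymmetryDatum ((fun x => T • x) '' A) ((fun C => T • C) '' B) ((fun C => T • C) '' B')
      Γ p) : SymmetryDatum A B B' (conjGroup T⁻¹ Γ) (T⁻¹.1 p) := by
  have := h.image T⁻¹
  rwa [image_smul_image, image_smul_image, image_smul_image] at this

/-- No symmetry is needed: there is no accumulation point, and the finitely many dual half-spaces
cut out the fundamental domain. -/
theorem GoodPair.exists_datum_of_finite (h : GoodPair A B B') (hfin : (B ∪ B').Finite) :
    ∃ p, SymmetryDatum A B B' ⊥ p := by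
  obtain ⟨p, hp, hpd⟩ := h.exists_isHyp
  have hA : A = ∅ := by
    rw [eq_empty_iff_forall_notMem, ← h.accumulation]
    exact fun x hx => hx univ isOpen_univ trivial (hfin.subset fun C hC => hC.1)
  refine ⟨p, hp, hpd, ?_, ?_, ?_, ?_, ?_, ?_⟩
  · rintro e he c hc
    rwa [Subgroup.mem_bot.1 he, one_smul]
  · rintro e he c hc
    rwa [Subgroup.mem_bot.1 he, one_smul]
  · exact fun e he _ => he
  · exact fun R => (finite_singleton (1 : lor)).subset fun e he => he.1
  · refine ⟨∅, finite_empty, empty_subset _, B', hfin.subset subset_union_right, Subset.rfl,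
      fun q hq _ h2 => ⟨fun e he => ?_, h2⟩⟩
    rw [Subgroup.mem_bot.1 he, lor_one_apply]
  · simp [hA]

/-! ### Möbius transformations in the Lorentz group -/

/-- The action of a matrix on Hermitian matrices, as a map of the Lorentz space. -/
def hermitianMap (k : ℝ) (α β γ δ : ℂ) : Mink →ₗ[ℝ] Mink where
  toFun X := k • ((Complex.normSq γ * X.2.2 - 2 * (γ * (starRingEnd ℂ) δ * X.2.1).re +
      Complex.normSq δ * X.1,
    α * (starRingEnd ℂ) δ * X.2.1 + β * (starRingEnd ℂ) γ * (starRingEnd ℂ) X.2.1 -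
      α * (starRingEnd ℂ) γ * X.2.2 - β * (starRingEnd ℂ) δ * X.1,
    Complex.normSq α * X.2.2 - 2 * (α * (starRingEnd ℂ) β * X.2.1).re +
      Complex.normSq β * X.1) : Mink)
  map_add' X Y := by
    rw [← smul_add]
    congr 1
    refine Prod.ext ?_ (Prod.ext ?_ ?_)
    · simp [mul_add]; ring
    · simp; ring
    · simp [mul_add]; ring
  map_smul' r X := by
    rw [RingHom.id_apply, smul_comm r k]
    congr 1
    refine Prod.ext ?_ (Prod.ext ?_ ?_)
    · simp; ring
    · simp; ring
    · simp; ring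

theorem hermitianMap_apply (k : ℝ) (α β γ δ : ℂ) (X : Mink) : hermitianMap k α β γ δ X =
  k • ((Complex.normSq γ * X.2.2 - 2 * (γ * (starRingEnd ℂ) δ * X.2.1).re +
      Complex.normSq δ * X.1,
    α * (starRingEnd ℂ) δ * X.2.1 + β * (starRingEnd ℂ) γ * (starRingEnd ℂ) X.2.1 -
      α * (starRingEnd ℂ) γ * X.2.2 - β * (starRingEnd ℂ) δ * X.1,
    Complex.normSq α * X.2.2 - 2 * (α * (starRingEnd ℂ) β * X.2.1).re +
      Complex.normSq β * X.1) : Mink) := rfl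

/-- A vector corresponds to the Hermitian matrix with rows `(c, -b)` and `(-b̄, a)`, whose
determinant is half its square; the map is `M ↦ k g M g*`. -/
theorem mform_hermitianMap (k : ℝ) (α β γ δ : ℂ) (X : Mink) :
    mform (hermitianMap k α β γ δ X) (hermitianMap k α β γ δ X) =
      k ^ 2 * Complex.normSq (α * δ - β * γ) * mform X X := by
  rw [hermitianMap_apply, map_smul, map_smul, LinearMap.smul_apply, smul_eq_mul, smul_eq_mul,
    ← mul_assoc, sq, mul_assoc (k * k)]
  congr 1
  simp only [mform_apply, Complex.normSq_apply]
  simp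
  ring

theorem hermitianMap_infty (k : ℝ) (α β γ δ : ℂ) : hermitianMap k α β γ δ (pvec OnePoint.infty) =
    k • ((Complex.normSq γ, -(α * (starRingEnd ℂ) γ), Complex.normSq α) : Mink) := by
  rw [hermitianMap_apply]; simp

theorem hermitianMap_coe (k : ℝ) (α β γ δ z : ℂ) :
    hermitianMap k α β γ δ (pvec (z : Sphere)) =
    k • ((Complex.normSq (γ * z + δ), -((α * z + β) * (starRingEnd ℂ) (γ * z + δ)),
      Complex.normSq (α * z + β)) : Mink) := by
  rw [hermitianMap_apply, pvec_coe, sq_norm_complex, sq, sq]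
  congr 1
  refine Prod.ext ?_ (Prod.ext ?_ ?_)
  · simp [Complex.normSq_apply]; ring
  · apply Complex.ext
    · simp; ring
    · simp; ring
  · simp [Complex.normSq_apply]; ring

theorem toPt_smul_mk {k : ℝ} (hk : k ≠ 0) (u w : ℂ) (c : ℝ) :
    toPt (k • ((Complex.normSq w, -(u * (starRingEnd ℂ) w), c) : Mink)) =
      if w = 0 then OnePoint.infty else ((u / w : ℂ) : Sphere) := by
  by_cases hw : w = 0
  · simp [toPt, hw]
  · have hw' : (starRingEnd ℂ) w ≠ 0 := by simpa using hw
    have hk' : (k : ℂ) ≠ 0 := by exact_mod_cast hk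
    simp [toPt, hw, hk, ← Complex.mul_conj]
    field_simp

theorem exists_lor_smul (g : GL (Fin 2) ℂ) : ∃ T : lor, ∀ x : Sphere, T • x = g • x := by
  set α := g.1 0 0 with hα
  set β := g.1 0 1 with hβ
  set γ := g.1 1 0 with hγ
  set δ := g.1 1 1 with hδ
  have hdet : α * δ - β * γ ≠ 0 := by
    have := g.det.ne_zero
    rwa [Matrix.GeneralLinearGroup.val_det_apply, Matrix.det_fin_two] at this
  -- This scale turns the factor `k² |det|²` of the form into 1.
  set k : ℝ := ‖α * δ - β * γ‖⁻¹
  have hk : 0 < k := by positivity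
  have hF : ∀ (u w : ℂ) (c : ℝ), 0 < Complex.normSq w + c → c = Complex.normSq u →
      IsFuture (k • ((Complex.normSq w, -(u * (starRingEnd ℂ) w), c) : Mink)) := by
    rintro u w c h rfl
    refine IsFuture.smul ⟨?_, h⟩ hk
    simp only [mform_apply, Complex.normSq_apply]
    simp
    apply le_of_eq
    ring
  have hpos : ∀ u w : ℂ, ¬ (u = 0 ∧ w = 0) → 0 < Complex.normSq w + Complex.normSq u := by
    intro u w h
    by_cases hw : w = 0
    · have hu : u ≠ 0 := fun hu => h ⟨hu, hw⟩
      linarith [Complex.normSq_nonneg w, Complex.normSq_pos.2 hu]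
    · linarith [Complex.normSq_nonneg u, Complex.normSq_pos.2 hw]
  obtain ⟨T, hT⟩ := exists_lor (hermitianMap k α β γ δ) (fun X => by
    rw [mform_hermitianMap, Complex.normSq_eq_norm_sq, ← mul_pow,
      inv_mul_cancel₀ (norm_ne_zero_iff.2 hdet)]
    ring) (by
    rw [hermitianMap_infty]
    exact hF _ _ _ (hpos α γ fun h => hdet (by rw [h.1, h.2]; ring)) rfl) (by
    rw [hermitianMap_coe]
    exact hF _ _ _ (hpos _ _ fun h => hdet (by simp at h; rw [h.1, h.2]; ring)) rfl)
  refine ⟨T, fun x => ?_⟩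
  rw [lor_smul_def, hT]
  induction x using OnePoint.rec with
  | infty => rw [hermitianMap_infty, toPt_smul_mk hk.ne', OnePoint.smul_infty_eq_ite]
  | coe z => rw [hermitianMap_coe, toPt_smul_mk hk.ne', OnePoint.smul_some_eq_ite]

theorem exists_lor_conj : ∃ T : lor, ∀ x : Sphere, T • x = conjPerm x := by
  obtain ⟨T, hT⟩ := exists_lor
    ((LinearMap.id : ℝ →ₗ[ℝ] ℝ).prodMap
      (Complex.conjLIE.toLinearEquiv.toLinearMap.prodMap LinearMap.id))
    (fun X => by simp [mform_apply]) (by simpa using isFuture_pvec OnePoint.infty)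
    (by simpa using isFuture_pvec ((0 : ℂ) : Sphere))
  refine ⟨T, fun x => ?_⟩
  rw [lor_smul_def, hT, conjPerm_apply]
  induction x using OnePoint.rec with
  | infty => simp [toPt]
  | coe z => simp [toPt]

theorem exists_toSphere_eq {g : Equiv.Perm Sphere} (hg : g ∈ mobius) :
    ∃ T : lor, toSphere T = g := by
  obtain ⟨G, h | h⟩ := hg
  · obtain ⟨T, hT⟩ := exists_lor_smul G
    exact ⟨T, Equiv.ext fun x => (hT x).trans (h x).symm⟩
  · obtain ⟨T, hT⟩ := exists_lor_smul G
    obtain ⟨J, hJ⟩ := exists_lor_conj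
    exact ⟨T * J, Equiv.ext fun x => by rw [toSphere_apply, mul_smul, hJ, hT, h]⟩

end

section

/-! ### Symmetries of a configuration and its dual -/

/-- The Lorentz transformations preserving a configuration and its dual. -/
def symmetries (B B' : Set GenCircle) : Subgroup lor where
  carrier := {e | (∀ c, e • c ∈ B ↔ c ∈ B) ∧ ∀ c, e • c ∈ B' ↔ c ∈ B'}
  one_mem' := by simp
  mul_mem' := fun {e f} he hf => ⟨fun c => by rw [mul_smul, he.1, hf.1],
    fun c => by rw [mul_smul, he.2, hf.2]⟩
  inv_mem' := fun {e} he => ⟨fun c => by rw [← he.1, smul_inv_smul],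
    fun c => by rw [← he.2, smul_inv_smul]⟩

variable {A : Set Sphere} {B B' : Set GenCircle} {Γ : Subgroup lor} {p : Mink}

theorem image_smul_eq_iff (T : lor) (S : Set GenCircle) :
    (fun C => T • C) '' S = S ↔ ∀ c, T • c ∈ S ↔ c ∈ S := by
  constructor
  · intro h c
    conv_lhs => rw [← h]
    exact (MulAction.injective T).mem_set_image
  · intro h
    ext c
    constructor
    · rintro ⟨c', hc', rfl⟩
      exact (h c').2 hc'
    · intro hc
      exact ⟨T⁻¹ • c, (h _).1 (by rwa [smul_inv_smul]), smul_inv_smul T c⟩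

theorem mem_symmetries_of_toSphere {T : lor} (h : toSphere T ∈ symmetryGroup B B') :
    T ∈ symmetries B B' := by
  obtain ⟨-, h1, h2⟩ := h
  rw [preserves_toSphere, image_smul_eq_iff] at h1 h2
  exact ⟨h1, h2⟩

theorem GoodPair.smul_mem_accumulation (h : GoodPair A B B') {T : lor}
    (hT : T ∈ symmetries B B') {x : Sphere} (hx : x ∈ A) : T • x ∈ A := by
  rw [← h.accumulation] at hx ⊢
  have := smul_mem_accumulationPoints T hx
  rwa [image_union, (image_smul_eq_iff T B).2 hT.1, (image_smul_eq_iff T B').2 hT.2] at this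

/-- Three base circles and a dual circle crossing them form a basis, so a symmetry is determined by
their images. Bounded displacement of `p` leaves finitely many circles for each image. -/
theorem GoodPair.finite_symmetries (h : GoodPair A B B') (hp : IsHyp p) (R : ℝ) :
    {e | e ∈ symmetries B B' ∧ mform p (e.1 p) ≤ R}.Finite := by
  have key : ∀ S : Set GenCircle, PairwiseSep S → (∀ e ∈ symmetries B B', ∀ c ∈ S, e • c ∈ S) →
      ∀ c ∈ S, ∃ F : Set GenCircle, F.Finite ∧
        ∀ e ∈ symmetries B B', mform p (e.1 p) ≤ R → e • c ∈ F := by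
    intro S hS hmem c hc
    obtain ⟨K, hK, hKX⟩ := hp.exists_mform_le (p := c.vec)
    obtain ⟨K', hK', hKX'⟩ := hp.exists_mform_le (p := -c.vec)
    refine ⟨_, hS.finite_of_bounded hp (max (K * R) (K' * R)), fun e he hR => ⟨hmem e he c hc, ?_⟩⟩
    have hf : IsFuture (e⁻¹.1 p) := (lor_isFuture _).2 hp.1
    have h1 := hKX _ hf
    have h2 := hKX' _ hf
    have h3 : mform p (e⁻¹.1 p) ≤ R := by rwa [mform_comm, lor_mform_inv]
    rw [map_neg, LinearMap.neg_apply] at h2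
    rw [vec_smul, mform_comm, lor_mform_left, abs_le]
    constructor
    · have := (mul_le_mul_of_nonneg_left h3 hK').trans (le_max_right (K * R) (K' * R))
      linarith
    · exact (h1.trans (mul_le_mul_of_nonneg_left h3 hK)).trans (le_max_left _ _)
  obtain ⟨d, hd, -⟩ := h.nontrivial'
  obtain ⟨c₁, h1, c₂, h2, c₃, h3, ⟨s1, s2, s3⟩, o1, o2, o3⟩ := h.crossing d hd
  have hli := linearIndependent_of_orthogonal s1 s2 s3 o1 o2 o3
  have hspan := hli.span_eq_top_of_card_eq_finrank' (by simp)
  have hB := key B h.sep fun e he c hc => (he.1 c).2 hc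
  obtain ⟨F₁, hF₁, m1⟩ := hB c₁ h1
  obtain ⟨F₂, hF₂, m2⟩ := hB c₂ h2
  obtain ⟨F₃, hF₃, m3⟩ := hB c₃ h3
  obtain ⟨F, hF, m⟩ := key B' h.sep' (fun e he c hc => (he.2 c).2 hc) d hd
  refine Finite.of_injOn (f := fun e : lor => (e • c₁, e • c₂, e • c₃, e • d))
    (t := F₁ ×ˢ F₂ ×ˢ F₃ ×ˢ F) ?_ ?_ (hF₁.prod (hF₂.prod (hF₃.prod hF)))
  · rintro e ⟨he, hR⟩
    exact ⟨m1 e he hR, m2 e he hR, m3 e he hR, m e he hR⟩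
  · rintro e - f - hef
    simp only [Prod.mk.injEq] at hef
    obtain ⟨e1, e2, e3, e4⟩ := hef
    have : (e.1 : Mink →ₗ[ℝ] Mink) = f.1 := by
      refine LinearMap.ext_on_range hspan fun i => ?_
      fin_cases i
      · exact congrArg GenCircle.vec e1
      · exact congrArg GenCircle.vec e2
      · exact congrArg GenCircle.vec e3
      · exact congrArg GenCircle.vec e4
    exact lor_ext fun X => LinearMap.congr_fun this X

/-- There are base points with trivial stabilizers. -/
theorem GoodPair.exists_generic (h : GoodPair A B B') (hΓ : Γ ≤ symmetries B B') :
    ∃ p, IsHyp p ∧ (∀ d ∈ B', 0 < mform p d.vec) ∧ ∀ e ∈ Γ, e.1 p = p → e = 1 := by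
  obtain ⟨p₀, hp₀, hpd⟩ := h.exists_isHyp
  obtain ⟨δ, hδ, hδB⟩ := h.sep'.exists_pos_le hp₀ hpd
  have hcount : {e : lor | e ∈ Γ ∧ e ≠ 1}.Countable := by
    refine (countable_iUnion fun n : ℕ => (h.finite_symmetries hp₀ n).countable).mono ?_
    rintro e ⟨he, -⟩
    obtain ⟨n, hn⟩ := exists_nat_ge (mform p₀ (e.1 p₀))
    exact mem_iUnion.2 ⟨n, hΓ he, hn⟩
  -- The fixed vectors of a nontrivial symmetry form a proper subspace, closed with empty interior.
  -- There are countably many symmetries, so the Baire property applies.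
  have hdense : Dense (⋂ e ∈ {e : lor | e ∈ Γ ∧ e ≠ 1}, {X : Mink | e.1 X ≠ X}) := by
    refine dense_biInter_of_isOpen (fun e _ => ?_) hcount fun e he => ?_
    · exact isOpen_ne_fun (lor_continuous e) continuous_id
    · rw [← compl_compl {X : Mink | e.1 X ≠ X}, ← interior_eq_empty_iff_dense_compl]
      by_contra hne
      have hcoe : {X : Mink | e.1 X ≠ X}ᶜ =
          ((LinearMap.ker ((e.1 : Mink →ₗ[ℝ] Mink) - LinearMap.id) : Submodule ℝ Mink) :
            Set Mink) := by
        ext X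
        simp [sub_eq_zero]
      rw [hcoe, ← ne_eq, ← nonempty_iff_ne_empty] at hne
      have := Submodule.eq_top_of_nonempty_interior' _ hne
      refine he.2 (lor_ext fun X => ?_)
      have hX : X ∈ LinearMap.ker ((e.1 : Mink →ₗ[ℝ] Mink) - LinearMap.id) := by
        rw [this]; trivial
      simpa [sub_eq_zero] using hX
  obtain ⟨K, hK, hKX⟩ := hp₀.exists_norm_sq_le
  -- Being outside all dual half-spaces is an open condition even for infinitely many of them: the
  -- norm of a dual circle is at most `L` times its product with `p₀`, so a small perturbation
  -- changes all products by less than their values.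
  have hB' : ∃ U : Set Mink, IsOpen U ∧ p₀ ∈ U ∧ ∀ X ∈ U, ∀ d ∈ B', 0 < mform X d.vec := by
    set L := √(K * (1 + 2 / δ ^ 2))
    have hL : 0 < L := by positivity
    have hnorm : ∀ d ∈ B', ‖d.vec‖ ≤ L * mform p₀ d.vec := by
      intro d hd
      have h1 := hδB d hd
      have h2 := hKX d.vec
      rw [d.vec_sq] at h2
      rw [← abs_of_nonneg (norm_nonneg d.vec), ← abs_of_pos (mul_pos hL (hpd d hd)), ← sq_le_sq,
        mul_pow, Real.sq_sqrt (by positivity)]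
      have h3 : 2 ≤ 2 / δ ^ 2 * mform p₀ d.vec ^ 2 := by
        rw [div_mul_eq_mul_div, le_div_iff₀ (by positivity)]
        gcongr
      calc ‖d.vec‖ ^ 2 ≤ K * (mform p₀ d.vec ^ 2 - -2) := h2
        _ ≤ K * (mform p₀ d.vec ^ 2 + 2 / δ ^ 2 * mform p₀ d.vec ^ 2) := by gcongr; linarith
        _ = _ := by ring
    refine ⟨Metric.ball p₀ (1 / (4 * L)), Metric.isOpen_ball, Metric.mem_ball_self (by positivity),
      fun X hX d hd => ?_⟩
    rw [Metric.mem_ball, dist_eq_norm, lt_div_iff₀ (by positivity)] at hX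
    have h1 : |mform (X - p₀) d.vec| ≤ 4 * ‖X - p₀‖ * ‖d.vec‖ := by
      have e := mform_apply (X - p₀) d.vec
      set Y := X - p₀
      set Z := d.vec
      have b1 := norm_fst_le Y
      have b2 := (norm_fst_le Y.2).trans (norm_snd_le Y)
      have b3 := (norm_snd_le Y.2).trans (norm_snd_le Y)
      have b1' := norm_fst_le Z
      have b2' := (norm_fst_le Z.2).trans (norm_snd_le Z)
      have b3' := (norm_snd_le Z.2).trans (norm_snd_le Z)
      have hr : Y.2.1.re * Z.2.1.re + Y.2.1.im * Z.2.1.im =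
          ((starRingEnd ℂ) Y.2.1 * Z.2.1).re := by simp
      have h2 : |((starRingEnd ℂ) Y.2.1 * Z.2.1).re| ≤ ‖Y‖ * ‖Z‖ := by
        refine (Complex.abs_re_le_norm _).trans ?_
        rw [norm_mul, Complex.norm_conj]
        gcongr
      have h3 : |Y.1 * Z.2.2| ≤ ‖Y‖ * ‖Z‖ := by
        rw [abs_mul]; exact mul_le_mul b1 b3' (abs_nonneg _) (norm_nonneg _)
      have h4 : |Y.2.2 * Z.1| ≤ ‖Y‖ * ‖Z‖ := by
        rw [abs_mul]; exact mul_le_mul b3 b1' (abs_nonneg _) (norm_nonneg _)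
      rw [e, hr, abs_le]
      rw [abs_le] at h2 h3 h4
      constructor <;> linarith
    have h2 := hnorm d hd
    have h3 := hpd d hd
    have h4 : 4 * ‖X - p₀‖ * ‖d.vec‖ < mform p₀ d.vec := by
      calc 4 * ‖X - p₀‖ * ‖d.vec‖ ≤ 4 * ‖X - p₀‖ * (L * mform p₀ d.vec) := by gcongr
        _ = (‖X - p₀‖ * (4 * L)) * mform p₀ d.vec := by ring
        _ < 1 * mform p₀ d.vec := by gcongr
        _ = _ := one_mul _
    rw [map_sub, LinearMap.sub_apply] at h1
    linarith [(abs_le.1 h1).1]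
  obtain ⟨U, hU, hpU, hUd⟩ := hB'
  have hV1 : IsOpen {X : Mink | 0 < mform X X} := isOpen_lt continuous_const (by fun_prop)
  have hV2 : IsOpen {X : Mink | 0 < mtrace X} := isOpen_lt continuous_const (by fun_prop)
  obtain ⟨X, ⟨hXU, hX1, hX2⟩, hX⟩ := hdense.inter_open_nonempty _ (hU.inter (hV1.inter hV2))
    ⟨p₀, hpU, hp₀.pos, hp₀.1.2⟩
  obtain ⟨r, hr, hrX⟩ := exists_isHyp_smul ⟨hX1.le, hX2⟩ hX1
  refine ⟨_, hrX, fun d hd => ?_, fun e he hfix => ?_⟩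
  · rw [map_smul, LinearMap.smul_apply, smul_eq_mul]
    exact mul_pos hr (hUd X hXU d hd)
  · by_contra hne
    rw [map_smul] at hfix
    exact mem_iInter₂.1 hX e ⟨he, hne⟩ (smul_right_injective Mink hr.ne' hfix)

end

section

/-! ### Translations -/

/-- The linear map induced by the translation by `v`. -/
def transMap (v : ℂ) : Mink →ₗ[ℝ] Mink where
  toFun X := (X.1, X.2.1 - X.1 • v, X.2.2 - 2 * (v.re * X.2.1.re + v.im * X.2.1.im) +
    X.1 * (v.re ^ 2 + v.im ^ 2))
  map_add' X Y := by
    refine Prod.ext rfl (Prod.ext ?_ ?_)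
    · simp; ring
    · simp; ring
  map_smul' r X := by
    refine Prod.ext rfl (Prod.ext ?_ ?_)
    · simp; ring
    · simp; ring

theorem transMap_apply (v : ℂ) (X : Mink) : transMap v X = (X.1, X.2.1 - X.1 • v,
    X.2.2 - 2 * (v.re * X.2.1.re + v.im * X.2.1.im) + X.1 * (v.re ^ 2 + v.im ^ 2)) := rfl

theorem transMap_pvec_coe (v z : ℂ) :
    transMap v (pvec (z : Sphere)) = pvec ((z + v : ℂ) : Sphere) := by
  rw [transMap_apply, pvec_coe, pvec_coe]
  refine Prod.ext rfl (Prod.ext ?_ ?_)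
  · simp; ring
  · simp only [sq_norm_complex]; simp; ring

theorem transMap_pvec_infty (v : ℂ) :
    transMap v (pvec OnePoint.infty) = pvec OnePoint.infty := by
  rw [transMap_apply, pvec_infty]; simp

theorem exists_trans (v : ℂ) : ∃ T : lor, ∀ X, T.1 X = transMap v X := by
  refine exists_lor (transMap v) (fun X => ?_) ?_ ?_
  · simp only [transMap_apply, mform_apply]; simp; ring
  · rw [transMap_pvec_infty]; exact isFuture_pvec _
  · rw [transMap_pvec_coe]; exact isFuture_pvec _

/-- The translation by `v`, in the Lorentz group. -/
def trans (v : ℂ) : lor := (exists_trans v).choose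

theorem trans_apply (v : ℂ) (X : Mink) : (trans v).1 X = (X.1, X.2.1 - X.1 • v,
    X.2.2 - 2 * (v.re * X.2.1.re + v.im * X.2.1.im) + X.1 * (v.re ^ 2 + v.im ^ 2)) :=
  (exists_trans v).choose_spec X

theorem trans_add (v w : ℂ) : trans (v + w) = trans v * trans w := lor_ext fun X => by
  rw [lor_mul_apply, trans_apply, trans_apply, trans_apply]
  refine Prod.ext rfl (Prod.ext ?_ ?_)
  · simp; ring
  · simp; ring

theorem trans_zero : trans 0 = 1 := lor_ext fun X => by
  rw [trans_apply]; simp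

theorem trans_neg (v : ℂ) : trans (-v) = (trans v)⁻¹ := by
  rw [eq_inv_iff_mul_eq_one, ← trans_add, neg_add_cancel, trans_zero]

theorem trans_nsmul (n : ℕ) (v : ℂ) : trans (n • v) = trans v ^ n := by
  induction n with
  | zero => rw [zero_smul, trans_zero, pow_zero]
  | succ n ih => rw [succ_nsmul, trans_add, ih, pow_succ]

theorem trans_smul_coe (v z : ℂ) : trans v • (z : Sphere) = ((z + v : ℂ) : Sphere) := by
  have h := transMap_pvec_coe v z
  rw [transMap_apply, ← trans_apply] at h
  rw [lor_smul_def, h, ← one_smul ℝ (pvec _), toPt_smul_pvec _ one_ne_zero]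

theorem trans_smul_infty (v : ℂ) : trans v • (OnePoint.infty : Sphere) = OnePoint.infty := by
  have h := transMap_pvec_infty v
  rw [transMap_apply, ← trans_apply] at h
  rw [lor_smul_def, h, ← one_smul ℝ (pvec _), toPt_smul_pvec _ one_ne_zero]

theorem IsTranslation.eq_toSphere {f : Equiv.Perm Sphere} {v : ℂ} (h : IsTranslation f v) :
    f = toSphere (trans v) := by
  ext x : 1
  rw [toSphere_apply]
  induction x using OnePoint.rec with
  | infty => rw [trans_smul_infty, h.1]
  | coe z => rw [trans_smul_coe, h.2]

/-! ### Euclidean coordinates of hyperbolic points -/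

/-- The projection of a hyperbolic point to the complex plane. -/
def foot (X : Mink) : ℂ := -(X.1⁻¹ • X.2.1)

theorem IsHyp.fst_pos {p : Mink} (hp : IsHyp p) : 0 < p.1 := hp.1.fst_pos hp.pos

/-- The first coordinate is the inverse height in the upper half-space, so this is the usual
distance formula. Equal heights reduce comparisons of hyperbolic distances to comparisons of feet in
the plane. -/
theorem mform_eq_foot {p q : Mink} (hp : IsHyp p) (hq : IsHyp q) : mform q p =
    q.1 * p.1 * ‖foot q - foot p‖ ^ 2 + q.1 / p.1 + p.1 / q.1 := by
  have h1 := hp.fst_pos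
  have h2 := hq.fst_pos
  have h := mform_future_identity q p
  rw [hp.2, hq.2] at h
  have e : q.1 * p.1 * ‖foot q - foot p‖ ^ 2 = ((q.1 * p.2.1.re - p.1 * q.2.1.re) ^ 2 +
      (q.1 * p.2.1.im - p.1 * q.2.1.im) ^ 2) / (q.1 * p.1) := by
    rw [sq_norm_complex]
    simp [foot]
    field_simp
    ring
  rw [e]
  field_simp
  linarith

theorem mform_le_iff_foot {p p' q : Mink} (hp : IsHyp p) (hp' : IsHyp p') (hq : IsHyp q)
    (h : p'.1 = p.1) : mform q p ≤ mform q p' ↔ ‖foot q - foot p‖ ≤ ‖foot q - foot p'‖ := by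
  have h1 := hp.fst_pos
  have h2 := hq.fst_pos
  rw [mform_eq_foot hp hq, mform_eq_foot hp' hq, h, add_le_add_iff_right, add_le_add_iff_right,
    mul_le_mul_iff_right₀ (by positivity), sq_le_sq, abs_norm, abs_norm]

/-- When `C.a` is non-negative, a point above the exterior of the disc is automatically outside the
half-space. -/
theorem mform_circle_eq_foot {q : Mink} (hq : IsHyp q) (C : GenCircle) :
    mform q C.vec = q.1 * C.form (foot q : Sphere) + C.a / q.1 := by
  have h1 := hq.fst_pos
  have h2 := hq.2
  rw [mform_apply] at h2
  rw [C.form_eq, pvec_coe, sq_norm_complex, mform_apply, mform_apply]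
  simp [foot, GenCircle.vec]
  field_simp
  linear_combination C.a / 2 * h2

theorem foot_trans {p : Mink} (hp : IsHyp p) (v : ℂ) : foot ((trans v).1 p) = foot p + v := by
  have h1 : (p.1 : ℂ) ≠ 0 := by exact_mod_cast hp.fst_pos.ne'
  rw [trans_apply]
  simp [foot, mul_sub, h1]
  ring

/-- The element shrinking a neighbourhood of infinity. -/
theorem exists_shrink_infty {p q : Mink} (hp : IsHyp p) (hq : IsHyp q) {u : ℂ} (hu : u ≠ 0)
    (M : ℝ) : ∃ n : ℕ, ∃ D : GenCircle, D.form OnePoint.infty ≤ 0 ∧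
      mform ((trans (n • u)).1 p) D.vec ≤ 0 ∧ M ≤ mform q D.vec := by
  have hq1 := hq.fst_pos
  have hp1 := hp.fst_pos
  have hp2 := hp.1.nonneg_snd
  -- The half-space `D` is the outside of the hemisphere of radius `R` about 0. The radius is large
  -- enough for `q` to be at depth at least `M` below it, and then `n` is large enough for the
  -- translated `p` to be beyond it.
  set R : ℝ := max 1 ((M + |q.2.2|) / q.1)
  have hR : 0 < R := lt_of_lt_of_le one_pos (le_max_left _ _)
  have hR1 : 1 ≤ R := le_max_left _ _
  have hRM : M + |q.2.2| ≤ q.1 * R := by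
    rw [mul_comm, ← div_le_iff₀ hq1]; exact le_max_right _ _
  set α := p.1 * (u.re ^ 2 + u.im ^ 2)
  set β := u.re * p.2.1.re + u.im * p.2.1.im
  have hα : 0 < α := by
    have : 0 < ‖u‖ ^ 2 := by positivity
    rw [sq_norm_complex] at this
    positivity
  obtain ⟨n, hn⟩ := exists_nat_ge (max 1 ((R ^ 2 * p.1 + 2 * β) / α))
  have hn1 : (1 : ℝ) ≤ n := (le_max_left _ _).trans hn
  have hn2 : R ^ 2 * p.1 + 2 * β ≤ n * α := by
    rw [← div_le_iff₀ hα]; exact (le_max_right _ _).trans hn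
  have hD : mform ((-(1 / R), 0, R) : Mink) (-(1 / R), 0, R) = -2 := by
    simp only [mform_apply]; simp; field_simp; norm_num
  refine ⟨n, GenCircle.ofVec (-(1 / R), 0, R) hD, ?_, ?_, ?_⟩
  · rw [GenCircle.form_eq, GenCircle.vec_ofVec]
    simp [mform_apply]
    exact hR.le
  · rw [GenCircle.vec_ofVec, trans_apply, mform_apply]
    simp
    have h1 : R ^ 2 * p.1 ≤ n * (n * α - 2 * β) := by
      have h0 : 0 ≤ R ^ 2 * p.1 := by positivity
      nlinarith
    have e : p.2.2 - 2 * (n * u.re * p.2.1.re + n * u.im * p.2.1.im) +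
        p.1 * ((n * u.re) ^ 2 + (n * u.im) ^ 2) = p.2.2 + n * (n * α - 2 * β) := by
      simp only [α, β]; ring
    rw [e]
    field_simp
    linarith
  · rw [GenCircle.vec_ofVec, mform_apply]
    simp
    have h1 : q.2.2 * R⁻¹ ≤ |q.2.2| := by
      have := inv_le_one_of_one_le₀ hR1
      calc q.2.2 * R⁻¹ ≤ |q.2.2| * R⁻¹ := by gcongr; exact le_abs_self _
        _ ≤ |q.2.2| * 1 := by gcongr
        _ = _ := mul_one _
    linarith

theorem norm_le_norm_sub_iff (x v : ℂ) :
    ‖x‖ ≤ ‖x - v‖ ↔ 2 * (v.re * x.re + v.im * x.im) ≤ ‖v‖ ^ 2 := by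
  rw [← abs_norm x, ← abs_norm (x - v), ← sq_le_sq, sq_norm_complex, sq_norm_complex,
    sq_norm_complex, Complex.sub_re, Complex.sub_im]
  constructor <;> intro h <;> nlinarith

theorem exists_norm_le_of_det {v w : ℂ} (h : v.re * w.im - v.im * w.re ≠ 0) (α β : ℝ) :
    ∃ r : ℝ, ∀ u : ℂ, |v.re * u.re + v.im * u.im| ≤ α → |w.re * u.re + w.im * u.im| ≤ β →
      ‖u‖ ≤ r := by
  have hΔ := abs_pos.2 h
  set Δ := v.re * w.im - v.im * w.re with hΔdef
  refine ⟨(α * |w.im| + β * |v.im| + (β * |v.re| + α * |w.re|)) / |Δ|, fun u h1 h2 => ?_⟩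
  rw [le_div_iff₀ hΔ]
  have key : ∀ x y s t : ℝ, |x| ≤ α → |y| ≤ β → |x * s - y * t| ≤ α * |s| + β * |t| := by
    intro x y s t hx hy
    refine (abs_sub _ _).trans ?_
    rw [abs_mul, abs_mul]
    gcongr
  have e1 : u.re * Δ = (v.re * u.re + v.im * u.im) * w.im -
      (w.re * u.re + w.im * u.im) * v.im := by rw [hΔdef]; ring
  have e2 : u.im * Δ = -((v.re * u.re + v.im * u.im) * w.re -
      (w.re * u.re + w.im * u.im) * v.re) := by rw [hΔdef]; ring
  have h3 := key _ _ w.im v.im h1 h2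
  have h4 := key _ _ w.re v.re h1 h2
  rw [← e1, abs_mul] at h3
  rw [← abs_neg, ← e2, abs_mul] at h4
  have h5 := mul_le_mul_of_nonneg_right (Complex.norm_le_abs_re_add_abs_im u) hΔ.le
  linarith

variable {A : Set Sphere} {B B' : Set GenCircle} {Γ : Subgroup lor}

theorem GoodPair.finite_of_norm_le (h : GoodPair A B B') (hA : A ⊆ {OnePoint.infty}) (z : ℂ)
    (r : ℝ) : {d ∈ B' | ∃ ζ : ℂ, ‖ζ - z‖ ≤ r ∧ d.form ζ < 0}.Finite := by
  by_contra hinf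
  rw [← Set.Infinite] at hinf
  obtain ⟨y, ⟨ζ, -, rfl⟩, hy⟩ := h.sep'.exists_mem_accumulationPoints
    ((isCompact_closedBall z r).image OnePoint.continuous_coe) (hinf.mono (by
      rintro d ⟨hd, ζ, h1, h2⟩
      exact ⟨hd, _, mem_image_of_mem _ (by simpa [dist_eq_norm] using h1), h2.le⟩))
  have h1 := accumulationPoints_mono (subset_union_right (s := B)) hy
  rw [h.accumulation] at h1
  exact OnePoint.coe_ne_infty _ (hA h1)

theorem Sep.neg_of_lines {C C' : GenCircle} (h : Sep C C') (hC : C.a = 0) (hC' : C'.a = 0) :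
    C'.b = -C.b := by
  have h0 : (C.vec + C'.vec).1 = 0 := by simp [GenCircle.vec, hC, hC']
  have := IsFuture.eq_zero_of_fst h h0
  simp only [GenCircle.vec, Prod.snd_add, Prod.fst_add] at this
  exact eq_neg_of_add_eq_zero_right this

theorem norm_line {C : GenCircle} (hC : C.a = 0) : C.b.re ^ 2 + C.b.im ^ 2 = 1 := by
  have := C.normalized
  rwa [hC, zero_mul, sub_zero, sq_norm_complex] at this

theorem line_ne_zero {C : GenCircle} (hC : C.a = 0) : C.b ≠ 0 := fun h => by
  have := norm_line hC
  simp [h] at this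

theorem PairwiseSep.finite_lines {S : Set GenCircle} (hS : PairwiseSep S) :
    {d ∈ S | d.a = 0}.Finite := by
  rcases {d ∈ S | d.a = 0}.eq_empty_or_nonempty with h | ⟨d₀, hd₀, h0⟩
  · rw [h]; exact finite_empty
  refine Finite.of_injOn (f := GenCircle.b) (t := {d₀.b, -d₀.b}) ?_ ?_ (by simp)
  · rintro d ⟨hd, hda⟩
    by_cases e : d₀ = d
    · left; rw [e]
    · right; exact (hS d₀ hd₀ d hd e).neg_of_lines h0 hda
  · rintro d ⟨hd, hda⟩ d' ⟨hd', hda'⟩ hb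
    by_contra hne
    have h1 := (hS d hd d' hd' hne).neg_of_lines hda hda'
    rw [← hb] at h1
    exact line_ne_zero hda (self_eq_neg.1 h1)

/-- A disc containing infinity would overlap its own translate. -/
theorem PairwiseSep.nonneg_of_trans {S : Set GenCircle} (hS : PairwiseSep S) {v : ℂ} (hv : v ≠ 0)
    {C : GenCircle} (hC : C ∈ S) (hT : trans v • C ∈ S) : 0 ≤ C.a := by
  by_cases e : C = trans v • C
  · have h1 : C.vec.2.1 = ((trans v).1 C.vec).2.1 :=
      congrArg (fun C : GenCircle => C.vec.2.1) e
    rw [trans_apply] at h1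
    exact ((smul_eq_zero.1 (sub_eq_self.1 h1.symm)).resolve_right hv).ge
  · have := IsFuture.nonneg_fst (hS C hC _ hT e)
    rw [vec_smul, trans_apply] at this
    simp only [GenCircle.vec, Prod.fst_add] at this
    linarith

/-- Translations keep the normal vector of a line, whereas separated lines have opposite normals. So
the line is mapped to itself, which means that it is parallel to `v`. -/
theorem PairwiseSep.line_orthogonal_trans {S : Set GenCircle} (hS : PairwiseSep S) {v : ℂ}
    {C : GenCircle} (hC : C ∈ S) (hT : trans v • C ∈ S) (ha : C.a = 0) :
    v.re * C.b.re + v.im * C.b.im = 0 := by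
  have ha' : (trans v • C).a = 0 := by
    have : (trans v • C).vec.1 = 0 := by rw [vec_smul, trans_apply]; exact ha
    exact this
  by_cases e : C = trans v • C
  · have h1 : C.vec.2.2 = ((trans v).1 C.vec).2.2 :=
      congrArg (fun C : GenCircle => C.vec.2.2) e
    rw [trans_apply] at h1
    simp only [GenCircle.vec, ha] at h1
    linarith
  · have h1 := (hS C hC _ hT e).neg_of_lines ha ha'
    have h2 : (trans v • C).vec.2.1 = C.b := by
      rw [vec_smul, trans_apply]; simp [GenCircle.vec, ha]
    have h3 : (trans v • C).b = C.b := h2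
    rw [h3] at h1
    exact absurd (self_eq_neg.1 h1) (line_ne_zero ha)

theorem GoodPair.subset_infty (h : GoodPair A B B') {v : ℂ} (hv : v ≠ 0)
    (hT : trans v ∈ symmetries B B') : A ⊆ {OnePoint.infty} := by
  intro x hx
  induction x using OnePoint.rec with
  | infty => rfl
  | coe z =>
    have h1 := h.smul_mem_accumulation hT hx
    rw [trans_smul_coe] at h1
    have := h.subsingleton hx h1
    rw [OnePoint.coe_eq_coe] at this
    exact absurd this (by simpa using hv)

/-- A symmetry datum for a group of Euclidean isometries, given a description of the Dirichlet
domains in the plane. -/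
theorem GoodPair.exists_datum (h : GoodPair A B B') (hΓ : Γ ≤ symmetries B B')
    (hfix : ∀ e ∈ Γ, ∀ X : Mink, (e.1 X).1 = X.1) {u : ℂ} (hu : u ≠ 0) (huΓ : trans u ∈ Γ)
    (hdom : ∀ p, IsHyp p → ∃ T : Set lor, T.Finite ∧ T ⊆ Γ ∧ ∃ ρ : ℝ,
      (∀ ζ : ℂ, (∀ e ∈ T, ‖ζ - foot p‖ ≤ ‖ζ - foot (e.1 p)‖) → ∀ e ∈ Γ,
        ρ < ‖foot (e.1 p) - foot p‖ → ‖ζ - foot p‖ ≤ ‖ζ - foot (e.1 p)‖) ∧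
      {d ∈ B' | ∃ ζ : ℂ, (∀ e ∈ T, ‖ζ - foot p‖ ≤ ‖ζ - foot (e.1 p)‖) ∧ d.form ζ < 0}.Finite) :
    ∃ p, SymmetryDatum A B B' Γ p := by
  obtain ⟨p, hp, hpd, hstab⟩ := h.exists_generic hΓ
  have hA := h.subset_infty hu (hΓ huΓ)
  have hfin : ∀ R : ℝ, {e | e ∈ Γ ∧ mform p (e.1 p) ≤ R}.Finite := fun R =>
    (h.finite_symmetries hp R).subset fun e he => ⟨hΓ he.1, he.2⟩
  have hfoot : ∀ e ∈ Γ, ∀ q, IsHyp q →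
      (mform q p ≤ mform q (e.1 p) ↔ ‖foot q - foot p‖ ≤ ‖foot q - foot (e.1 p)‖) :=
    fun e he q hq => mform_le_iff_foot hp ((lor_isHyp e).2 hp) hq (hfix e he p)
  refine ⟨p, hp, hpd, fun e he c hc => ((hΓ he).1 c).2 hc, fun e he c hc => ((hΓ he).2 c).2 hc,
    hstab, hfin, ?_, ?_⟩
  · obtain ⟨T, hT, hTΓ, ρ, hρ, hS⟩ := hdom p hp
    have hp1 := hp.fst_pos
    -- Elements moving the foot by at most `ρ` are finitely many and are added to `T`; the others
    -- are controlled by the hypothesis on the plane.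
    have hF : {e | e ∈ Γ ∧ ‖foot (e.1 p) - foot p‖ ≤ ρ}.Finite := by
      refine (hfin (p.1 * p.1 * ρ ^ 2 + 2)).subset ?_
      rintro e ⟨he, hle⟩
      refine ⟨he, ?_⟩
      rw [mform_comm, mform_eq_foot hp ((lor_isHyp e).2 hp), hfix e he, div_self hp1.ne', add_assoc]
      have : ‖foot (e.1 p) - foot p‖ ^ 2 ≤ ρ ^ 2 := by gcongr
      have := mul_le_mul_of_nonneg_left this (mul_pos hp1 hp1).le
      linarith
    refine ⟨T ∪ {e | e ∈ Γ ∧ ‖foot (e.1 p) - foot p‖ ≤ ρ}, hT.union hF,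
      union_subset hTΓ fun e he => he.1, _, hS, fun d hd => hd.1, fun q hq h1 h2 => ?_⟩
    have hζ : ∀ e ∈ T, ‖foot q - foot p‖ ≤ ‖foot q - foot (e.1 p)‖ := fun e he =>
      (hfoot e (hTΓ he) q hq).1 (h1 e (Or.inl he))
    refine ⟨fun e he => ?_, fun d hd => ?_⟩
    · rcases le_or_gt ‖foot (e.1 p) - foot p‖ ρ with hle | hlt
      · exact h1 e (Or.inr ⟨he, hle⟩)
      · exact (hfoot e he q hq).2 (hρ _ hζ e he hlt)
    -- Only dual discs that contain the foot of `q` impose a condition, and by hypothesis finitely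
    -- many of them meet the planar domain.
    · by_cases hneg : d.form (foot q : Sphere) < 0
      · exact h2 d ⟨hd, foot q, hζ, hneg⟩
      · have h3 := h.sep'.nonneg_of_trans hu hd (((hΓ huΓ).2 d).2 hd)
        have h4 := hq.fst_pos
        rw [mform_circle_eq_foot hq]
        exact add_nonneg (mul_nonneg h4.le (not_lt.1 hneg)) (div_nonneg h3 h4.le)
  · intro a ha q hq M
    obtain rfl : a = OnePoint.infty := hA ha
    obtain ⟨n, D, h1, h2, h3⟩ := exists_shrink_infty hp hq hu M
    exact ⟨_, by rw [trans_nsmul]; exact pow_mem huΓ n, D, h1, h2, h3⟩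

end

/-! ### Lattice and strip configurations, and their mirrors -/

section

variable {A : Set Sphere} {B B' : Set GenCircle} {Γ : Subgroup lor}

/-- Three pairwise separated circles are not all lines, since their normals would be pairwise
opposite. The translates of a base circle that is not a line are infinitely many, and they can
accumulate only at infinity. -/
theorem GoodPair.infty_mem (h : GoodPair A B B') {v : ℂ} (hv : v ≠ 0)
    (hT : trans v ∈ symmetries B B') : OnePoint.infty ∈ A := by
  obtain ⟨d, hd, -⟩ := h.nontrivial'
  obtain ⟨c₁, h1, c₂, h2, c₃, h3, ⟨s1, s2, s3⟩, -⟩ := h.crossing d hd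
  obtain ⟨c, hc, hca⟩ : ∃ c ∈ B, c.a ≠ 0 := by
    by_contra! hcon
    have a1 := hcon c₁ h1
    have a2 := hcon c₂ h2
    have a3 := hcon c₃ h3
    have e := s3.neg_of_lines a2 a3
    rw [s1.neg_of_lines a1 a2, s2.neg_of_lines a1 a3, neg_neg] at e
    exact line_ne_zero a1 (neg_eq_self.1 e)
  have hmem : ∀ n : ℕ, trans (n • v) • c ∈ B := fun n => by
    rw [trans_nsmul]
    exact ((pow_mem hT n).1 c).2 hc
  have hinj : Function.Injective fun n : ℕ => trans (n • v) • c := by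
    intro m n hmn
    have h1 : ((trans (m • v)).1 c.vec).2.1 = ((trans (n • v)).1 c.vec).2.1 :=
      congrArg (fun C : GenCircle => C.vec.2.1) hmn
    rw [trans_apply, trans_apply] at h1
    have h2 := smul_right_injective ℂ hca (sub_right_injective h1)
    simpa [hv] using h2
  have hinf : {C ∈ B | ∃ x ∈ (univ : Set Sphere), C.form x ≤ 0}.Infinite := by
    refine (infinite_range_of_injective hinj).mono ?_
    rintro _ ⟨n, rfl⟩
    obtain ⟨y, -, -, hy, -⟩ := (trans (n • v) • c).exists_two_mem_carrier
    exact ⟨hmem n, y, trivial, hy.le⟩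
  obtain ⟨y, -, hy⟩ := h.sep.exists_mem_accumulationPoints isCompact_univ hinf
  have hyA := accumulationPoints_mono (subset_union_left (t := B')) hy
  rw [h.accumulation] at hyA
  have e : y = OnePoint.infty := h.subset_infty hv hT hyA
  rwa [e] at hyA

/-- A symmetry fixes the accumulation point, which is infinity, and a reflection fixing infinity is
across a line. -/
theorem GoodPair.line_of_refl (h : GoodPair A B B') {v : ℂ} (hv : v ≠ 0)
    (hT : trans v ∈ symmetries B B') {C : GenCircle} (hC : refl C ∈ symmetries B B') :
    C.a = 0 := by
  have h1 : refl C • (OnePoint.infty : Sphere) = OnePoint.infty :=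
    h.subset_infty hv hT (h.smul_mem_accumulation hC (h.infty_mem hv hT))
  obtain ⟨r, -, e⟩ := exists_smul_pvec (refl C) OnePoint.infty
  rw [h1, refl_apply] at e
  have := congrArg Prod.fst e
  simpa [mform_apply, GenCircle.vec] using this

/-- The Lorentz transformations that act on the plane by Euclidean isometries. -/
def euclidean : Subgroup lor where
  carrier := {e | ∀ X : Mink, (e.1 X).1 = X.1}
  one_mem' := fun _ => rfl
  mul_mem' := fun {e f} he hf X => (he _).trans (hf X)
  inv_mem' := fun {e} he X => by rw [← he, lor_apply_inv]

/-- The Lorentz transformations that move the points of the plane in the direction of `v`. -/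
def along (v : ℂ) : Subgroup lor where
  carrier := {e | ∀ X : Mink, (e.1 X).1 = X.1 ∧ ∃ r : ℝ, (e.1 X).2.1 = X.2.1 + r • v}
  one_mem' := fun _ => ⟨rfl, 0, by simp⟩
  mul_mem' := fun {e f} he hf X => by
    obtain ⟨h1, r, hr⟩ := he (f.1 X)
    obtain ⟨h2, s, hs⟩ := hf X
    exact ⟨h1.trans h2, s + r, by rw [lor_mul_apply, hr, hs, add_smul, add_assoc]⟩
  inv_mem' := fun {e} he X => by
    obtain ⟨h1, r, hr⟩ := he (e⁻¹.1 X)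
    rw [lor_apply_inv] at h1 hr
    exact ⟨h1.symm, -r, by rw [hr, neg_smul, add_neg_cancel_right]⟩

theorem trans_mem_euclidean (v : ℂ) : trans v ∈ euclidean := fun X => by rw [trans_apply]

theorem refl_mem_euclidean {C : GenCircle} (hC : C.a = 0) : refl C ∈ euclidean := fun X => by
  rw [refl_apply]; simp [GenCircle.vec, hC]

theorem trans_mem_along (v : ℂ) : trans v ∈ along v := fun X => by
  rw [trans_apply]
  exact ⟨rfl, -X.1, by rw [neg_smul, ← sub_eq_add_neg]⟩

theorem refl_mem_along {C : GenCircle} (hC : C.a = 0) {v : ℂ} {s : ℝ} (hs : C.b = s • v) :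
    refl C ∈ along v := fun X => by
  rw [refl_apply]
  exact ⟨by simp [GenCircle.vec, hC], mform C.vec X * s, by simp [GenCircle.vec, hs, mul_assoc]⟩

theorem foot_trans_bound {p : Mink} (hp : IsHyp p) {v ζ : ℂ}
    (h : ∀ e ∈ ({trans v, trans (-v)} : Set lor), ‖ζ - foot p‖ ≤ ‖ζ - foot (e.1 p)‖) :
    |v.re * (ζ - foot p).re + v.im * (ζ - foot p).im| ≤ ‖v‖ ^ 2 / 2 := by
  have h1 := h _ (Or.inl rfl)
  have h2 := h _ (Or.inr rfl)
  rw [foot_trans hp, ← sub_sub, norm_le_norm_sub_iff] at h1 h2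
  rw [norm_neg, Complex.neg_re, Complex.neg_im] at h2
  rw [abs_le]
  constructor <;> linarith

/-- The Dirichlet inequalities of the two translations and their inverses confine the foot to a
parallelogram. It is bounded, so it meets finitely many dual discs, and elements moving the foot by
more than twice its radius `r` impose nothing new. -/
theorem GoodPair.exists_datum_lattice (h : GoodPair A B B') (hΓ : Γ ≤ symmetries B B')
    (hfix : Γ ≤ euclidean) {v w : ℂ} (hdet : v.re * w.im - v.im * w.re ≠ 0) (hv : trans v ∈ Γ)
    (hw : trans w ∈ Γ) : ∃ p, SymmetryDatum A B B' Γ p := by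
  have hv0 : v ≠ 0 := by rintro rfl; simp at hdet
  refine h.exists_datum hΓ (fun e he => hfix he) hv0 hv fun p hp => ?_
  obtain ⟨r, hr⟩ := exists_norm_le_of_det hdet (‖v‖ ^ 2 / 2) (‖w‖ ^ 2 / 2)
  have key : ∀ ζ : ℂ, (∀ e ∈ ({trans v, trans (-v)} ∪ {trans w, trans (-w)} : Set lor),
      ‖ζ - foot p‖ ≤ ‖ζ - foot (e.1 p)‖) → ‖ζ - foot p‖ ≤ r := fun ζ hζ =>
    hr _ (foot_trans_bound hp fun e he => hζ e (Or.inl he))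
      (foot_trans_bound hp fun e he => hζ e (Or.inr he))
  refine ⟨_, ((toFinite {trans v, trans (-v)}).union (toFinite {trans w, trans (-w)})), ?_, 2 * r,
    fun ζ hζ e he hlt => ?_, ?_⟩
  · rintro e ((rfl | rfl) | (rfl | rfl))
    · exact hv
    · rw [trans_neg]; exact inv_mem hv
    · exact hw
    · rw [trans_neg]; exact inv_mem hw
  · have h1 := key ζ hζ
    have h2 := norm_sub_le_norm_sub_add_norm_sub (foot (e.1 p)) ζ (foot p)
    rw [norm_sub_rev _ ζ] at h2
    linarith
  · refine (h.finite_of_norm_le (h.subset_infty hv0 (hΓ hv)) (foot p) r).subset ?_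
    rintro d ⟨hd, ζ, hζ, hneg⟩
    exact ⟨hd, ζ, key ζ hζ, hneg⟩

theorem det_ne_zero_of_orthogonal {v w : ℂ} (hv : v ≠ 0) (hw : w ≠ 0)
    (h : v.re * w.re + v.im * w.im = 0) : v.re * w.im - v.im * w.re ≠ 0 := by
  intro h0
  have h1 : ‖v‖ ^ 2 * ‖w‖ ^ 2 = 0 := by
    rw [sq_norm_complex, sq_norm_complex]
    linear_combination (v.re * w.re + v.im * w.im) * h + (v.re * w.im - v.im * w.re) * h0
  have : 0 < ‖v‖ ^ 2 * ‖w‖ ^ 2 := by positivity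
  linarith

/-- In a strip configuration, the dual circles lie in a parallel slab. -/
theorem GoodPair.exists_slab (h : GoodPair A B B') {v : ℂ} (hv : v ≠ 0)
    (hT : trans v ∈ symmetries B B') {L₁ L₂ : GenCircle} (h1 : L₁ ∈ B ∪ B') (h2 : L₂ ∈ B ∪ B')
    (a1 : L₁.a = 0) (a2 : L₂.a = 0) (hne : L₁ ≠ L₂) :
    v.re * L₁.b.re + v.im * L₁.b.im = 0 ∧ ∃ W : ℝ, ∀ d ∈ B', d.a ≠ 0 → ∀ ζ : ℂ, d.form ζ < 0 →
      |2 * (L₁.b.re * ζ.re + L₁.b.im * ζ.im) + L₁.c| ≤ W := by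
  have hperp : ∀ L ∈ B ∪ B', L.a = 0 → v.re * L.b.re + v.im * L.b.im = 0 := by
    rintro L (hL | hL) ha
    · exact h.sep.line_orthogonal_trans hL ((hT.1 L).2 hL) ha
    · exact h.sep'.line_orthogonal_trans hL ((hT.2 L).2 hL) ha
  refine ⟨hperp L₁ h1 a1, ?_⟩
  -- Both normals are perpendicular to `v`, so the lines cannot cross at right angles.
  have hno : mform L₁.vec L₂.vec ≠ 0 := by
    intro h0
    rw [mform_apply] at h0
    simp only [GenCircle.vec, a1, a2] at h0
    have hb : L₁.b.re * L₂.b.re + L₁.b.im * L₂.b.im = 0 := by linarith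
    have p1 := hperp L₁ h1 a1
    have p2 := hperp L₂ h2 a2
    have hd := det_ne_zero_of_orthogonal (line_ne_zero a1) (line_ne_zero a2) hb
    refine hv (Complex.ext ?_ ?_)
    · refine (mul_eq_zero.1 (?_ : _ * v.re = 0)).resolve_left hd
      linear_combination p1 * L₂.b.im - p2 * L₁.b.im
    · refine (mul_eq_zero.1 (?_ : _ * v.im = 0)).resolve_left hd
      linear_combination p2 * L₁.b.re - p1 * L₂.b.re
  have hs : Sep L₁ L₂ := by
    rcases h1 with h1 | h1 <;> rcases h2 with h2 | h2
    · exact h.sep _ h1 _ h2 hne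
    · exact (h.orth_or_sep _ h1 _ h2).resolve_left hno
    · exact ((h.orth_or_sep _ h2 _ h1).resolve_left (by rwa [mform_comm])).symm
    · exact h.sep' _ h1 _ h2 hne
  have hb := hs.neg_of_lines a1 a2
  have hW : 0 < L₁.c + L₂.c := by
    have := hs.2
    simpa [mtrace_apply, GenCircle.vec, a1, a2] using this
  have hdic : ∀ d ∈ B', d.a ≠ 0 → ∀ L ∈ B ∪ B', L.a = 0 →
      mform d.vec L.vec = 0 ∨ 2 ≤ mform d.vec L.vec := by
    rintro d hd hda L (hL | hL) ha
    · rw [mform_comm]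
      exact (h.orth_or_sep L hL d hd).imp id Sep.two_le
    · exact Or.inr (h.sep' d hd L hL (by rintro rfl; exact hda ha)).two_le
  refine ⟨2 * (L₁.c + L₂.c), fun d hd hda ζ hζ => ?_⟩
  have hpos : 0 < d.a :=
    lt_of_le_of_ne (h.sep'.nonneg_of_trans hv hd ((hT.2 d).2 hd)) hda.symm
  have e1 := hdic d hd hda L₁ h1 a1
  have e2 := hdic d hd hda L₂ h2 a2
  have f1 : mform d.vec L₁.vec = d.a * L₁.c - 2 * (d.b.re * L₁.b.re + d.b.im * L₁.b.im) := by
    simp [mform_apply, GenCircle.vec, a1]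
  have f2 : mform d.vec L₂.vec = d.a * L₂.c + 2 * (d.b.re * L₁.b.re + d.b.im * L₁.b.im) := by
    simp [mform_apply, GenCircle.vec, a2, hb]; ring
  have hDW := mul_pos hpos hW
  set F := mform d.vec L₁.vec
  -- The products of `d` with the two lines add up to `d.a * (L₁.c + L₂.c)`. Each is 0 or at least 2
  -- and they are not both 0, so the sum is at least 2; this accounts for the factor 2 in the width.
  have hF : 0 ≤ F ∧ F + 2 ≤ d.a * (2 * (L₁.c + L₂.c)) := by
    rcases e1 with e1 | e1 <;> rcases e2 with e2 | e2 <;> constructor <;> nlinarith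
  have hn := d.normalized
  rw [sq_norm_complex] at hn
  rw [d.form_eq, pvec_coe, sq_norm_complex, mform_apply] at hζ
  simp [GenCircle.vec] at hζ
  replace hζ : d.a * (ζ.re ^ 2 + ζ.im ^ 2) + 2 * (d.b.re * ζ.re + d.b.im * ζ.im) + d.c < 0 := by
    linarith
  -- Coordinates in which the disc of `d` is the unit disc about the origin.
  set y1 := d.a * ζ.re + d.b.re
  set y2 := d.a * ζ.im + d.b.im
  have hy : y1 ^ 2 + y2 ^ 2 ≤ 1 := by
    have := mul_neg_of_pos_of_neg hpos hζ
    simp only [y1, y2]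
    nlinarith
  have hu := norm_line a1
  have hcs : (L₁.b.re * y1 + L₁.b.im * y2) ^ 2 ≤ 1 := by
    have : (L₁.b.re * y1 + L₁.b.im * y2) ^ 2 + (L₁.b.re * y2 - L₁.b.im * y1) ^ 2 =
        (L₁.b.re ^ 2 + L₁.b.im ^ 2) * (y1 ^ 2 + y2 ^ 2) := by ring
    rw [hu, one_mul] at this
    nlinarith [sq_nonneg (L₁.b.re * y2 - L₁.b.im * y1)]
  have hcs' : |L₁.b.re * y1 + L₁.b.im * y2| ≤ 1 := (sq_le_one_iff_abs_le_one _).1 hcs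
  have e : d.a * (2 * (L₁.b.re * ζ.re + L₁.b.im * ζ.im) + L₁.c) =
      2 * (L₁.b.re * y1 + L₁.b.im * y2) + F := by
    rw [f1]; simp only [y1, y2]; ring
  rw [abs_le] at hcs' ⊢
  constructor
  · rw [← mul_le_mul_iff_right₀ hpos, e]; linarith
  · rw [← mul_le_mul_iff_right₀ hpos, e]; linarith

/-- The translation and its inverse bound the domain along the strip, and elements displacing by
more than `v` in the same direction give weaker inequalities. Across the strip the dual discs are
bounded by `exists_slab`; dual lines are finitely many anyway. -/
theorem GoodPair.exists_datum_strip (h : GoodPair A B B') (hΓ : Γ ≤ symmetries B B') {v : ℂ}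
    (hv : v ≠ 0) (halong : Γ ≤ along v) (hvΓ : trans v ∈ Γ) {L₁ L₂ : GenCircle}
    (h1 : L₁ ∈ B ∪ B') (h2 : L₂ ∈ B ∪ B') (a1 : L₁.a = 0) (a2 : L₂.a = 0) (hne : L₁ ≠ L₂) :
    ∃ p, SymmetryDatum A B B' Γ p := by
  obtain ⟨hperp, W, hW⟩ := h.exists_slab hv (hΓ hvΓ) h1 h2 a1 a2 hne
  have hdet := det_ne_zero_of_orthogonal hv (line_ne_zero a1) hperp
  refine h.exists_datum hΓ (fun e he X => (halong he X).1) hv hvΓ fun p hp => ?_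
  refine ⟨{trans v, trans (-v)}, toFinite _, ?_, ‖v‖, fun ζ hζ e he hlt => ?_, ?_⟩
  · rintro e (rfl | rfl)
    · exact hvΓ
    · rw [trans_neg]; exact inv_mem hvΓ
  · have hb := foot_trans_bound hp hζ
    obtain ⟨r1, r, hr⟩ := halong he p
    have hs : foot (e.1 p) = foot p + (-(p.1⁻¹ * r)) • v := by
      rw [foot, foot, r1, hr]
      module
    set s := -(p.1⁻¹ * r)
    rw [hs, add_sub_cancel_left, norm_smul, Real.norm_eq_abs] at hlt
    have hs1 : 1 < |s| := by
      by_contra! hle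
      have := mul_le_mul_of_nonneg_right hle (norm_nonneg v)
      linarith
    rw [hs, ← sub_sub, norm_le_norm_sub_iff, norm_smul, mul_pow, Real.norm_eq_abs]
    set x := ζ - foot p
    have h3 : s * (v.re * x.re + v.im * x.im) ≤ |s| * (‖v‖ ^ 2 / 2) := by
      refine (le_abs_self _).trans ?_
      rw [abs_mul]
      gcongr
    have h4 : |s| * ‖v‖ ^ 2 ≤ |s| ^ 2 * ‖v‖ ^ 2 := by
      gcongr
      nlinarith
    simp only [Complex.smul_re, Complex.smul_im, smul_eq_mul]
    linarith
  · set q := foot p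
    obtain ⟨r, hr⟩ := exists_norm_le_of_det hdet (‖v‖ ^ 2 / 2)
      ((W + |L₁.c| + 2 * |L₁.b.re * q.re + L₁.b.im * q.im|) / 2)
    refine (h.sep'.finite_lines.union
      (h.finite_of_norm_le (h.subset_infty hv (hΓ hvΓ)) q r)).subset ?_
    rintro d ⟨hd, ζ, hζ, hneg⟩
    by_cases hda : d.a = 0
    · exact Or.inl ⟨hd, hda⟩
    · refine Or.inr ⟨hd, ζ, hr _ (foot_trans_bound hp hζ) ?_, hneg⟩
      have h3 := abs_le.1 (hW d hd hda ζ hneg)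
      have h4 := neg_abs_le L₁.c
      have h5 := le_abs_self L₁.c
      have h6 := neg_abs_le (L₁.b.re * q.re + L₁.b.im * q.im)
      have h7 := le_abs_self (L₁.b.re * q.re + L₁.b.im * q.im)
      rw [Complex.sub_re, Complex.sub_im, abs_le]
      constructor <;> linarith

/-! ### Reflective symmetries -/

theorem toSphere_injective : Function.Injective toSphere := by
  intro S T h
  have hC : ∀ C : GenCircle, S.1 C.vec = T.1 C.vec := fun C => by
    have : S • C = T • C := GenCircle.interior_injective (by
      rw [← image_toSphere_interior, ← image_toSphere_interior, h])
    exact congrArg GenCircle.vec this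
  have hX : ∀ X : Mink, mform X X = -2 → S.1 X = T.1 X := fun X h => hC (GenCircle.ofVec X h)
  have e1 := hX (0, 1, 0) (by simp [mform_apply])
  have e2 := hX (0, Complex.I, 0) (by simp [mform_apply])
  have e3 := hX (1, 1, 0) (by simp [mform_apply])
  have e4 := hX (0, 1, 1) (by simp [mform_apply])
  refine lor_ext fun X => ?_
  have hdec : X = X.1 • ((1, 1, 0) : Mink) + X.2.2 • ((0, 1, 1) : Mink) +
      (X.2.1.re - X.1 - X.2.2) • ((0, 1, 0) : Mink) + X.2.1.im • ((0, Complex.I, 0) : Mink) := by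
    refine Prod.ext (by simp) (Prod.ext ?_ (by simp))
    apply Complex.ext <;> simp
  rw [hdec]
  simp only [map_add, map_smul, e1, e2, e3, e4]

/-- The circles whose reflections preserve a configuration and its dual. -/
def mirrors (B B' : Set GenCircle) : Set GenCircle := {C | refl C ∈ symmetries B B'}

theorem closure_mirrors_le : Subgroup.closure (refl '' mirrors B B') ≤ symmetries B B' := by
  rw [Subgroup.closure_le]
  rintro _ ⟨C, hC, rfl⟩
  exact hC

theorem mem_closure_of_maxReflective {T : lor}
    (h : toSphere T ∈ maxReflective (symmetryGroup B B')) :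
    T ∈ Subgroup.closure (refl '' mirrors B B') := by
  have hle : maxReflective (symmetryGroup B B') ≤
      (Subgroup.closure (refl '' mirrors B B')).map toSphere := by
    rw [maxReflective, Subgroup.closure_le]
    rintro f ⟨hf, C, rfl⟩
    rw [← toSphere_refl] at hf ⊢
    exact ⟨_, Subgroup.subset_closure (mem_image_of_mem _ (mem_symmetries_of_toSphere hf)), rfl⟩
  obtain ⟨S, hS, e⟩ := hle h
  rwa [← toSphere_injective e]

theorem refl_mul_trans {C : GenCircle} (hC : C.a = 0) (k : ℝ) :
    refl C * trans (-(k • C.b)) = trans (k • C.b) * refl C := lor_ext fun X => by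
  have hn := norm_line hC
  rw [lor_mul_apply, lor_mul_apply, refl_apply, refl_apply, trans_apply, trans_apply]
  simp only [mform_apply, GenCircle.vec, hC]
  refine Prod.ext (by simp) (Prod.ext (Complex.ext ?_ ?_) ?_)
  · simp
    linear_combination (-2 * X.1 * k * C.b.re) * hn
  · simp
    linear_combination (-2 * X.1 * k * C.b.im) * hn
  · simp
    linear_combination (-2 * k * (2 * (C.b.re * X.2.1.re + C.b.im * X.2.1.im))) * hn

/-- The mirror of a strip configuration that is perpendicular to the strip. -/
theorem GoodPair.exists_mirror (h : GoodPair A B B') {v : ℂ} (hv : v ≠ 0)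
    (hT : trans v ∈ Subgroup.closure (refl '' mirrors B B')) {L₁ : GenCircle} (h1 : L₁ ∈ B ∪ B')
    (a1 : L₁.a = 0) : ∃ C ∈ mirrors B B', C.a = 0 ∧ ∃ s : ℝ, C.b = s • v := by
  have hTs := closure_mirrors_le hT
  have hline : ∀ C ∈ mirrors B B', C.a = 0 := fun C hC => h.line_of_refl hv hTs hC
  have hperp : ∀ L ∈ B ∪ B', L.a = 0 → v.re * L.b.re + v.im * L.b.im = 0 := by
    rintro L (hL | hL) ha
    · exact h.sep.line_orthogonal_trans hL ((hTs.1 L).2 hL) ha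
    · exact h.sep'.line_orthogonal_trans hL ((hTs.2 L).2 hL) ha
  by_contra! hcon
  -- A mirror sends `L₁` to a line of the configurations, whose normal is again perpendicular to
  -- `v`. Hence the mirror is perpendicular or parallel to the strip, and the first case is excluded
  -- by assumption.
  have hmir : ∀ C ∈ mirrors B B', v.re * C.b.re + v.im * C.b.im = 0 := by
    intro C hC
    have ha := hline C hC
    have p1 := hperp L₁ h1 a1
    have hmem : refl C • L₁ ∈ B ∪ B' :=
      h1.imp (fun h1 => (hC.1 L₁).2 h1) fun h1 => (hC.2 L₁).2 h1
    have ea : (refl C • L₁).vec.1 = 0 := by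
      rw [vec_smul, refl_apply]; simp [GenCircle.vec, ha, a1]
    have eb : (refl C • L₁).vec.2.1 =
        L₁.b + (-2 * (C.b.re * L₁.b.re + C.b.im * L₁.b.im)) • C.b := by
      rw [vec_smul, refl_apply]; simp [GenCircle.vec, ha, a1, mform_apply]
    have p2 := hperp _ hmem ea
    change v.re * (refl C • L₁).vec.2.1.re + v.im * (refl C • L₁).vec.2.1.im = 0 at p2
    rw [eb] at p2
    simp only [Complex.add_re, Complex.add_im, Complex.smul_re, Complex.smul_im,
      smul_eq_mul] at p2
    have hprod : (C.b.re * L₁.b.re + C.b.im * L₁.b.im) *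
        (v.re * C.b.re + v.im * C.b.im) = 0 := by linarith
    refine (mul_eq_zero.1 hprod).resolve_left fun h0 => ?_
    have hn := norm_line a1
    set k := v.im * L₁.b.re - v.re * L₁.b.im
    have hk : k ≠ 0 := fun hk => hv <| Complex.ext
      (by rw [Complex.zero_re]
          linear_combination (-v.re) * hn + L₁.b.re * p1 - L₁.b.im * hk)
      (by rw [Complex.zero_im]
          linear_combination (-v.im) * hn + L₁.b.im * p1 + L₁.b.re * hk)
    refine hcon C hC ha ((C.b.im * L₁.b.re - C.b.re * L₁.b.im) / k) ?_
    rw [div_eq_inv_mul, mul_smul, eq_inv_smul_iff₀ hk]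
    apply Complex.ext
    · simp only [Complex.smul_re, smul_eq_mul, k]
      linear_combination v.im * h0 - C.b.im * p1
    · simp only [Complex.smul_im, smul_eq_mul, k]
      linear_combination -v.re * h0 + C.b.re * p1
  -- Reflections in mirrors parallel to `v` fix the vector `(0, v, 0)`, while the translation by `v`
  -- changes its last coordinate by `-2 ‖v‖²`.
  have hfix : Subgroup.closure (refl '' mirrors B B') ≤
      (MulAction.stabilizer (Mink ≃ₗ[ℝ] Mink) ((0, v, 0) : Mink)).comap lor.subtype := by
    rw [Subgroup.closure_le]
    rintro _ ⟨C, hC, rfl⟩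
    change (refl C).1 _ = _
    have ha := hline C hC
    have hb := hmir C hC
    rw [refl_apply_of_eq_zero]
    simp [mform_apply, GenCircle.vec, ha]
    linarith
  have h2 : (trans v).1 (0, v, 0) = (0, v, 0) := hfix hT
  rw [trans_apply] at h2
  have h3 := congrArg (fun X : Mink => X.2.2) h2
  simp at h3
  have h4 : 0 < ‖v‖ ^ 2 := by positivity
  rw [sq_norm_complex] at h4
  nlinarith

/-- The full mirror group may contain reflections in lines parallel to the strip, which do not move
points along `v`. The infinite dihedral group of one perpendicular mirror and its translate by `v /
2` suffices, and it contains the translation by `v`. -/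
theorem GoodPair.exists_reflective_strip (h : GoodPair A B B') {v : ℂ} (hv : v ≠ 0)
    (hT : trans v ∈ Subgroup.closure (refl '' mirrors B B')) {L₁ L₂ : GenCircle}
    (h1 : L₁ ∈ B ∪ B') (h2 : L₂ ∈ B ∪ B') (a1 : L₁.a = 0) (a2 : L₂.a = 0) (hne : L₁ ≠ L₂) :
    ∃ R : Set GenCircle, ∃ p, SymmetryDatum A B B' (Subgroup.closure (refl '' R)) p := by
  obtain ⟨C, hC, ha, s, hs⟩ := h.exists_mirror hv hT h1 a1
  have hs0 : s ≠ 0 := by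
    rintro rfl
    rw [zero_smul] at hs
    exact line_ne_zero ha hs
  -- Chosen so that `k • C.b` is `v / 2`; the product of the reflections in the two mirrors is then
  -- the translation by `v`.
  set k := (2 * s)⁻¹
  have hk : k • C.b + k • C.b = v := by
    rw [hs, ← add_smul, smul_smul, show (k + k) * s = 1 by simp only [k]; field_simp; norm_num,
      one_smul]
  set C' := trans (k • C.b) • C
  have hC' : refl C' = trans v * refl C := by
    rw [refl_smul, mul_assoc, ← trans_neg, refl_mul_trans ha, ← mul_assoc, ← trans_add, hk]
  have ha' : C'.a = 0 := by
    have : C'.vec.1 = 0 := by rw [vec_smul, trans_apply]; exact ha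
    exact this
  have hb' : C'.b = s • v := by
    have : C'.vec.2.1 = C.b := by rw [vec_smul, trans_apply]; simp [GenCircle.vec, ha]
    exact this.trans hs
  have hmem : refl C ∈ Subgroup.closure (refl '' {C, C'}) :=
    Subgroup.subset_closure ⟨C, Or.inl rfl, rfl⟩
  have hmem' : refl C' ∈ Subgroup.closure (refl '' {C, C'}) :=
    Subgroup.subset_closure ⟨C', Or.inr rfl, rfl⟩
  refine ⟨{C, C'}, h.exists_datum_strip ?_ hv ?_ ?_ h1 h2 a1 a2 hne⟩
  · rw [Subgroup.closure_le]
    rintro _ ⟨_, rfl | rfl, rfl⟩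
    · exact hC
    · rw [hC']; exact mul_mem (closure_mirrors_le hT) hC
  · rw [Subgroup.closure_le]
    rintro _ ⟨_, rfl | rfl, rfl⟩
    · exact refl_mem_along ha hs
    · exact refl_mem_along ha' hb'
  · have : trans v = refl C' * refl C := by
      rw [hC', mul_assoc, refl_mul_self, mul_one]
    rw [this]
    exact mul_mem hmem' hmem

/-- All mirrors are lines, so their reflections are Euclidean isometries and the whole mirror group
can be used. -/
theorem GoodPair.exists_reflective_lattice (h : GoodPair A B B') {v w : ℂ}
    (hdet : v.re * w.im - v.im * w.re ≠ 0)
    (hv : trans v ∈ Subgroup.closure (refl '' mirrors B B'))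
    (hw : trans w ∈ Subgroup.closure (refl '' mirrors B B')) :
    ∃ R : Set GenCircle, ∃ p, SymmetryDatum A B B' (Subgroup.closure (refl '' R)) p := by
  have hv0 : v ≠ 0 := by rintro rfl; simp at hdet
  refine ⟨mirrors B B', h.exists_datum_lattice closure_mirrors_le ?_ hdet hv hw⟩
  rw [Subgroup.closure_le]
  rintro _ ⟨C, hC, rfl⟩
  exact refl_mem_euclidean (h.line_of_refl hv0 (closure_mirrors_le hv) hC)

theorem IsStrip.exists_lines {S : Set GenCircle} (h : IsStrip S) :
    ∃ L₁ ∈ S, ∃ L₂ ∈ S, L₁.a = 0 ∧ L₂.a = 0 ∧ L₁ ≠ L₂ := by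
  obtain ⟨C, hC, C', hC', h1, h2, h3⟩ := h
  refine ⟨C, hC, C', hC', h1, h2, ?_⟩
  rintro rfl
  obtain ⟨x, y, hxy, hx, hy⟩ := C.exists_two_mem_carrier
  have hx' : x ∈ C.carrier ∩ C.carrier := ⟨hx, hx⟩
  have hy' : y ∈ C.carrier ∩ C.carrier := ⟨hy, hy⟩
  rw [h3] at hx' hy'
  exact hxy (hx'.trans hy'.symm)

theorem det_ne_zero_of_linearIndependent {v : Fin 2 → ℂ} (h : LinearIndependent ℝ v) :
    (v 0).re * (v 1).im - (v 0).im * (v 1).re ≠ 0 := by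
  intro h0
  have h' := Fintype.linearIndependent_iff.1 h
  have h1 := h' ![(v 1).im, -(v 0).im] (by
    rw [Fin.sum_univ_two]
    apply Complex.ext <;> simp <;> linarith)
  have h2 := h' ![(v 1).re, -(v 0).re] (by
    rw [Fin.sum_univ_two]
    apply Complex.ext <;> simp <;> linarith)
  have e1 := h1 1
  have e2 := h2 1
  simp at e1 e2
  exact h.ne_zero 0 (Complex.ext e2 e1)

end

/-! ### The conditions of the theorem, transported back to the original configuration -/

section

variable {A : Set Sphere} {B B' : Set GenCircle}

theorem GoodPair.isKleinian_of_strip (h : GoodPair A B B')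
    (hs : StripCondition (fun G => G) B B') : IsKleinian (orbit B B') := by
  obtain ⟨g, hg, hstrip, f, hf, v, hv, htr⟩ := hs
  obtain ⟨T, rfl⟩ := exists_toSphere_eq hg
  rw [mapCircles_toSphere, mapCircles_toSphere] at hstrip hf
  rw [htr.eq_toSphere] at hf
  obtain ⟨L₁, h1, L₂, h2, a1, a2, hne⟩ := hstrip.exists_lines
  obtain ⟨p, hp⟩ := (h.image T).exists_datum_strip (Γ := Subgroup.closure {trans v})
    (by simpa using mem_symmetries_of_toSphere hf) hv (by simpa using trans_mem_along v)
    (Subgroup.subset_closure rfl) h1 h2 a1 a2 hne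
  exact hp.exists_of_image.isKleinian h

theorem GoodPair.isKleinian_of_lattice (h : GoodPair A B B')
    (hl : LatticeCondition (fun G => G) B B') : IsKleinian (orbit B B') := by
  obtain ⟨g, hg, f₁, hf₁, f₂, hf₂, v, hv, htr₁, htr₂⟩ := hl
  obtain ⟨T, rfl⟩ := exists_toSphere_eq hg
  rw [mapCircles_toSphere, mapCircles_toSphere] at hf₁ hf₂
  rw [htr₁.eq_toSphere] at hf₁
  rw [htr₂.eq_toSphere] at hf₂
  obtain ⟨p, hp⟩ := (h.image T).exists_datum_lattice
    (Γ := Subgroup.closure {trans (v 0), trans (v 1)})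
    ((Subgroup.closure_le _).2 (insert_subset (mem_symmetries_of_toSphere hf₁)
      (singleton_subset_iff.2 (mem_symmetries_of_toSphere hf₂))))
    ((Subgroup.closure_le _).2 (insert_subset (trans_mem_euclidean _)
      (singleton_subset_iff.2 (trans_mem_euclidean _))))
    (det_ne_zero_of_linearIndependent hv) (Subgroup.subset_closure (Or.inl rfl))
    (Subgroup.subset_closure (Or.inr rfl))
  exact hp.exists_of_image.isKleinian h

theorem GoodPair.isCrystallographic_of_image (h : GoodPair A B B') {T : lor}
    (hd : ∃ R : Set GenCircle, ∃ p, SymmetryDatum ((fun x => T • x) '' A)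
      ((fun C => T • C) '' B) ((fun C => T • C) '' B') (Subgroup.closure (refl '' R)) p) :
    IsCrystallographic (orbit B B') := by
  obtain ⟨R, p, hp⟩ := hd
  have := hp.exists_of_image
  rw [conjGroup_closure] at this
  exact this.isCrystallographic h

theorem GoodPair.isCrystallographic_of_strip (h : GoodPair A B B')
    (hs : StripCondition maxReflective B B') : IsCrystallographic (orbit B B') := by
  obtain ⟨g, hg, hstrip, f, hf, v, hv, htr⟩ := hs
  obtain ⟨T, rfl⟩ := exists_toSphere_eq hg
  rw [mapCircles_toSphere, mapCircles_toSphere] at hstrip hf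
  rw [htr.eq_toSphere] at hf
  obtain ⟨L₁, h1, L₂, h2, a1, a2, hne⟩ := hstrip.exists_lines
  exact h.isCrystallographic_of_image ((h.image T).exists_reflective_strip hv
    (mem_closure_of_maxReflective hf) h1 h2 a1 a2 hne)

theorem GoodPair.isCrystallographic_of_lattice (h : GoodPair A B B')
    (hl : LatticeCondition maxReflective B B') : IsCrystallographic (orbit B B') := by
  obtain ⟨g, hg, f₁, hf₁, f₂, hf₂, v, hv, htr₁, htr₂⟩ := hl
  obtain ⟨T, rfl⟩ := exists_toSphere_eq hg
  rw [mapCircles_toSphere, mapCircles_toSphere] at hf₁ hf₂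
  rw [htr₁.eq_toSphere] at hf₁
  rw [htr₂.eq_toSphere] at hf₂
  exact h.isCrystallographic_of_image ((h.image T).exists_reflective_lattice
    (det_ne_zero_of_linearIndependent hv) (mem_closure_of_maxReflective hf₁)
    (mem_closure_of_maxReflective hf₂))

theorem GoodPair.isCrystallographic_of_finite (h : GoodPair A B B') (hfin : (B ∪ B').Finite) :
    IsCrystallographic (orbit B B') := by
  obtain ⟨p, hp⟩ := h.exists_datum_of_finite hfin
  rw [← Subgroup.closure_empty, ← image_empty refl] at hp
  exact hp.isCrystallographic h

end

end CirclePacking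

end

theorem mainTheorem6 (B B' : Set CirclePacking.GenCircle) (h : CirclePacking.IsBaseDual B B') :
    (((B ∪ B').Finite ∨
        CirclePacking.StripCondition (fun G => G) B B' ∨
        CirclePacking.LatticeCondition (fun G => G) B B') →
      CirclePacking.IsKleinian (CirclePacking.packing B B')) ∧
    (((B ∪ B').Finite ∨
        CirclePacking.StripCondition CirclePacking.maxReflective B B' ∨
        CirclePacking.LatticeCondition CirclePacking.maxReflective B B') →
      CirclePacking.IsCrystallographic (CirclePacking.packing B B')) := by
  obtain ⟨D, hD⟩ := h.exists_dualConfig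
  have hg := hD.goodPair
  rw [CirclePacking.packing_eq]
  constructor
  · rintro (hfin | hs | hl)
    · exact (hg.exists_datum_of_finite hfin).choose_spec.isKleinian hg
    · exact hg.isKleinian_of_strip hs
    · exact hg.isKleinian_of_lattice hl
  · rintro (hfin | hs | hl)
    · exact hg.isCrystallographic_of_finite hfin
    · exact hg.isCrystallographic_of_strip hs
    · exact hg.isCrystallographic_of_lattice hl
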